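/- **Setting.** Let $\mathbb R^{1|1}$ have coordinates $(x,\theta)$, with $\theta$ odd, and put $\eta=\partial_\theta+\theta\partial_x$, $\overline\eta=\partial_\theta-\theta\partial_x$, $\alpha=dx+\theta d\theta$. For homogeneous $F\in\mathbb R[x,\theta]$ of parity $|F|$ let $X_F=F\partial_x-\tfrac12(-1)^{|F|}\overline\eta(F)\overline\eta$, and let $\mathfrak{osp}(1|2)=\mathrm{Span}(X_1,X_\theta,X_x,X_{x\theta},X_{x^2})$. For $\lambda\in\mathbb R$ let $\mathfrak F_\lambda=\mathbb R[x,\theta]\,\alpha^\lambda$ with the action $\mathfrak L^\lambda_{X_G}=X_G+\lambda G'$, where $G'=\partial_xG$. For $\delta\in\mathbb R$ let $\mathfrak S_\delta=\bigoplus_{k\ge0}\mathfrak F_{\delta-k/2}$, with the resulting action $\mathfrak L$ of $\mathfrak{osp}(1|2)$. If $2\delta$ is a positive integer put $m=2\delta$; otherwise put $m=0$. Consider the $1$-cocycles $$\Upsilon'_{2\delta-j}(X_G)=G':\ \mathfrak F_{\delta-j/2}\to\mathfrak F_{\delta-j/2}\qquad(j\ge0)$$ and, for $1\le k\le m$, the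 $1$-cocycles with values in the differential operators $\mathfrak F_{(1-k)/2}\to\mathfrak F_{k/2}$ $$\Upsilon_k(X_G)=(-1)^{|G|}\eta^2(G)\,\overline\eta^{\,2k-1},\qquad \widetilde\Upsilon_k(X_G)=(-1)^{|G|}\big((k-1)\eta^4(G)\,\overline\eta^{\,2k-3}+\eta^3(G)\,\overline\eta^{\,2k-2}\big).$$ Let $A=\bigoplus_{n\ge0}A_n$ be a graded supercommutative associative unital $\mathbb R$-superalgebra (for example, the parameters subject to homogeneous relations) and let $\widehat A=\prod_nA_n$. For a family $t=(\mathfrak a_{2\delta-j},\mathfrak b_k,\mathfrak c_k)_{j\ge0,\,1\le k\le m}$ in $\widehat A$, with $\mathfrak a_{2\delta-j}$ even and $\mathfrak b_k,\mathfrak c_k$ odd, put $$\mathfrak L^{(1)}_{X_F}(t)=\sum_{j\ge0}\mathfrak a_{2\delta-j}\,\Upsilon'_{2\delta-j}(X_F)+\sum_{k=1}^m\big(\mathfrak b_k\Upsilon_k(X_F)+\mathfrak c_k\widetilde\Upsilon_k(X_F)\big).$$ A differential operator on $\mathfrak S_\delta$ is a linear operator all of whose components $\mathfrak F_{\delta-j/2}\to\mathfrak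 F_{\delta-i/2}$ are differential operators, with finitely many non-zero components for each $j$; with coefficients in $A_n$ the definition is the same. A formal deformation of $\mathfrak S_\delta$ with base $A$ is a parity-preserving linear map $\rho=\mathfrak L+\rho_1+\rho_2+\cdots$ on $\mathfrak{osp}(1|2)$, where $\rho_n$ takes values in differential operators with coefficients in $A_n$, such that $\rho(X)\rho(Y)-(-1)^{|X||Y|}\rho(Y)\rho(X)=\rho([X,Y])$ for homogeneous $X,Y$. Two such are equivalent if they are conjugate under some $1+I_1+I_2+\cdots$, where $I_n$ is an even differential operator with coefficients in $A_n$. **Theorem.** (1) Suppose that the components of $t$ lie in $A_1$. There is a formal deformation $\rho$ with $\rho_1=\mathfrak L^{(1)}(t)$ if and only if $$\mathfrak b_k\mathfrak a_{1-k}-\mathfrak c_k\mathfrak a_k+\mathfrak c_k\mathfrak a_{1-k}=0\quad\text{in }A,\qquad 1\le k\le m.\tag{$*$}$$ (For $m=0$ there is no condition.) (2) Every formal deformation $\rho$ of $\mathfrak S_\delta$ with base $A$ is equivalent to a deformation $\mathfrak L+\mathfrak L^{(1)}(t)$ of first order in its parameters, where $t$ is a family of formal series $t=t_1+t_2+\cdots$,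 with $t_n$ in $A_n$, that satisfies $(*)$ in $\widehat A$. If $\rho_1=\mathfrak L^{(1)}(s)$ with $s$ in $A_1$, then $t_1=s$. In other words, every formal deformation is equivalent to its infinitesimal part, up to a formal change $s\mapsto s+t_2+t_3+\cdots$ of the parameters. -/

import Mathlib

open scoped Polynomial PowerSeries

noncomputable section

/-! ## Superfunctions on the `1|1`-dimensional superline, with coefficients in a superalgebra

`SuperFun A` is the space `ℝ[x, θ] ⊗ A`.  The pair `(f₀, f₁)` of polynomials with coefficients in
`A` stands for `f₀(x) + θ f₁(x)`, the scalars of `A` being written on the right of `x` and `θ`.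
It is a right `A`-module, that is, a module over `Aᵐᵒᵖ`; for `A = ℝ` it is `ℝ[x, θ]` itself. -/

/-- The superspace of polynomial superfunctions `f₀ + θ f₁` with coefficients in `A`. -/
abbrev SuperFun (A : Type*) [Ring A] : Type _ := A[X] × A[X]

/-- Right `A`-linear operators on superfunctions, that is, linear maps
`ℝ[x, θ] → ℝ[x, θ] ⊗ A`, extended `A`-linearly. -/
abbrev SuperOp (A : Type*) [Ring A] : Type _ := Module.End Aᵐᵒᵖ (SuperFun A)

section Operators

variable (A : Type*) [Ring A]

/-- The derivative of polynomials over a possibly noncommutative ring, as a right linear map. -/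
def polyDeriv : A[X] →ₗ[Aᵐᵒᵖ] A[X] where
  toFun f := Polynomial.derivative f
  map_add' f g := by simp
  map_smul' a f := by
    ext n
    have h := (Nat.cast_commute (n + 1) a.unop).eq
    push_cast at h
    simp only [Polynomial.coeff_derivative, Polynomial.coeff_smul, RingHom.id_apply,
      MulOpposite.smul_eq_mul_unop, mul_assoc, h]

/-- Left multiplication by a polynomial with coefficients in `A`, as a right linear map. -/
def polyMul {A : Type*} [Ring A] (c : A[X]) : A[X] →ₗ[Aᵐᵒᵖ] A[X] where
  toFun f := c * f
  map_add' f g := mul_add c f g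
  map_smul' a f := by
    ext n
    simp only [Polynomial.coeff_mul, Polynomial.coeff_smul, RingHom.id_apply,
      MulOpposite.smul_eq_mul_unop, Finset.sum_mul, mul_assoc]

/-- `∂ₓ`. -/
def dX : SuperOp A := (polyDeriv A).prodMap (polyDeriv A)

/-- `∂_θ : f₀ + θ f₁ ↦ f₁`. -/
def dTheta : SuperOp A := LinearMap.inl Aᵐᵒᵖ A[X] A[X] ∘ₗ LinearMap.snd Aᵐᵒᵖ A[X] A[X]

/-- Multiplication by `θ : f₀ + θ f₁ ↦ θ f₀`. -/
def thetaMul : SuperOp A := LinearMap.inr Aᵐᵒᵖ A[X] A[X] ∘ₗ LinearMap.fst Aᵐᵒᵖ A[X] A[X]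

/-- The parity operator `f₀ + θ f₁ ↦ f₀ - θ f₁`; for homogeneous `F ∈ ℝ[x, θ]` it is
`F ↦ (-1) ^ p(F) F`. -/
def parityOp : SuperOp A := LinearMap.prodMap LinearMap.id (-LinearMap.id)

/-- The odd vector field `η = ∂_θ + θ ∂ₓ`. -/
def etaOp : SuperOp A := dTheta A + thetaMul A * dX A

/-- The odd vector field `η̄ = ∂_θ - θ ∂ₓ`, which spans the contact distribution. -/
def etaBarOp : SuperOp A := dTheta A - thetaMul A * dX A

variable {A}

/-- The operator `f₀ + θ f₁ ↦ c f₀ + θ c f₁`, for `c` a polynomial with coefficients in `A`. -/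
def coeffMul (c : A[X]) : SuperOp A := (polyMul c).prodMap (polyMul c)

/-- Left multiplication by an even scalar `a ∈ A` in the superalgebra `A ⊗ ℝ[x, θ]`. -/
def evenMul (a : A) : SuperOp A := coeffMul (Polynomial.C a)

/-- Left multiplication by an odd scalar `b ∈ A` in the superalgebra `A ⊗ ℝ[x, θ]`: since
`b θ = - θ b`, it is `f₀ + θ f₁ ↦ b f₀ - θ b f₁`. -/
def oddMul (b : A) : SuperOp A := coeffMul (Polynomial.C b) * parityOp A

/-- Left multiplication by a real superfunction `F = F₀ + θ F₁`. -/
def superMul [Algebra ℝ A] (F : SuperFun ℝ) : SuperOp A :=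
  coeffMul (F.1.map (algebraMap ℝ A)) + thetaMul A * coeffMul (F.2.map (algebraMap ℝ A))

variable (A)

/-- Linear differential operators on `ℝ^{1|1}` with coefficients in `A`: finite sums of
operators `θ^i c(x) ∂_θ^j ∂ₓ^r` with `c ∈ A[x]`. -/
def diffOps [Algebra ℝ A] : Submodule ℝ (SuperOp A) :=
  Submodule.span ℝ {T | ∃ (i j r : ℕ) (c : A[X]),
    T = thetaMul A ^ i * coeffMul c * dTheta A ^ j * dX A ^ r}

end Operators

/-! ## Contact vector fields and `osp(1|2)` -/

/-- `F ∈ ℝ[x, θ]` is homogeneous of parity `p`. -/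
def HasParity (p : ZMod 2) (F : SuperFun ℝ) : Prop :=
  (p = 0 → F.2 = 0) ∧ (p = 1 → F.1 = 0)

/-- The sign `(-1) ^ (p q)`. -/
def superSign (p q : ZMod 2) : ℤ := if p = 1 ∧ q = 1 then -1 else 1

section Contact

variable (A : Type*) [Ring A] [Algebra ℝ A]

/-- The contact vector field `X_F = F ∂ₓ - ½ (-1) ^ p(F) η̄(F) η̄`. -/
def contactField (F : SuperFun ℝ) : SuperOp A :=
  superMul F * dX A - (1 / 2 : ℝ) • (superMul (etaBarOp ℝ (parityOp ℝ F)) * etaBarOp A)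

/-- The action `X_F + w F'` of `X_F` on the densities `F α^w` of weight `w`. -/
def densityAction (w : ℝ) (F : SuperFun ℝ) : SuperOp A :=
  contactField A F + w • superMul (dX ℝ F)

end Contact

/-- The Lie superalgebra `osp(1|2)`, spanned by the `X_F` with `F ∈ {1, θ, x, xθ, x²}`.  The
contact vector field `X_F` is represented by its generating function `F`; the bracket is the
supercommutator of the vector fields. -/
def osp : Submodule ℝ (SuperFun ℝ) :=
  Submodule.span ℝ {(1, 0), (0, 1), (Polynomial.X, 0), (0, Polynomial.X), (Polynomial.X ^ 2, 0)}

/-- `X_H = [X_F, X_G]` for `F`, `G` homogeneous of parities `p`, `q`. -/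
def IsBracket (p q : ZMod 2) (F G H : SuperFun ℝ) : Prop :=
  contactField ℝ H = contactField ℝ F * contactField ℝ G -
    superSign p q • (contactField ℝ G * contactField ℝ F)

/-! ## The module of symbols -/

/-- The space of symbols `⨁ₖ 𝔉_{δ - k/2}`, with coefficients in `A`; the component with
index `k` has weight `δ - k/2`. -/
abbrev Symbols (A : Type*) [Ring A] : Type _ := ℕ →₀ SuperFun A

/-- Right `A`-linear operators on symbols with coefficients in `A`, that is, linear maps
`𝔖 → 𝔖 ⊗ A`, extended `A`-linearly. -/
abbrev SymbolOp (A : Type*) [Ring A] : Type _ := Module.End Aᵐᵒᵖ (Symbols A)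

section Symbols

variable {A : Type*} [Ring A]

/-- The operator that is `T` from the component `j` to the component `i` and zero elsewhere. -/
def blockOp (i j : ℕ) (T : SuperOp A) : SymbolOp A :=
  Finsupp.lsingle i ∘ₗ T ∘ₗ Finsupp.lapply j

/-- The operator that acts on the component `j` by `T j`. -/
def diagOp (T : ℕ → SuperOp A) : SymbolOp A :=
  Finsupp.lsum ℕ fun j => Finsupp.lsingle j ∘ₗ T j

/-- The component of an operator from `𝔉_{δ - j/2}` to `𝔉_{δ - i/2}`. -/
def component (i j : ℕ) (T : SymbolOp A) : SuperOp A :=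
  Finsupp.lapply i ∘ₗ T ∘ₗ Finsupp.lsingle j

/-- Linear differential operators on the space of symbols: every component is a differential
operator, and `T` maps each `𝔉_{δ - j/2}` to the sum of finitely many `𝔉_{δ - i/2}`. -/
def IsDiffOp [Algebra ℝ A] (T : SymbolOp A) : Prop :=
  (∀ i j : ℕ, component i j T ∈ diffOps A) ∧ ∀ j : ℕ, {i : ℕ | component i j T ≠ 0}.Finite

/-- The `osp(1|2)`-action on `𝔖_δ`, the direct sum of the actions on `𝔉_{δ - k/2}`. -/
def symbolAction (A : Type*) [Ring A] [Algebra ℝ A] (δ : ℝ) (F : SuperFun ℝ) : SymbolOp A :=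
  diagOp fun k => densityAction A (δ - k / 2) F

/-- A symbol with coefficients in `A` is homogeneous of degree `n` and parity `p`, where
`d = (n, p)`; `x` has degree `0` and parity `0`, `θ` has degree `0` and parity `1`. -/
def SymbolHasDegree [Algebra ℝ A] (𝒜 : ℕ × ZMod 2 → Submodule ℝ A) (d : ℕ × ZMod 2)
    (v : Symbols A) : Prop :=
  ∀ i r : ℕ, (v i).1.coeff r ∈ 𝒜 d ∧ (v i).2.coeff r ∈ 𝒜 (d + (0, 1))

/-- An operator is homogeneous of degree `n` and parity `p`, where `d = (n, p)`. -/
def OpHasDegree [Algebra ℝ A] (𝒜 : ℕ × ZMod 2 → Submodule ℝ A) (d : ℕ × ZMod 2)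
    (T : SymbolOp A) : Prop :=
  ∀ (e : ℕ × ZMod 2) (v : Symbols A), SymbolHasDegree 𝒜 e v → SymbolHasDegree 𝒜 (d + e) (T v)

end Symbols

/-! ## The cocycles and the infinitesimal deformation -/

section Cocycles

variable (A : Type*) [Ring A] [Algebra ℝ A]

/-- `Υ'(X_G) = G'`, from `𝔉_w` to `𝔉_w`. -/
def upsilonPrime (G : SuperFun ℝ) : SuperOp A := superMul (dX ℝ G)

/-- `Υ_k(X_G) = (-1)^{|G|} η²(G) η̄^{2k-1}`, from `𝔉_{(1-k)/2}` to `𝔉_{k/2}`. -/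
def upsilon (k : ℕ) (G : SuperFun ℝ) : SuperOp A :=
  superMul ((etaOp ℝ ^ 2) (parityOp ℝ G)) * etaBarOp A ^ (2 * k - 1)

/-- `Υ̃_k(X_G) = (-1)^{|G|} ((k-1) η⁴(G) η̄^{2k-3} + η³(G) η̄^{2k-2})`, from `𝔉_{(1-k)/2}` to
`𝔉_{k/2}`.  For `k = 1` the first term is zero. -/
def upsilonTilde (k : ℕ) (G : SuperFun ℝ) : SuperOp A :=
  ((k : ℝ) - 1) • (superMul ((etaOp ℝ ^ 4) (parityOp ℝ G)) * etaBarOp A ^ (2 * k - 3)) +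
    superMul ((etaOp ℝ ^ 3) (parityOp ℝ G)) * etaBarOp A ^ (2 * k - 2)

end Cocycles

/-- Values in `B` of the parameters.  Here `a j` is `𝔞_{2δ-j}`, the parameter of the cocycle `Υ'`
on the component `𝔉_{δ-j/2}` (`j ≥ 0`), and `b k`, `c k` are `𝔟_k`, `𝔠_k` (`1 ≤ k ≤ m`). -/
@[ext]
structure Params (m : ℕ) (B : Type*) where
  a : ℕ → B
  b : Finset.Icc 1 m → B
  c : Finset.Icc 1 m → B

namespace Params

variable {m : ℕ}

/-- Apply a function to all parameters. -/
def map {B B' : Type*} (f : B → B') (t : Params m B) : Params m B' where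
  a j := f (t.a j)
  b k := f (t.b k)
  c k := f (t.c k)

/-- The relations `𝔟_k 𝔞_{1-k} - 𝔠_k 𝔞_k + 𝔠_k 𝔞_{1-k} = 0`, `1 ≤ k ≤ m`, for `2δ = m`: the
component with index `m + k - 1` has weight `(1-k)/2`, and the one with index `m - k` has
weight `k/2`. -/
def Relations {B : Type*} [Ring B] (t : Params m B) : Prop :=
  ∀ k : Finset.Icc 1 m,
    t.b k * t.a (m + k - 1) - t.c k * t.a (m - k) + t.c k * t.a (m + k - 1) = 0

/-- The parameters `𝔞` are even of degree `n`, the parameters `𝔟`, `𝔠` are odd of degree `n`. -/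
def IsHomogeneous {A : Type*} [Ring A] [Algebra ℝ A] (𝒜 : ℕ × ZMod 2 → Submodule ℝ A) (n : ℕ)
    (t : Params m A) : Prop :=
  (∀ j, t.a j ∈ 𝒜 (n, 0)) ∧ (∀ k, t.b k ∈ 𝒜 (n, 1)) ∧ ∀ k, t.c k ∈ 𝒜 (n, 1)

/-- Formal series of parameters without constant term, with term of index `n` of degree `n`. -/
def IsFormal {A : Type*} [Ring A] [Algebra ℝ A] (𝒜 : ℕ × ZMod 2 → Submodule ℝ A)
    (t : Params m A⟦X⟧) : Prop :=
  (∀ n, IsHomogeneous 𝒜 n (t.map (PowerSeries.coeff n))) ∧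
    t.map (PowerSeries.coeff 0) = ⟨0, 0, 0⟩

/-- The infinitesimal term
`∑_{j ≥ 0} 𝔞_{m-j} Υ'_{m-j}(X_F) + ∑_{k=1}^m (𝔟_k Υ_k(X_F) + 𝔠_k Υ̃_k(X_F))`. -/
def infinitesimal {A : Type*} [Ring A] [Algebra ℝ A] (t : Params m A) (F : SuperFun ℝ) :
    SymbolOp A :=
  diagOp (fun j => evenMul (t.a j) * upsilonPrime A F) +
    ∑ k : Finset.Icc 1 m, blockOp (m - k) (m + k - 1)
      (oddMul (t.b k) * upsilon A k F + oddMul (t.c k) * upsilonTilde A k F)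

end Params

/-! ## Formal deformations

The base is a graded supercommutative algebra `A = ⨁ₙ Aₙ`; the formal variable `X` of the power
series only records the degree: a series `∑ₙ Tₙ Xⁿ` with `Tₙ` of degree `n` is an operator with
coefficients in the completion `∏ₙ Aₙ`. -/

section Deformations

variable {A : Type*} [Ring A] [Algebra ℝ A]

/-- Graded supercommutativity: `a b = (-1)^{|a||b|} b a`. -/
def IsSuperCommutative (𝒜 : ℕ × ZMod 2 → Submodule ℝ A) : Prop :=
  ∀ (d e : ℕ × ZMod 2) (a b : A), a ∈ 𝒜 d → b ∈ 𝒜 e → a * b = superSign d.2 e.2 • (b * a)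

/-- Formal deformations `ρ = ρ₀ + ρ₁ + ρ₂ + ⋯` of the `osp(1|2)`-module `𝔖_δ` with base `A`. -/
structure IsFormalDeformation (𝒜 : ℕ × ZMod 2 → Submodule ℝ A) (δ : ℝ)
    (ρ : osp → (SymbolOp A)⟦X⟧) : Prop where
  linear : IsLinearMap ℝ ρ
  coeff_zero : ∀ F : osp, PowerSeries.coeff 0 (ρ F) = symbolAction A δ F
  differential : ∀ (F : osp) (n : ℕ), IsDiffOp (PowerSeries.coeff n (ρ F))
  degree : ∀ (F : osp) (p : ZMod 2), HasParity p (F : SuperFun ℝ) →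
    ∀ n : ℕ, OpHasDegree 𝒜 (n, p) (PowerSeries.coeff n (ρ F))
  hom : ∀ (F G H : osp) (p q : ZMod 2), HasParity p (F : SuperFun ℝ) →
    HasParity q (G : SuperFun ℝ) → IsBracket p q (F : SuperFun ℝ) G H →
    ρ F * ρ G - superSign p q • (ρ G * ρ F) = ρ H

/-- Two families of formal operators are conjugate under an even formal automorphism
`1 + I₁ + I₂ + ⋯`, with `Iₙ` differential of degree `n`. -/
def FormallyEquivalent (𝒜 : ℕ × ZMod 2 → Submodule ℝ A) (ρ ρ' : osp → (SymbolOp A)⟦X⟧) : Prop :=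
  ∃ I : (SymbolOp A)⟦X⟧, PowerSeries.coeff 0 I = 1 ∧
    (∀ n : ℕ, IsDiffOp (PowerSeries.coeff n I) ∧ OpHasDegree 𝒜 (n, 0) (PowerSeries.coeff n I)) ∧
    ∀ F : osp, I * ρ F = ρ' F * I

/-- The infinitesimal deformation given by `t` can be integrated to a formal deformation. -/
def IsIntegrable {m : ℕ} (𝒜 : ℕ × ZMod 2 → Submodule ℝ A) (δ : ℝ) (t : Params m A) : Prop :=
  ∃ ρ : osp → (SymbolOp A)⟦X⟧, IsFormalDeformation 𝒜 δ ρ ∧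
    ∀ F : osp, PowerSeries.coeff 1 (ρ F) = t.infinitesimal (F : SuperFun ℝ)

/-- The family `X_F ↦ 𝔏_{X_F} + 𝔏⁽¹⁾_{X_F}` of first order in the parameters, whose parameters
are formal series. -/
def firstOrderFamily {m : ℕ} (δ : ℝ) (t : Params m A⟦X⟧) (F : osp) : (SymbolOp A)⟦X⟧ :=
  PowerSeries.C (symbolAction A δ (F : SuperFun ℝ)) +
    PowerSeries.mk fun n => (t.map (PowerSeries.coeff n)).infinitesimal (F : SuperFun ℝ)

end Deformations

end

/-! The algebra osp(1|2) is generated by its two odd elements 2X_θ and 2X_{xθ}. A representation is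
therefore a pair of operators (E, Φ) such that H = EΦ + ΦE satisfies [H, E] = -E and [H, Φ] = Φ
(`OspPair`, `ospMap_bracket`, `ospPair_of_representation`). On densities of weight ν/2 this pair is
E = η, Φ = φ = xη + νθ. All the cocycles of the theorem vanish on X_θ, so the infinitesimal
deformation leaves E = η alone and adds to Φ an operator N (`normalOp`): it is a multiple of θ on
each component, and it has off-diagonal blocks combining θη^{2k-1} and ση^{2k-2}, where σ is the
parity operator.

Sufficiency. The product N² consists exactly of the left-hand sides of (∗), up to non-zero
constants, times θη^{2k-2} (`normalOp_mul_normalOp`). If (∗) holds then N² = 0. The relations for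
(η, φ + N) are linear in N up to the commutator [η, N²], so this pair is again a representation, and
it is of first order in N on all of osp(1|2) (`OspPair.add`, `coeff_ospMap`).

Normalization. Two facts about differential operators carry the argument. The map T ↦ [η, T] is
onto, because η² = ∂ₓ and [∂ₓ, ·] only differentiates polynomial coefficients
(`exists_eta_primitive`). Its kernel consists of the polynomials in η (`exists_etaSum_of_commute`).
Consider the lowest homogeneous term of a deformation that is not yet in normal form. The first fact
conjugates its E-part away. The relations then force its Φ-part to be θc(η) + σp(η), and the
conjugations still available are by 1 + g(η). If the two weights differ by w/2, such a g changes c_k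
by (k - w)g_k and p_{k-1} by γ_k g_k, with γ_k = `gaugeCoeff ν k`. The relation [H, Φ] = Φ becomes
(w - k - 1)p_k + γ_{k+1}c_{k+1} + q_k = 0, where q comes from the square of the part already
normalized. Thus everything can be removed except c_0 on the diagonal, and c_w, p_{w-1} where w ≥ 1
and γ_w = 0. The latter happens only for w = 2k - 1 and ν = 1 - k, which are the blocks carrying 𝔟_k
and 𝔠_k (`exists_gauge`, `exists_gauge_normalOp`).

Necessity. At these exceptional blocks the last equation reads q_{w-1} = 0, and q_{w-1} is a
non-zero multiple of the coefficient of (∗) in the degree considered. Hence the normalization itself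
proves the relations, degree by degree (`IsNormalized.step`, `exists_normalization`). Both parts of
the theorem follow once it is known that the parameters of degree one cannot change: a conjugation
preserving η is by a polynomial in η, and the surviving coefficients are precisely those it does not
move (`eq_of_normalOp_conj`). -/

noncomputable section

/-! ### Commutation relations of η, θ, x, the parity operator σ and the scalars. -/

section OperatorAlgebra

variable {A : Type*} [Ring A]

theorem etaOp_apply (f : SuperFun A) :
    etaOp A f = (f.2, Polynomial.derivative f.1) := by
  ext <;> simp [etaOp, dTheta, thetaMul, dX, polyDeriv]

theorem thetaMul_apply (f : SuperFun A) : thetaMul A f = (0, f.1) := by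
  ext <;> simp [thetaMul]

theorem dTheta_apply (f : SuperFun A) : dTheta A f = (f.2, 0) := by
  ext <;> simp [dTheta]

theorem dX_apply (f : SuperFun A) :
    dX A f = (Polynomial.derivative f.1, Polynomial.derivative f.2) := by
  ext <;> simp [dX, polyDeriv]

theorem parityOp_apply (f : SuperFun A) : parityOp A f = (f.1, -f.2) := by
  ext <;> simp [parityOp]

theorem coeffMul_apply (c : A[X]) (f : SuperFun A) : coeffMul c f = (c * f.1, c * f.2) := by
  ext <;> simp [coeffMul, polyMul]

theorem eta_mul_theta : etaOp A * thetaMul A = 1 - thetaMul A * etaOp A := by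
  refine LinearMap.ext fun f => ?_
  ext <;> simp [etaOp_apply, thetaMul_apply, Module.End.mul_apply]

theorem theta_mul_theta : thetaMul A * thetaMul A = 0 := by
  refine LinearMap.ext fun f => ?_
  simp [thetaMul_apply, Module.End.mul_apply]

theorem theta_mul_coeffMul (c : A[X]) : thetaMul A * coeffMul c = coeffMul c * thetaMul A := by
  refine LinearMap.ext fun f => ?_
  simp [thetaMul_apply, coeffMul_apply, Module.End.mul_apply]

theorem dTheta_mul_coeffMul (c : A[X]) : dTheta A * coeffMul c = coeffMul c * dTheta A := by
  refine LinearMap.ext fun f => ?_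
  simp [dTheta_apply, coeffMul_apply, Module.End.mul_apply]

theorem parity_mul_coeffMul (c : A[X]) :
    parityOp A * coeffMul c = coeffMul c * parityOp A := by
  refine LinearMap.ext fun f => ?_
  simp [parityOp_apply, coeffMul_apply, Module.End.mul_apply]

theorem dX_mul_coeffMul (c : A[X]) :
    dX A * coeffMul c = coeffMul c * dX A + coeffMul (Polynomial.derivative c) := by
  refine LinearMap.ext fun f => ?_
  simp [dX_apply, coeffMul_apply, Module.End.mul_apply, Polynomial.derivative_mul, add_comm]

theorem eta_mul_coeffMul (c : A[X]) :
    etaOp A * coeffMul c =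
      coeffMul c * etaOp A + thetaMul A * coeffMul (Polynomial.derivative c) := by
  refine LinearMap.ext fun f => ?_
  simp [etaOp_apply, thetaMul_apply, coeffMul_apply, Module.End.mul_apply,
    Polynomial.derivative_mul, add_comm]

theorem coeffMul_mul (c d : A[X]) : coeffMul c * coeffMul d = coeffMul (c * d) := by
  refine LinearMap.ext fun f => ?_
  simp [coeffMul_apply, Module.End.mul_apply, mul_assoc]

theorem coeffMul_add (c d : A[X]) : coeffMul (c + d) = coeffMul c + coeffMul d := by
  refine LinearMap.ext fun f => ?_
  simp [coeffMul_apply, add_mul]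

theorem coeffMul_zero : coeffMul (0 : A[X]) = 0 := by
  refine LinearMap.ext fun f => ?_
  simp [coeffMul_apply]

theorem coeffMul_one : coeffMul (1 : A[X]) = 1 := by
  refine LinearMap.ext fun f => ?_
  simp [coeffMul_apply]

theorem dX_mul_theta : dX A * thetaMul A = thetaMul A * dX A := by
  refine LinearMap.ext fun f => ?_
  simp [dX_apply, thetaMul_apply, Module.End.mul_apply]

theorem dX_mul_dTheta : dX A * dTheta A = dTheta A * dX A := by
  refine LinearMap.ext fun f => ?_
  simp [dX_apply, dTheta_apply, Module.End.mul_apply]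

theorem dTheta_mul_theta : dTheta A * thetaMul A = 1 - thetaMul A * dTheta A := by
  refine LinearMap.ext fun f => ?_
  ext <;> simp [dTheta_apply, thetaMul_apply, Module.End.mul_apply]

theorem dTheta_mul_dTheta : dTheta A * dTheta A = 0 := by
  refine LinearMap.ext fun f => ?_
  simp [dTheta_apply, Module.End.mul_apply]

theorem eta_mul_eta : etaOp A * etaOp A = dX A := by
  refine LinearMap.ext fun f => ?_
  simp [dX_apply, etaOp_apply, Module.End.mul_apply]

theorem parity_mul_eta : parityOp A * etaOp A = -(etaOp A * parityOp A) := by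
  refine LinearMap.ext fun f => ?_
  simp [parityOp_apply, etaOp_apply, Module.End.mul_apply]

theorem parity_mul_theta : parityOp A * thetaMul A = -thetaMul A := by
  refine LinearMap.ext fun f => ?_
  simp [parityOp_apply, thetaMul_apply, Module.End.mul_apply]

theorem theta_mul_parity : thetaMul A * parityOp A = thetaMul A := by
  refine LinearMap.ext fun f => ?_
  simp [parityOp_apply, thetaMul_apply, Module.End.mul_apply]

theorem parity_mul_parity : parityOp A * parityOp A = 1 := by
  refine LinearMap.ext fun f => ?_
  simp [parityOp_apply, Module.End.mul_apply]

/-- The product θη is the projection onto the odd part θf₁. -/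
theorem parityOp_eq : parityOp A = 1 - 2 * (thetaMul A * etaOp A) := by
  refine LinearMap.ext fun f => ?_
  rw [two_mul]
  simp only [parityOp_apply, thetaMul_apply, etaOp_apply, Module.End.mul_apply,
    LinearMap.sub_apply, LinearMap.add_apply, Module.End.one_apply]
  ext <;> simp

/-- This removes η̄ from the computations: everything is expressed by η, θ, x and σ. -/
theorem etaBarOp_eq : etaBarOp A = parityOp A * etaOp A := by
  refine LinearMap.ext fun f => ?_
  simp [parityOp_apply, etaOp_apply, etaBarOp, dTheta_apply, thetaMul_apply, dX_apply,
    Module.End.mul_apply]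

theorem eta_mul_x :
    etaOp A * coeffMul Polynomial.X = coeffMul Polynomial.X * etaOp A + thetaMul A := by
  rw [eta_mul_coeffMul, Polynomial.derivative_X, coeffMul_one, mul_one]

/-- Scalars are written to the right of x and θ, so this multiplication carries no sign and commutes
with η, θ, σ and x for every a, even or odd. The signs of odd scalars are produced by the factor σ
in `oddMul`. -/
theorem evenMul_comm_eta (a : A) : etaOp A * evenMul a = evenMul a * etaOp A := by
  rw [evenMul, eta_mul_coeffMul, Polynomial.derivative_C, coeffMul_zero, mul_zero, add_zero]

theorem evenMul_comm_theta (a : A) : thetaMul A * evenMul a = evenMul a * thetaMul A :=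
  theta_mul_coeffMul _

theorem evenMul_comm_parity (a : A) : parityOp A * evenMul a = evenMul a * parityOp A :=
  parity_mul_coeffMul _

theorem evenMul_comm_x (a : A) :
    coeffMul Polynomial.X * evenMul a = evenMul a * coeffMul Polynomial.X := by
  rw [evenMul, coeffMul_mul, coeffMul_mul, Polynomial.X_mul_C]

theorem evenMul_mul (a b : A) : evenMul (a * b) = evenMul a * evenMul b := by
  rw [evenMul, evenMul, evenMul, coeffMul_mul, Polynomial.C_mul]

theorem evenMul_add (a b : A) : evenMul (a + b) = evenMul a + evenMul b := by
  rw [evenMul, Polynomial.C_add, coeffMul_add]; rfl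

theorem evenMul_zero : evenMul (0 : A) = 0 := by
  rw [evenMul, Polynomial.C_0, coeffMul_zero]

end OperatorAlgebra

section RealScalars

variable {A : Type*} [Ring A] [Algebra ℝ A]

theorem coeffMul_smul (r : ℝ) (c : A[X]) : coeffMul (r • c) = r • coeffMul c := by
  refine LinearMap.ext fun f => ?_
  simp [coeffMul_apply]

theorem evenMul_smul (r : ℝ) (a : A) : evenMul (r • a) = r • evenMul a := by
  rw [evenMul, ← Polynomial.smul_C, coeffMul_smul]; rfl

theorem superMul_add (F G : SuperFun ℝ) :
    (superMul (F + G) : SuperOp A) = superMul F + superMul G := by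
  simp only [superMul, Prod.fst_add, Prod.snd_add, Polynomial.map_add, coeffMul_add, mul_add]
  abel

theorem superMul_smul (r : ℝ) (F : SuperFun ℝ) :
    (superMul (r • F) : SuperOp A) = r • superMul F := by
  simp only [superMul, Prod.smul_fst, Prod.smul_snd, Polynomial.map_smul]
  have h (c : A[X]) : algebraMap ℝ A r • c = r • c := algebraMap_smul A r c
  rw [h, h, coeffMul_smul, coeffMul_smul, mul_smul_comm, smul_add]

end RealScalars

/-! ### Presentation of osp(1|2) by two odd generators. -/

section OspPairs

variable {B : Type*} [Ring B]

/-- The relations satisfied by the images `E`, `Φ` of `2X_θ`, `2X_{xθ}` in a representation of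
`osp(1|2)`; they determine the representation. -/
def OspPair (E Φ : B) : Prop :=
  (E * Φ + Φ * E) * E - E * (E * Φ + Φ * E) = -E ∧
    (E * Φ + Φ * E) * Φ - Φ * (E * Φ + Φ * E) = Φ

/-- The relations contain no unit term, so a one-sided inverse suffices: `K * I = 1` cancels the
inner factors of each product. -/
theorem OspPair.conj {E Φ I K : B} (h : OspPair E Φ) (hKI : K * I = 1) :
    OspPair (I * E * K) (I * Φ * K) := by
  have hc (u v : B) : I * u * K * (I * v * K) = I * (u * v) * K := by
    calc I * u * K * (I * v * K) = I * u * (K * I) * (v * K) := by noncomm_ring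
      _ = I * (u * v) * K := by rw [hKI]; noncomm_ring
  have ha (u v : B) : I * u * K + I * v * K = I * (u + v) * K := by noncomm_ring
  have hs (u v : B) : I * u * K - I * v * K = I * (u - v) * K := by noncomm_ring
  constructor
  · rw [hc, hc, ha, hc, hc, hs, h.1]; noncomm_ring
  · rw [hc, hc, ha, hc, hc, hs, h.2]

theorem OspPair.map {B' : Type*} [Ring B'] {E Φ : B} (h : OspPair E Φ) (f : B →+* B') :
    OspPair (f E) (f Φ) := by
  constructor
  · simp only [← map_mul, ← map_add, ← map_sub, ← map_neg, h.1]
  · simp only [← map_mul, ← map_add, ← map_sub, h.2]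

/-- With E fixed, the first relation is linear in Φ. The part of the second that is quadratic in N
is [eN + Ne, N] = eN² - N²e, which vanishes with N². -/
theorem OspPair.add {e φ N : B} (h : OspPair e φ) (h1 : N * N = 0)
    (h2 : (e * N + N * e) * e = e * (e * N + N * e))
    (h3 : (e * φ + φ * e) * N + (e * N + N * e) * φ =
      N + N * (e * φ + φ * e) + φ * (e * N + N * e)) :
    OspPair e (φ + N) := by
  obtain ⟨h5, h6⟩ := h
  constructor
  · linear_combination (norm := noncomm_ring) h5 + h2
  · have h7 : (e * N + N * e) * N - N * (e * N + N * e) = 0 := by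
      calc _ = e * (N * N) - (N * N) * e := by noncomm_ring
        _ = 0 := by rw [h1]; simp
    linear_combination (norm := noncomm_ring) h6 + h3 + h7

/-- The mixed terms EΦE cancel in the commutator of EΦ + ΦE with E. -/
theorem OspPair.sq_left {E Φ : B} (h : OspPair E Φ) : E * E * Φ - Φ * (E * E) = E := by
  have h1 := h.1
  have : E * E * Φ - Φ * (E * E) = -((E * Φ + Φ * E) * E - E * (E * Φ + Φ * E)) := by
    noncomm_ring
  rw [this, h1, neg_neg]

theorem OspPair.sq_right {E Φ : B} (h : OspPair E Φ) : Φ * Φ * E - E * (Φ * Φ) = -Φ := by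
  have h1 := h.2
  have : Φ * Φ * E - E * (Φ * Φ) = -((E * Φ + Φ * E) * Φ - Φ * (E * Φ + Φ * E)) := by
    noncomm_ring
  rw [this, h1]

theorem OspPair.weight_sq_left {E Φ : B} (h : OspPair E Φ) :
    (E * Φ + Φ * E) * (E * E) - E * E * (E * Φ + Φ * E) = -(2 • (E * E)) := by
  calc _ = ((E * Φ + Φ * E) * E - E * (E * Φ + Φ * E)) * E +
      E * ((E * Φ + Φ * E) * E - E * (E * Φ + Φ * E)) := by noncomm_ring
    _ = _ := by rw [h.1]; noncomm_ring

theorem OspPair.weight_sq_right {E Φ : B} (h : OspPair E Φ) :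
    (E * Φ + Φ * E) * (Φ * Φ) - Φ * Φ * (E * Φ + Φ * E) = 2 • (Φ * Φ) := by
  calc _ = ((E * Φ + Φ * E) * Φ - Φ * (E * Φ + Φ * E)) * Φ +
      Φ * ((E * Φ + Φ * E) * Φ - Φ * (E * Φ + Φ * E)) := by noncomm_ring
    _ = _ := by rw [h.2, two_nsmul]

theorem OspPair.sq_sq {E Φ : B} (h : OspPair E Φ) :
    E * E * (Φ * Φ) - Φ * Φ * (E * E) = E * Φ + Φ * E := by
  calc _ = (E * E * Φ - Φ * (E * E)) * Φ + Φ * (E * E * Φ - Φ * (E * E)) := by noncomm_ring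
    _ = _ := by rw [h.sq_left]

variable [Algebra ℝ B]

/-- The linear map on `osp(1|2)` determined by the images `E`, `Φ` of `2X_θ`, `2X_{xθ}`. -/
def ospMap (E Φ : B) : SuperFun ℝ →ₗ[ℝ] B where
  toFun F := F.1.coeff 0 • (E * E) + (F.1.coeff 1 / 2) • (E * Φ + Φ * E) +
    F.1.coeff 2 • (Φ * Φ) + (F.2.coeff 0 / 2) • E + (F.2.coeff 1 / 2) • Φ
  map_add' F G := by
    simp only [Prod.fst_add, Prod.snd_add, Polynomial.coeff_add]
    module
  map_smul' r F := by
    simp only [Prod.smul_fst, Prod.smul_snd, Polynomial.coeff_smul, RingHom.id_apply, smul_eq_mul]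
    module

/-- The contact bracket of quadratic superfunctions of parities `p`, `q`. -/
def ospBracket (p q : ZMod 2) (F G : SuperFun ℝ) : SuperFun ℝ :=
  if p = 0 then
    if q = 0 then
      (Polynomial.C (F.1.coeff 0 * G.1.coeff 1 - F.1.coeff 1 * G.1.coeff 0) +
        Polynomial.C (2 * (F.1.coeff 0 * G.1.coeff 2 - F.1.coeff 2 * G.1.coeff 0)) * Polynomial.X +
        Polynomial.C (F.1.coeff 1 * G.1.coeff 2 - F.1.coeff 2 * G.1.coeff 1) *
          Polynomial.X ^ 2, 0)
    else
      (0, Polynomial.C (F.1.coeff 0 * G.2.coeff 1 - F.1.coeff 1 * G.2.coeff 0 / 2) +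
        Polynomial.C (F.1.coeff 1 * G.2.coeff 1 / 2 - F.1.coeff 2 * G.2.coeff 0) * Polynomial.X)
  else
    if q = 0 then
      (0, Polynomial.C (F.2.coeff 0 * G.1.coeff 1 / 2 - F.2.coeff 1 * G.1.coeff 0) +
        Polynomial.C (F.2.coeff 0 * G.1.coeff 2 - F.2.coeff 1 * G.1.coeff 1 / 2) * Polynomial.X)
    else
      (Polynomial.C (F.2.coeff 0 * G.2.coeff 0 / 2) +
        Polynomial.C ((F.2.coeff 0 * G.2.coeff 1 + F.2.coeff 1 * G.2.coeff 0) / 2) * Polynomial.X +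
        Polynomial.C (F.2.coeff 1 * G.2.coeff 1 / 2) * Polynomial.X ^ 2, 0)

/-- For two odd elements no relation is needed, because the images of the even generators are
defined through anticommutators of E and Φ. The other cases are bilinear combinations of the two
relations and of the brackets they imply between E², Φ² and H. -/
theorem ospMap_bracket {E Φ : B} (h : OspPair E Φ) {p q : ZMod 2} {F G : SuperFun ℝ}
    (hF : HasParity p F) (hG : HasParity q G) :
    ospMap E Φ F * ospMap E Φ G - superSign p q • (ospMap E Φ G * ospMap E Φ F) =
      ospMap E Φ (ospBracket p q F G) := by
  have e1 := h.sq_left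
  have e2 := h.sq_right
  have e3 := h.weight_sq_left
  have e4 := h.weight_sq_right
  have e5 := h.sq_sq
  obtain ⟨e6, e7⟩ := h
  simp only [mul_assoc] at e1 e2
  -- With the anticommutator as a single symbol, each case is a linear identity between fixed
  -- monomials in E, Φ and H.
  generalize hH : E * Φ + Φ * E = H at e3 e4 e5 e6 e7
  simp only [mul_assoc] at e3 e4 e5
  have hz : ∀ p : ZMod 2, p = 0 ∨ p = 1 := by decide
  rcases hz p with rfl | rfl <;> rcases hz q with rfl | rfl <;>
    simp only [HasParity, zero_ne_one, one_ne_zero, false_implies, true_and, and_true,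
      true_implies] at hF hG <;>
    simp only [ospMap, ospBracket, superSign, hF, hG, Polynomial.coeff_X, Polynomial.coeff_C,
      hH, mul_assoc, mul_add, add_mul, smul_mul_assoc, mul_smul_comm, LinearMap.coe_mk,
      AddHom.coe_mk, Polynomial.coeff_zero, Polynomial.coeff_add, Polynomial.coeff_C_mul,
      Polynomial.coeff_X_pow, zero_smul, add_zero, zero_add, zero_div, reduceIte, zero_ne_one,
      one_ne_zero, and_true, and_false, and_self, one_smul, neg_smul,
      mul_zero, mul_one, OfNat.ofNat_ne_zero, OfNat.zero_ne_ofNat,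
      OfNat.one_ne_ofNat]
  · linear_combination (norm := module)
      (F.1.coeff 0 * G.1.coeff 2 - F.1.coeff 2 * G.1.coeff 0) • e5
      + ((F.1.coeff 1 * G.1.coeff 0 - F.1.coeff 0 * G.1.coeff 1) / 2) • e3
      + ((F.1.coeff 1 * G.1.coeff 2 - F.1.coeff 2 * G.1.coeff 1) / 2) • e4
  · linear_combination (norm := module)
      (F.1.coeff 0 * G.2.coeff 1 / 2) • e1 + (F.1.coeff 2 * G.2.coeff 0 / 2) • e2
      + (F.1.coeff 1 * G.2.coeff 0 / 4) • e6
      + (F.1.coeff 1 * G.2.coeff 1 / 4) • e7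
  · linear_combination (norm := module)
      (-(G.1.coeff 0 * F.2.coeff 1 / 2)) • e1 - (G.1.coeff 2 * F.2.coeff 0 / 2) • e2
      - (G.1.coeff 1 * F.2.coeff 0 / 4) • e6
      - (G.1.coeff 1 * F.2.coeff 1 / 4) • e7
  · rw [← hH]
    module

end OspPairs

/-! ### Rewriting rules for words in the basic operators. -/

section NormalOrdering

variable {A : Type*} [Ring A]

theorem Module.End.neg_mul' {R M : Type*} [Ring R] [AddCommGroup M] [Module R M]
    (S T : Module.End R M) : -S * T = -(S * T) := rfl

theorem Module.End.mul_neg' {R M : Type*} [Ring R] [AddCommGroup M] [Module R M]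
    (S T : Module.End R M) : S * -T = -(S * T) :=
  LinearMap.ext fun f => map_neg S (T f)

/-- The versions with a trailing factor apply inside right-associated words: scalars and x move to
the left, and η moves past θ to the right. -/
theorem eta_mul_theta_mul (T : SuperOp A) :
    etaOp A * (thetaMul A * T) = T - thetaMul A * (etaOp A * T) := by
  rw [← mul_assoc, eta_mul_theta, sub_mul, one_mul, mul_assoc]

theorem theta_mul_theta_mul (T : SuperOp A) : thetaMul A * (thetaMul A * T) = 0 := by
  rw [← mul_assoc, theta_mul_theta, zero_mul]

theorem eta_mul_x_mul (T : SuperOp A) :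
    etaOp A * (coeffMul Polynomial.X * T) =
      coeffMul Polynomial.X * (etaOp A * T) + thetaMul A * T := by
  rw [← mul_assoc, eta_mul_x, add_mul, mul_assoc]

theorem theta_mul_x : thetaMul A * coeffMul Polynomial.X = coeffMul Polynomial.X * thetaMul A :=
  theta_mul_coeffMul _

theorem theta_mul_x_mul (T : SuperOp A) :
    thetaMul A * (coeffMul Polynomial.X * T) = coeffMul Polynomial.X * (thetaMul A * T) := by
  rw [← mul_assoc, theta_mul_x, mul_assoc]

theorem parity_mul_x :
    parityOp A * coeffMul Polynomial.X = coeffMul Polynomial.X * parityOp A :=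
  parity_mul_coeffMul _

theorem parity_mul_x_mul (T : SuperOp A) :
    parityOp A * (coeffMul Polynomial.X * T) = coeffMul Polynomial.X * (parityOp A * T) := by
  rw [← mul_assoc, parity_mul_x, mul_assoc]

theorem parity_mul_eta_mul (T : SuperOp A) :
    parityOp A * (etaOp A * T) = -(etaOp A * (parityOp A * T)) := by
  rw [← mul_assoc, parity_mul_eta, Module.End.neg_mul', mul_assoc]

theorem parity_mul_theta_mul (T : SuperOp A) :
    parityOp A * (thetaMul A * T) = -(thetaMul A * T) := by
  rw [← mul_assoc, parity_mul_theta, Module.End.neg_mul']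

theorem theta_mul_parity_mul (T : SuperOp A) :
    thetaMul A * (parityOp A * T) = thetaMul A * T := by
  rw [← mul_assoc, theta_mul_parity]

theorem parity_mul_parity_mul (T : SuperOp A) : parityOp A * (parityOp A * T) = T := by
  rw [← mul_assoc, parity_mul_parity, one_mul]

theorem eta_comm_evenMul_mul (a : A) (T : SuperOp A) :
    etaOp A * (evenMul a * T) = evenMul a * (etaOp A * T) := by
  rw [← mul_assoc, evenMul_comm_eta, mul_assoc]

theorem theta_comm_evenMul_mul (a : A) (T : SuperOp A) :
    thetaMul A * (evenMul a * T) = evenMul a * (thetaMul A * T) := by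
  rw [← mul_assoc, evenMul_comm_theta, mul_assoc]

theorem parity_comm_evenMul_mul (a : A) (T : SuperOp A) :
    parityOp A * (evenMul a * T) = evenMul a * (parityOp A * T) := by
  rw [← mul_assoc, evenMul_comm_parity, mul_assoc]

theorem x_comm_evenMul_mul (a : A) (T : SuperOp A) :
    coeffMul Polynomial.X * (evenMul a * T) = evenMul a * (coeffMul Polynomial.X * T) := by
  rw [← mul_assoc, evenMul_comm_x, mul_assoc]

end NormalOrdering

/-! ### Density modules in terms of the two generators. -/

section Densities

variable (A : Type*) [Ring A] [Algebra ℝ A]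

/-- The action `x η + ν θ` of `2X_{xθ}` on densities of weight `ν / 2`. -/
def phiOp (ν : ℝ) : SuperOp A := coeffMul Polynomial.X * etaOp A + ν • thetaMul A

variable {A}

theorem eta_phi_anticomm (ν : ℝ) :
    etaOp A * phiOp A ν + phiOp A ν * etaOp A =
      2 • (coeffMul Polynomial.X * (etaOp A * etaOp A)) + thetaMul A * etaOp A + ν • 1 := by
  simp only [phiOp, mul_add, add_mul, mul_assoc, eta_mul_x_mul, eta_mul_theta, mul_smul_comm,
    smul_mul_assoc]
  module

/-- The anticommutator is 2x∂ₓ + θ∂_θ + ν, an Euler operator giving weight 2 to x and weight 1 to θ.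
The operator η lowers this weight by one and xη + νθ raises it by one. -/
theorem ospPair_eta_phi (ν : ℝ) : OspPair (etaOp A) (phiOp A ν) := by
  rw [OspPair, eta_phi_anticomm]
  constructor
  · simp only [mul_add, add_mul, mul_assoc, eta_mul_x_mul, eta_mul_theta_mul, mul_smul_comm,
      smul_mul_assoc, mul_one, one_mul]
    module
  · simp only [phiOp, mul_add, add_mul, mul_assoc, eta_mul_x_mul, eta_mul_theta_mul,
      eta_mul_theta, mul_smul_comm, mul_sub, theta_mul_x_mul,
      theta_mul_theta_mul, smul_mul_assoc, mul_one, one_mul]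
    module

theorem phi_sq (ν : ℝ) :
    phiOp A ν * phiOp A ν = coeffMul (Polynomial.X ^ 2) * (etaOp A * etaOp A) +
      thetaMul A * coeffMul Polynomial.X * etaOp A + ν • coeffMul Polynomial.X := by
  rw [pow_two, ← coeffMul_mul]
  simp only [phiOp, mul_add, add_mul, mul_assoc, eta_mul_x_mul,
      eta_mul_theta, mul_smul_comm, mul_sub, theta_mul_x_mul, theta_mul_x,
      theta_mul_theta, smul_mul_assoc, mul_one]
  module

theorem contactField_add (F G : SuperFun ℝ) :
    contactField A (F + G) = contactField A F + contactField A G := by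
  simp only [contactField, map_add, superMul_add, add_mul, smul_add]
  abel

theorem contactField_smul (r : ℝ) (F : SuperFun ℝ) :
    contactField A (r • F) = r • contactField A F := by
  have h1 : parityOp ℝ (r • F) = r • parityOp ℝ F := by
    ext <;> simp [parityOp_apply]
  have h2 (G : SuperFun ℝ) : etaBarOp ℝ (r • G) = r • etaBarOp ℝ G := by
    ext <;> simp [etaBarOp, dTheta_apply, thetaMul_apply, dX_apply]
  simp only [contactField, h1, h2, superMul_smul, smul_mul_assoc]
  module

theorem densityAction_add (w : ℝ) (F G : SuperFun ℝ) :
    densityAction A w (F + G) = densityAction A w F + densityAction A w G := by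
  simp only [densityAction, map_add, superMul_add, contactField_add]
  module

theorem densityAction_smul (w r : ℝ) (F : SuperFun ℝ) :
    densityAction A w (r • F) = r • densityAction A w F := by
  have h1 : dX ℝ (r • F) = r • dX ℝ F := by
    ext <;> simp [dX_apply]
  simp only [densityAction, h1, superMul_smul, contactField_smul]
  module

variable (A) in
/-- The action of contact vector fields on densities, as a linear map. -/
def densityActionLinear (w : ℝ) : SuperFun ℝ →ₗ[ℝ] SuperOp A where
  toFun := densityAction A w
  map_add' := densityAction_add w
  map_smul' := densityAction_smul w

theorem eqOn_osp {M : Type*} [AddCommGroup M] [Module ℝ M] {f g : SuperFun ℝ →ₗ[ℝ] M}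
    (h1 : f (1, 0) = g (1, 0)) (h2 : f (0, 1) = g (0, 1))
    (h3 : f (Polynomial.X, 0) = g (Polynomial.X, 0))
    (h4 : f (0, Polynomial.X) = g (0, Polynomial.X))
    (h5 : f (Polynomial.X ^ 2, 0) = g (Polynomial.X ^ 2, 0)) {F : SuperFun ℝ} (hF : F ∈ osp) :
    f F = g F := by
  refine LinearMap.eqOn_span (fun G hG => ?_) hF
  simp only [Set.mem_insert_iff, Set.mem_singleton_iff] at hG
  rcases hG with rfl | rfl | rfl | rfl | rfl <;> assumption

section ospMapGenerators

variable {B : Type*} [Ring B] [Algebra ℝ B] (E Φ : B)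

theorem ospMap_one : ospMap E Φ (1, 0) = E * E := by
  simp [ospMap, Polynomial.coeff_one]

theorem ospMap_theta : ospMap E Φ (0, 1) = (1 / 2 : ℝ) • E := by
  simp [ospMap, Polynomial.coeff_one]

theorem ospMap_x : ospMap E Φ (Polynomial.X, 0) = (1 / 2 : ℝ) • (E * Φ + Φ * E) := by
  simp [ospMap, Polynomial.coeff_X]

theorem ospMap_x_theta : ospMap E Φ (0, Polynomial.X) = (1 / 2 : ℝ) • Φ := by
  simp [ospMap, Polynomial.coeff_X]

theorem ospMap_x_sq : ospMap E Φ (Polynomial.X ^ 2, 0) = Φ * Φ := by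
  simp [ospMap, Polynomial.coeff_X_pow]

end ospMapGenerators

theorem coeffMul_neg (c : A[X]) : coeffMul (-c) = -coeffMul c := by
  refine LinearMap.ext fun f => ?_
  simp [coeffMul_apply]

theorem superMul_even (f : ℝ[X]) :
    (superMul (f, 0) : SuperOp A) = coeffMul (f.map (algebraMap ℝ A)) := by
  simp [superMul, coeffMul_zero]

theorem superMul_odd (f : ℝ[X]) :
    (superMul (0, f) : SuperOp A) = thetaMul A * coeffMul (f.map (algebraMap ℝ A)) := by
  simp [superMul, coeffMul_zero]

theorem etaBarOp_apply (f : SuperFun A) :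
    etaBarOp A f = (f.2, -Polynomial.derivative f.1) := by
  ext <;> simp [etaBarOp, dTheta_apply, thetaMul_apply, dX_apply]

theorem theta_mul_etaBar : thetaMul A * etaBarOp A = thetaMul A * etaOp A := by
  rw [etaBarOp_eq, theta_mul_parity_mul]

/-- All density modules share the same E = η and differ only in the term νθ of Φ, with ν = 2w. By
linearity the comparison is made on the five generators. -/
theorem densityAction_eq_ospMap (w : ℝ) {F : SuperFun ℝ} (hF : F ∈ osp) :
    densityAction A w F = ospMap (etaOp A) (phiOp A (2 * w)) F := by
  change densityActionLinear A w F = _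
  have hX : (coeffMul (Polynomial.C (algebraMap ℝ A 2) * Polynomial.X) : SuperOp A) =
      (2 : ℝ) • coeffMul Polynomial.X := by
    rw [map_ofNat, map_ofNat, two_mul, coeffMul_add, two_smul]
  have he : (etaBarOp A : SuperOp A) = etaOp A - 2 • (thetaMul A * (etaOp A * etaOp A)) := by
    rw [etaBarOp_eq, parityOp_eq, sub_mul, one_mul, two_smul, two_mul, add_mul, mul_assoc]
  refine eqOn_osp ?_ ?_ ?_ ?_ ?_ hF
  · simp [ospMap_one, densityActionLinear, densityAction, contactField, dX_apply, parityOp_apply,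
      etaBarOp_apply, superMul_even, coeffMul_zero, coeffMul_one, eta_mul_eta]
  · simp [ospMap_theta, densityActionLinear, densityAction, contactField, dX_apply,
      parityOp_apply, etaBarOp_apply, superMul_odd, superMul_even, coeffMul_zero, coeffMul_one,
      coeffMul_neg]
    rw [← eta_mul_eta, he]
    simp only [Module.End.neg_mul', one_mul]
    module
  · rw [ospMap_x, eta_phi_anticomm]
    simp [densityActionLinear, densityAction, contactField, dX_apply, parityOp_apply,
      etaBarOp_apply, superMul_even, superMul_odd, coeffMul_one, coeffMul_neg]
    rw [← eta_mul_eta]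
    simp only [Module.End.neg_mul', Module.End.mul_neg', mul_one, theta_mul_etaBar, two_mul]
    module
  · rw [ospMap_x_theta, phiOp]
    simp [densityActionLinear, densityAction, contactField, dX_apply, parityOp_apply,
      etaBarOp_apply, superMul_even, superMul_odd, coeffMul_one, coeffMul_neg]
    rw [← eta_mul_eta, he]
    simp only [Module.End.neg_mul', mul_sub, mul_smul_comm, theta_mul_x, mul_assoc]
    module
  · rw [ospMap_x_sq, phi_sq]
    simp [densityActionLinear, densityAction, contactField, dX_apply, parityOp_apply,
      etaBarOp_apply, superMul_even, superMul_odd, coeffMul_neg, one_add_one_eq_two,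
      hX]
    rw [← eta_mul_eta]
    simp only [Module.End.neg_mul', Module.End.mul_neg', mul_smul_comm, smul_mul_assoc, mul_assoc,
      theta_mul_x_mul, theta_mul_etaBar]
    module

theorem contactField_eq_ospMap {F : SuperFun ℝ} (hF : F ∈ osp) :
    contactField A F = ospMap (etaOp A) (phiOp A 0) F := by
  have h := densityAction_eq_ospMap (A := A) 0 hF
  rwa [densityAction, zero_smul, add_zero, mul_zero] at h

/-- Evaluation on the coordinate x gives F₀ + ½θF₁, which determines F. Hence a bracket determines
its generating function. -/
theorem contactField_injective {F G : SuperFun ℝ} (h : contactField ℝ F = contactField ℝ G) :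
    F = G := by
  have h1 (F : SuperFun ℝ) : contactField ℝ F (Polynomial.X, 0) =
      (F.1, (1 / 2 : ℝ) • F.2) := by
    simp [contactField, dX_apply, etaBarOp_apply, parityOp_apply, superMul, coeffMul_apply,
      thetaMul_apply, Module.End.mul_apply]
    ext1
    · simp
    · simp only [Prod.snd_sub]
      module
  have h2 := h1 F
  rw [h, h1 G, Prod.mk.injEq] at h2
  exact Prod.ext h2.1.symm (smul_right_injective _ (by norm_num : (1 / 2 : ℝ) ≠ 0) h2.2).symm

theorem ospBracket_mem (p q : ZMod 2) (F G : SuperFun ℝ) : ospBracket p q F G ∈ osp := by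
  have he (a b c : ℝ) : ((Polynomial.C a + Polynomial.C b * Polynomial.X +
      Polynomial.C c * Polynomial.X ^ 2, 0) : SuperFun ℝ) ∈ osp := by
    have : ((Polynomial.C a + Polynomial.C b * Polynomial.X +
        Polynomial.C c * Polynomial.X ^ 2, 0) : SuperFun ℝ) =
        a • (1, 0) + b • (Polynomial.X, 0) + c • (Polynomial.X ^ 2, 0) := by
      ext1 <;> simp [Polynomial.smul_eq_C_mul]
    rw [this]
    refine add_mem (add_mem ?_ ?_) ?_ <;>
    exact Submodule.smul_mem _ _ (Submodule.subset_span (by simp))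
  have ho (a b : ℝ) : ((0, Polynomial.C a + Polynomial.C b * Polynomial.X) : SuperFun ℝ) ∈
      osp := by
    have : ((0, Polynomial.C a + Polynomial.C b * Polynomial.X) : SuperFun ℝ) =
        a • (0, 1) + b • (0, Polynomial.X) := by
      ext1 <;> simp [Polynomial.smul_eq_C_mul]
    rw [this]
    refine add_mem ?_ ?_ <;>
    exact Submodule.smul_mem _ _ (Submodule.subset_span (by simp))
  unfold ospBracket
  split_ifs
  exacts [he _ _ _, ho _ _, ho _ _, he _ _ _]

/-- The vector fields themselves are the density action of weight 0, so the general bracket formula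
applies to them. -/
theorem isBracket_ospBracket {p q : ZMod 2} {F G : SuperFun ℝ} (hF : HasParity p F)
    (hG : HasParity q G) (hF' : F ∈ osp) (hG' : G ∈ osp) :
    IsBracket p q F G (ospBracket p q F G) := by
  rw [IsBracket, contactField_eq_ospMap hF', contactField_eq_ospMap hG',
    contactField_eq_ospMap (ospBracket_mem p q F G), ospMap_bracket (ospPair_eta_phi 0) hF hG]

theorem IsBracket.eq_ospBracket {p q : ZMod 2} {F G H : SuperFun ℝ} (h : IsBracket p q F G H)
    (hF : HasParity p F) (hG : HasParity q G) (hF' : F ∈ osp) (hG' : G ∈ osp) :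
    H = ospBracket p q F G :=
  contactField_injective (h.trans (isBracket_ospBracket hF hG hF' hG').symm)

end Densities

/-! ### Differential operators form a ring. -/

section DiffOpsRing

variable {A : Type*} [Ring A] [Algebra ℝ A]

theorem diffOps_generator_mem (i j r : ℕ) (c : A[X]) :
    thetaMul A ^ i * coeffMul c * dTheta A ^ j * dX A ^ r ∈ diffOps A :=
  Submodule.subset_span ⟨i, j, r, c, rfl⟩

theorem mul_mem_diffOps_of_generators {S : SuperOp A}
    (hS : ∀ (i j r : ℕ) (c : A[X]),
      S * (thetaMul A ^ i * coeffMul c * dTheta A ^ j * dX A ^ r) ∈ diffOps A)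
    {T : SuperOp A} (hT : T ∈ diffOps A) : S * T ∈ diffOps A := by
  induction hT using Submodule.span_induction with
  | mem T h => obtain ⟨i, j, r, c, rfl⟩ := h; exact hS i j r c
  | zero => rw [mul_zero]; exact zero_mem _
  | add T T' _ _ h h' => rw [mul_add]; exact add_mem h h'
  | smul a T _ h => rw [mul_smul_comm]; exact Submodule.smul_mem _ _ h

theorem theta_mul_mem_diffOps {T : SuperOp A} (hT : T ∈ diffOps A) :
    thetaMul A * T ∈ diffOps A :=
  mul_mem_diffOps_of_generators (fun i j r c => by
    have := diffOps_generator_mem (i + 1) j r c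
    simpa only [pow_succ', mul_assoc] using this) hT

theorem coeffMul_mul_mem_diffOps (d : A[X]) {T : SuperOp A} (hT : T ∈ diffOps A) :
    coeffMul d * T ∈ diffOps A :=
  mul_mem_diffOps_of_generators (fun i j r c => by
    have := diffOps_generator_mem i j r (d * c)
    have h : coeffMul d * thetaMul A ^ i = thetaMul A ^ i * coeffMul d :=
      (Commute.pow_right (theta_mul_coeffMul d).symm i)
    rwa [← mul_assoc, ← mul_assoc, ← mul_assoc, h, mul_assoc (thetaMul A ^ i), coeffMul_mul]) hT

theorem dX_mul_mem_diffOps {T : SuperOp A} (hT : T ∈ diffOps A) : dX A * T ∈ diffOps A :=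
  mul_mem_diffOps_of_generators (fun i j r c => by
    have h : dX A * thetaMul A ^ i = thetaMul A ^ i * dX A :=
      (Commute.pow_right dX_mul_theta i)
    have h' : dX A * dTheta A ^ j = dTheta A ^ j * dX A :=
      (Commute.pow_right dX_mul_dTheta j)
    have : dX A * (thetaMul A ^ i * coeffMul c * dTheta A ^ j * dX A ^ r) =
        thetaMul A ^ i * coeffMul c * dTheta A ^ j * dX A ^ (r + 1) +
        thetaMul A ^ i * coeffMul (Polynomial.derivative c) * dTheta A ^ j * dX A ^ r := by
      calc _ = (dX A * thetaMul A ^ i) * coeffMul c * dTheta A ^ j * dX A ^ r := by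
            simp only [mul_assoc]
        _ = thetaMul A ^ i * (dX A * coeffMul c) * dTheta A ^ j * dX A ^ r := by
            rw [h]; simp only [mul_assoc]
        _ = thetaMul A ^ i * coeffMul c * (dX A * dTheta A ^ j) * dX A ^ r +
            thetaMul A ^ i * coeffMul (Polynomial.derivative c) * dTheta A ^ j * dX A ^ r := by
            rw [dX_mul_coeffMul]; simp only [mul_assoc, add_mul, mul_add]
        _ = _ := by rw [h', pow_succ']; simp only [mul_assoc]
    rw [this]
    exact add_mem (diffOps_generator_mem _ _ _ _) (diffOps_generator_mem _ _ _ _)) hT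

theorem dTheta_mul_mem_diffOps {T : SuperOp A} (hT : T ∈ diffOps A) :
    dTheta A * T ∈ diffOps A :=
  mul_mem_diffOps_of_generators (fun i j r c => by
    have h0 : dTheta A * (coeffMul c * dTheta A ^ j * dX A ^ r) =
        coeffMul c * dTheta A ^ (j + 1) * dX A ^ r := by
      rw [pow_succ', ← mul_assoc, ← mul_assoc, dTheta_mul_coeffMul]; simp only [mul_assoc]
    match i with
    | 0 =>
      rw [pow_zero, one_mul, h0]
      simpa using diffOps_generator_mem 0 (j + 1) r c
    | 1 =>
      have : dTheta A * (thetaMul A ^ 1 * coeffMul c * dTheta A ^ j * dX A ^ r) =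
          thetaMul A ^ 0 * coeffMul c * dTheta A ^ j * dX A ^ r -
          thetaMul A ^ 1 * coeffMul c * dTheta A ^ (j + 1) * dX A ^ r := by
        calc _ = dTheta A * thetaMul A * (coeffMul c * dTheta A ^ j * dX A ^ r) := by
              rw [pow_one]; simp only [mul_assoc]
          _ = _ := by
              rw [dTheta_mul_theta, sub_mul, mul_assoc (thetaMul A), h0, one_mul, pow_zero,
                one_mul, pow_one]
              simp only [mul_assoc]
      rw [this]
      exact sub_mem (diffOps_generator_mem _ _ _ _) (diffOps_generator_mem _ _ _ _)
    | i + 2 =>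
      have : thetaMul A ^ (i + 2) = 0 := by
        rw [pow_add, pow_two, theta_mul_theta, mul_zero]
      rw [this]
      simp only [zero_mul, mul_zero]
      exact zero_mem _) hT

theorem pow_mul_mem_diffOps {S : SuperOp A}
    (hS : ∀ {T : SuperOp A}, T ∈ diffOps A → S * T ∈ diffOps A) (n : ℕ) {T : SuperOp A}
    (hT : T ∈ diffOps A) : S ^ n * T ∈ diffOps A := by
  induction n with
  | zero => simpa using hT
  | succ n ih => rw [pow_succ', mul_assoc]; exact hS ih

theorem mul_mem_diffOps {S T : SuperOp A} (hS : S ∈ diffOps A) (hT : T ∈ diffOps A) :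
    S * T ∈ diffOps A := by
  induction hS using Submodule.span_induction with
  | mem S h =>
    obtain ⟨i, j, r, c, rfl⟩ := h
    simp only [mul_assoc]
    exact pow_mul_mem_diffOps theta_mul_mem_diffOps i (coeffMul_mul_mem_diffOps c
      (pow_mul_mem_diffOps dTheta_mul_mem_diffOps j (pow_mul_mem_diffOps dX_mul_mem_diffOps r hT)))
  | zero => rw [zero_mul]; exact zero_mem _
  | add S S' _ _ h h' => rw [add_mul]; exact add_mem h h'
  | smul a S _ h => rw [smul_mul_assoc]; exact Submodule.smul_mem _ _ h

theorem one_mem_diffOps : (1 : SuperOp A) ∈ diffOps A := by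
  simpa [coeffMul_one] using diffOps_generator_mem 0 0 0 (1 : A[X])

theorem pow_mem_diffOps {S : SuperOp A} (hS : S ∈ diffOps A) (n : ℕ) : S ^ n ∈ diffOps A := by
  induction n with
  | zero => exact one_mem_diffOps
  | succ n ih => rw [pow_succ']; exact mul_mem_diffOps hS ih

theorem thetaMul_mem_diffOps : thetaMul A ∈ diffOps A := by
  simpa using theta_mul_mem_diffOps one_mem_diffOps

theorem coeffMul_mem_diffOps (c : A[X]) : coeffMul c ∈ diffOps A := by
  simpa using coeffMul_mul_mem_diffOps c one_mem_diffOps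

theorem dX_mem_diffOps : dX A ∈ diffOps A := by
  simpa using dX_mul_mem_diffOps one_mem_diffOps

theorem dTheta_mem_diffOps : dTheta A ∈ diffOps A := by
  simpa using dTheta_mul_mem_diffOps one_mem_diffOps

theorem etaOp_mem_diffOps : etaOp A ∈ diffOps A :=
  add_mem dTheta_mem_diffOps (mul_mem_diffOps thetaMul_mem_diffOps dX_mem_diffOps)

theorem parityOp_mem_diffOps : parityOp A ∈ diffOps A := by
  rw [parityOp_eq, two_mul]
  have := mul_mem_diffOps (thetaMul_mem_diffOps (A := A)) etaOp_mem_diffOps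
  exact sub_mem one_mem_diffOps (add_mem this this)

theorem etaBarOp_mem_diffOps : etaBarOp A ∈ diffOps A :=
  sub_mem dTheta_mem_diffOps (mul_mem_diffOps thetaMul_mem_diffOps dX_mem_diffOps)

theorem superMul_mem_diffOps (F : SuperFun ℝ) : superMul F ∈ diffOps A :=
  add_mem (coeffMul_mem_diffOps _) (mul_mem_diffOps thetaMul_mem_diffOps (coeffMul_mem_diffOps _))

theorem densityAction_mem_diffOps (w : ℝ) (F : SuperFun ℝ) : densityAction A w F ∈ diffOps A :=
  add_mem (sub_mem (mul_mem_diffOps (superMul_mem_diffOps _) dX_mem_diffOps)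
    (Submodule.smul_mem _ _ (mul_mem_diffOps (superMul_mem_diffOps _) etaBarOp_mem_diffOps)))
    (Submodule.smul_mem _ _ (superMul_mem_diffOps _))

theorem oddMul_mem_diffOps (b : A) : oddMul b ∈ diffOps A :=
  mul_mem_diffOps (coeffMul_mem_diffOps _) parityOp_mem_diffOps

theorem upsilon_mem_diffOps (k : ℕ) (G : SuperFun ℝ) : upsilon A k G ∈ diffOps A :=
  mul_mem_diffOps (superMul_mem_diffOps _) (pow_mem_diffOps etaBarOp_mem_diffOps _)

theorem upsilonTilde_mem_diffOps (k : ℕ) (G : SuperFun ℝ) : upsilonTilde A k G ∈ diffOps A :=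
  add_mem (Submodule.smul_mem _ _ (mul_mem_diffOps (superMul_mem_diffOps _)
    (pow_mem_diffOps etaBarOp_mem_diffOps _)))
    (mul_mem_diffOps (superMul_mem_diffOps _) (pow_mem_diffOps etaBarOp_mem_diffOps _))

end DiffOpsRing

/-! ### Degree and parity of operators on superfunctions. -/

section Degrees

variable {A : Type*} [Ring A] [Algebra ℝ A] (𝒜 : ℕ × ZMod 2 → Submodule ℝ A)

/-- A superfunction with coefficients in `A` is homogeneous of degree `n` and parity `p`, where
`d = (n, p)`. -/
def SuperFunHasDegree (d : ℕ × ZMod 2) (f : SuperFun A) : Prop :=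
  ∀ r : ℕ, f.1.coeff r ∈ 𝒜 d ∧ f.2.coeff r ∈ 𝒜 (d + (0, 1))

/-- An operator on superfunctions is homogeneous of degree `n` and parity `p`, where
`d = (n, p)`. -/
def SuperOpHasDegree (d : ℕ × ZMod 2) (T : SuperOp A) : Prop :=
  ∀ (e : ℕ × ZMod 2) (f : SuperFun A), SuperFunHasDegree 𝒜 e f → SuperFunHasDegree 𝒜 (d + e) (T f)

variable {𝒜}

theorem SuperFunHasDegree.zero (d : ℕ × ZMod 2) : SuperFunHasDegree 𝒜 d 0 :=
  fun _ => ⟨by simp, by simp⟩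

theorem SuperFunHasDegree.add {d : ℕ × ZMod 2} {f g : SuperFun A}
    (hf : SuperFunHasDegree 𝒜 d f) (hg : SuperFunHasDegree 𝒜 d g) :
    SuperFunHasDegree 𝒜 d (f + g) := fun r =>
  ⟨by simpa using add_mem (hf r).1 (hg r).1, by simpa using add_mem (hf r).2 (hg r).2⟩

theorem SuperFunHasDegree.smul {d : ℕ × ZMod 2} (a : ℝ) {f : SuperFun A}
    (hf : SuperFunHasDegree 𝒜 d f) : SuperFunHasDegree 𝒜 d (a • f) := fun r =>
  ⟨by simpa using Submodule.smul_mem _ a (hf r).1, by simpa using Submodule.smul_mem _ a (hf r).2⟩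

theorem SuperOpHasDegree.zero (d : ℕ × ZMod 2) : SuperOpHasDegree 𝒜 d 0 :=
  fun _ _ _ => SuperFunHasDegree.zero _

theorem SuperOpHasDegree.add {d : ℕ × ZMod 2} {S T : SuperOp A}
    (hS : SuperOpHasDegree 𝒜 d S) (hT : SuperOpHasDegree 𝒜 d T) :
    SuperOpHasDegree 𝒜 d (S + T) := fun e f hf => (hS e f hf).add (hT e f hf)

theorem SuperOpHasDegree.smul {d : ℕ × ZMod 2} (a : ℝ) {T : SuperOp A}
    (hT : SuperOpHasDegree 𝒜 d T) : SuperOpHasDegree 𝒜 d (a • T) :=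
  fun e f hf => (hT e f hf).smul a

theorem SuperOpHasDegree.neg {d : ℕ × ZMod 2} {T : SuperOp A}
    (hT : SuperOpHasDegree 𝒜 d T) : SuperOpHasDegree 𝒜 d (-T) := fun e f hf r =>
  ⟨by simpa using (hT e f hf r).1, by simpa using (hT e f hf r).2⟩

theorem SuperOpHasDegree.sub {d : ℕ × ZMod 2} {S T : SuperOp A}
    (hS : SuperOpHasDegree 𝒜 d S) (hT : SuperOpHasDegree 𝒜 d T) :
    SuperOpHasDegree 𝒜 d (S - T) := by
  rw [sub_eq_add_neg]; exact hS.add hT.neg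

theorem SuperOpHasDegree.sum {d : ℕ × ZMod 2} {ι : Type*} (s : Finset ι) {T : ι → SuperOp A}
    (hT : ∀ i ∈ s, SuperOpHasDegree 𝒜 d (T i)) : SuperOpHasDegree 𝒜 d (∑ i ∈ s, T i) :=
  Finset.sum_induction _ (SuperOpHasDegree 𝒜 d) (fun _ _ h h' => h.add h') (.zero d) hT

theorem SuperOpHasDegree.mul {d e : ℕ × ZMod 2} {S T : SuperOp A}
    (hS : SuperOpHasDegree 𝒜 d S) (hT : SuperOpHasDegree 𝒜 e T) :
    SuperOpHasDegree 𝒜 (d + e) (S * T) := fun c f hf => by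
  rw [add_assoc]; exact hS _ _ (hT _ _ hf)

theorem SuperOpHasDegree.mul_eq {d e c : ℕ × ZMod 2} {S T : SuperOp A}
    (hS : SuperOpHasDegree 𝒜 d S) (hT : SuperOpHasDegree 𝒜 e T) (h : d + e = c) :
    SuperOpHasDegree 𝒜 c (S * T) := h ▸ hS.mul hT

theorem SuperOpHasDegree.one : SuperOpHasDegree 𝒜 0 1 := fun e f hf => by
  rw [zero_add]; exact hf

theorem odd_add_add_odd (e : ℕ × ZMod 2) : (0, 1) + e + (0, 1) = e := by
  obtain ⟨n, p⟩ := e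
  ext
  · simp
  · revert p; simp only [Prod.snd_add]; decide

theorem superOpHasDegree_theta : SuperOpHasDegree 𝒜 (0, 1) (thetaMul A) := fun e f hf r => by
  rw [odd_add_add_odd, thetaMul_apply]
  exact ⟨by simp, (hf r).1⟩

theorem superOpHasDegree_dTheta : SuperOpHasDegree 𝒜 (0, 1) (dTheta A) := fun e f hf r => by
  rw [odd_add_add_odd, dTheta_apply, add_comm]
  exact ⟨(hf r).2, by simp⟩

theorem superOpHasDegree_parity : SuperOpHasDegree 𝒜 0 (parityOp A) := fun e f hf r => by
  rw [zero_add, parityOp_apply]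
  exact ⟨(hf r).1, by simpa using (hf r).2⟩

theorem superOpHasDegree_dX : SuperOpHasDegree 𝒜 0 (dX A) := fun e f hf r => by
  rw [zero_add, dX_apply]
  have h (s : Submodule ℝ A) (a : A) (ha : a ∈ s) : a * ((r : A) + 1) ∈ s := by
    have : a * ((r : A) + 1) = ((r : ℝ) + 1) • a := by
      rw [Algebra.smul_def, Algebra.commutes]; simp
    rw [this]
    exact s.smul_mem _ ha
  exact ⟨by rw [Polynomial.coeff_derivative]; exact h _ _ (hf _).1,
    by rw [Polynomial.coeff_derivative]; exact h _ _ (hf _).2⟩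

theorem superOpHasDegree_eta : SuperOpHasDegree 𝒜 (0, 1) (etaOp A) :=
  superOpHasDegree_dTheta.add (superOpHasDegree_theta.mul_eq superOpHasDegree_dX (by simp))

theorem superOpHasDegree_etaBar : SuperOpHasDegree 𝒜 (0, 1) (etaBarOp A) :=
  superOpHasDegree_dTheta.sub (superOpHasDegree_theta.mul_eq superOpHasDegree_dX (by simp))

theorem SuperOpHasDegree.pow_odd {T : SuperOp A} (hT : SuperOpHasDegree 𝒜 (0, 1) T) (k : ℕ) :
    SuperOpHasDegree 𝒜 (0, (k : ZMod 2)) (T ^ k) := by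
  induction k with
  | zero => rw [Nat.cast_zero, pow_zero]; exact SuperOpHasDegree.one
  | succ k ih => rw [pow_succ]; exact ih.mul_eq hT (by simp)

variable [GradedAlgebra 𝒜]

theorem superOpHasDegree_coeffMul {d : ℕ × ZMod 2} {c : A[X]} (hc : ∀ r, c.coeff r ∈ 𝒜 d) :
    SuperOpHasDegree 𝒜 d (coeffMul c) := fun e f hf r => by
  rw [coeffMul_apply]
  constructor
  · rw [Polynomial.coeff_mul]
    exact sum_mem fun x _ => SetLike.mul_mem_graded (hc _) (hf _).1
  · rw [Polynomial.coeff_mul, add_assoc]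
    exact sum_mem fun x _ => SetLike.mul_mem_graded (hc _) (hf _).2

theorem superOpHasDegree_evenMul {d : ℕ × ZMod 2} {a : A} (ha : a ∈ 𝒜 d) :
    SuperOpHasDegree 𝒜 d (evenMul a) :=
  superOpHasDegree_coeffMul fun r => by
    rw [Polynomial.coeff_C]; split_ifs
    exacts [ha, zero_mem _]

theorem superOpHasDegree_oddMul {d : ℕ × ZMod 2} {a : A} (ha : a ∈ 𝒜 d) :
    SuperOpHasDegree 𝒜 d (oddMul a) :=
  (superOpHasDegree_evenMul ha).mul_eq superOpHasDegree_parity (add_zero d)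

theorem superOpHasDegree_real (c : ℝ[X]) :
    SuperOpHasDegree 𝒜 0 (coeffMul (c.map (algebraMap ℝ A))) :=
  superOpHasDegree_coeffMul fun r => by
    rw [Polynomial.coeff_map]; exact SetLike.algebraMap_mem_graded 𝒜 _

theorem superOpHasDegree_superMul {p : ZMod 2} {F : SuperFun ℝ} (hF : HasParity p F) :
    SuperOpHasDegree 𝒜 (0, p) (superMul F) := by
  have hz : ∀ p : ZMod 2, p = 0 ∨ p = 1 := by decide
  rcases hz p with rfl | rfl
  · rw [superMul, hF.1 rfl, Polynomial.map_zero, coeffMul_zero, mul_zero, add_zero]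
    exact superOpHasDegree_real _
  · rw [superMul, hF.2 rfl, Polynomial.map_zero, coeffMul_zero, zero_add]
    exact superOpHasDegree_theta.mul_eq (superOpHasDegree_real _) (add_zero _)

theorem superOpHasDegree_x : SuperOpHasDegree 𝒜 0 (coeffMul (Polynomial.X : A[X])) := by
  simpa using superOpHasDegree_real (𝒜 := 𝒜) Polynomial.X

theorem superOpHasDegree_phi (ν : ℝ) : SuperOpHasDegree 𝒜 (0, 1) (phiOp A ν) :=
  (superOpHasDegree_x.mul_eq superOpHasDegree_eta (zero_add _)).add
    (superOpHasDegree_theta.smul ν)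

end Degrees

/-! ### Surjectivity of the commutator with η. -/

section AdEta

variable {A : Type*} [Ring A] [Algebra ℝ A]

variable (A) in
/-- The commutator with `∂ₓ`. -/
def adDX : SuperOp A →ₗ[ℝ] SuperOp A where
  toFun T := dX A * T - T * dX A
  map_add' S T := by simp only [mul_add, add_mul]; abel
  map_smul' r T := by simp only [mul_smul_comm, smul_mul_assoc, RingHom.id_apply, smul_sub]

theorem adDX_apply (T : SuperOp A) : adDX A T = dX A * T - T * dX A := rfl

theorem adDX_generator (i j r : ℕ) (c : A[X]) :
    adDX A (thetaMul A ^ i * coeffMul c * dTheta A ^ j * dX A ^ r) =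
      thetaMul A ^ i * coeffMul (Polynomial.derivative c) * dTheta A ^ j * dX A ^ r := by
  have h : dX A * thetaMul A ^ i = thetaMul A ^ i * dX A :=
    (Commute.pow_right dX_mul_theta i)
  have h' : dTheta A ^ j * dX A = dX A * dTheta A ^ j :=
    (Commute.pow_right dX_mul_dTheta j).symm
  calc _ = (dX A * thetaMul A ^ i) * coeffMul c * dTheta A ^ j * dX A ^ r -
        thetaMul A ^ i * coeffMul c * dTheta A ^ j * (dX A ^ r * dX A) := by
        simp only [adDX_apply, mul_assoc]
    _ = thetaMul A ^ i * (dX A * coeffMul c) * dTheta A ^ j * dX A ^ r -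
        thetaMul A ^ i * coeffMul c * (dTheta A ^ j * dX A) * dX A ^ r := by
        rw [h, ← pow_succ, pow_succ']; simp only [mul_assoc]
    _ = _ := by
        rw [dX_mul_coeffMul, h']
        simp only [mul_assoc, add_mul, mul_add]
        abel

/-- Since ∂ₓ commutes with θ and ∂_θ, the commutator only differentiates the polynomial coefficient,
which dies after finitely many steps. -/
theorem adDX_nilpotent {T : SuperOp A} (hT : T ∈ diffOps A) :
    ∃ n : ℕ, ∀ m, n ≤ m → (adDX A ^ m) T = 0 := by
  induction hT using Submodule.span_induction with
  | mem T h =>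
    obtain ⟨i, j, r, c, rfl⟩ := h
    refine ⟨c.natDegree + 1, fun m hm => ?_⟩
    have key : ∀ m : ℕ, (adDX A ^ m) (thetaMul A ^ i * coeffMul c * dTheta A ^ j * dX A ^ r) =
        thetaMul A ^ i * coeffMul (Polynomial.derivative^[m] c) * dTheta A ^ j * dX A ^ r := by
      intro m
      induction m with
      | zero => simp
      | succ m ih =>
        rw [pow_succ', Module.End.mul_apply, ih, adDX_generator, Function.iterate_succ_apply']
    rw [key, Polynomial.iterate_derivative_eq_zero (by omega), coeffMul_zero]
    simp
  | zero => exact ⟨0, fun m _ => map_zero _⟩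
  | add T T' _ _ h h' =>
    obtain ⟨n, hn⟩ := h
    obtain ⟨n', hn'⟩ := h'
    refine ⟨max n n', fun m hm => ?_⟩
    rw [map_add, hn m (le_trans (le_max_left _ _) hm), hn' m (le_trans (le_max_right _ _) hm),
      add_zero]
  | smul a T _ h =>
    obtain ⟨n, hn⟩ := h
    exact ⟨n, fun m hm => by rw [map_smul, hn m hm, smul_zero]⟩

/-- The partial sum of the series `∑ (-1)^k x^{k+1}/(k+1)! ad(∂ₓ)^k T`, a primitive of `T`. -/
def adDXPrimitive (n : ℕ) (T : SuperOp A) : SuperOp A :=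
  ∑ k ∈ Finset.range n, ((-1 : ℝ) ^ k * ((k + 1).factorial : ℝ)⁻¹) •
    (coeffMul (Polynomial.X ^ (k + 1)) * (adDX A ^ k) T)

theorem adDX_x_pow (k : ℕ) (T : SuperOp A) :
    adDX A (coeffMul (Polynomial.X ^ (k + 1)) * T) =
      ((k : ℝ) + 1) • (coeffMul (Polynomial.X ^ k) * T) +
        coeffMul (Polynomial.X ^ (k + 1)) * adDX A T := by
  have h : (coeffMul (Polynomial.derivative (Polynomial.X ^ (k + 1))) : SuperOp A) =
      ((k : ℝ) + 1) • coeffMul (Polynomial.X ^ k) := by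
    rw [← coeffMul_smul]
    congr 1
    rw [Polynomial.derivative_X_pow]
    ext n
    simp [Algebra.smul_def]
  rw [adDX_apply, ← mul_assoc, dX_mul_coeffMul, h, adDX_apply, mul_sub]
  simp only [add_mul, smul_mul_assoc, mul_assoc]
  abel

/-- The sum telescopes: differentiating x^{k+1}/(k+1)! in one term cancels the term of the previous
index in which the commutator falls on T. Only the last remainder is left, and it vanishes for large
n on differential operators. -/
theorem adDX_primitive (n : ℕ) (T : SuperOp A) :
    adDX A (adDXPrimitive n T) = T - ((-1 : ℝ) ^ n * (n.factorial : ℝ)⁻¹) •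
      (coeffMul (Polynomial.X ^ n) * (adDX A ^ n) T) := by
  induction n with
  | zero => simp [adDXPrimitive, coeffMul_one]
  | succ n ih =>
    have h1 : adDXPrimitive (n + 1) T = adDXPrimitive n T +
        ((-1 : ℝ) ^ n * ((n + 1).factorial : ℝ)⁻¹) •
          (coeffMul (Polynomial.X ^ (n + 1)) * (adDX A ^ n) T) := Finset.sum_range_succ _ _
    have h2 : ((n + 1).factorial : ℝ)⁻¹ * ((n : ℝ) + 1) = (n.factorial : ℝ)⁻¹ := by
      rw [Nat.factorial_succ]
      push_cast
      field_simp
    rw [h1, map_add, ih, map_smul, adDX_x_pow, smul_add, smul_smul, mul_assoc, h2,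
      ← Module.End.mul_apply, ← pow_succ', pow_succ (-1 : ℝ)]
    module

/-- If [∂ₓ, U] = S, then T = ηU + Uη satisfies [η, T] = [η², U] = S, because η² = ∂ₓ. The clause on
S = 0 later keeps the gauge operator finite in each column of components. -/
theorem exists_eta_primitive {S : SuperOp A} (hS : S ∈ diffOps A) :
    ∃ T ∈ diffOps A, etaOp A * T - T * etaOp A = S ∧ (S = 0 → T = 0) ∧
      ∀ (𝒜 : ℕ × ZMod 2 → Submodule ℝ A) [GradedAlgebra 𝒜] (d : ℕ × ZMod 2),
        SuperOpHasDegree 𝒜 d S → SuperOpHasDegree 𝒜 (d + (0, 1)) T := by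
  obtain ⟨n, hn⟩ := adDX_nilpotent hS
  have hU := adDX_primitive n S
  rw [hn n le_rfl, mul_zero, smul_zero, sub_zero] at hU
  set U := adDXPrimitive n S with hUdef
  have had : ∀ k, (adDX A ^ k) S ∈ diffOps A := fun k => by
    induction k with
    | zero => exact hS
    | succ k ih =>
      rw [pow_succ', Module.End.mul_apply, adDX_apply]
      exact sub_mem (mul_mem_diffOps dX_mem_diffOps ih) (mul_mem_diffOps ih dX_mem_diffOps)
  have hUm : U ∈ diffOps A := Submodule.sum_mem _ fun k _ => Submodule.smul_mem _ _
    (mul_mem_diffOps (coeffMul_mem_diffOps _) (had k))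
  refine ⟨etaOp A * U + U * etaOp A, add_mem (mul_mem_diffOps etaOp_mem_diffOps hUm)
    (mul_mem_diffOps hUm etaOp_mem_diffOps), ?_, fun hS0 => ?_, fun 𝒜 _ d hd => ?_⟩
  · rw [← hU, adDX_apply, ← eta_mul_eta]
    simp only [mul_add, add_mul, mul_assoc]
    abel
  · simp [hUdef, adDXPrimitive, hS0]
  · have hadd : ∀ k, SuperOpHasDegree 𝒜 d ((adDX A ^ k) S) := fun k => by
      induction k with
      | zero => exact hd
      | succ k ih =>
        rw [pow_succ', Module.End.mul_apply, adDX_apply]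
        exact (superOpHasDegree_dX.mul_eq ih (zero_add d)).sub
          (ih.mul_eq superOpHasDegree_dX (add_zero d))
    have hUd : SuperOpHasDegree 𝒜 d U := SuperOpHasDegree.sum _ fun k _ =>
      SuperOpHasDegree.smul _ (SuperOpHasDegree.mul_eq
        (by simpa using superOpHasDegree_real (𝒜 := 𝒜) (Polynomial.X ^ (k + 1))) (hadd k)
        (zero_add d))
    exact (superOpHasDegree_eta.mul_eq hUd (add_comm _ _)).add
      (hUd.mul superOpHasDegree_eta)

end AdEta

/-! ### The commutant of η. -/

section EtaSum

variable {A : Type*} [Ring A] [Algebra ℝ A]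

/-- The operator `∑ₖ cₖ ηᵏ`. -/
def etaSum : (ℕ →₀ A) →+ SuperOp A :=
  Finsupp.liftAddHom fun k =>
    { toFun := fun a => evenMul a * etaOp A ^ k
      map_zero' := by rw [evenMul_zero, zero_mul]
      map_add' := fun a b => by rw [evenMul_add, add_mul] }

theorem etaSum_single (k : ℕ) (a : A) :
    etaSum (Finsupp.single k a) = evenMul a * etaOp A ^ k := by
  rw [etaSum, Finsupp.liftAddHom_apply]
  exact Finsupp.sum_single_index (by simp [evenMul_zero])

theorem etaSum_eq (c : ℕ →₀ A) : etaSum c = ∑ k ∈ c.support, evenMul (c k) * etaOp A ^ k := rfl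

theorem etaSum_smul (r : ℝ) (c : ℕ →₀ A) : etaSum (r • c) = r • etaSum c := by
  induction c using Finsupp.induction_linear with
  | zero => simp
  | add c d hc hd => rw [smul_add, map_add, map_add, hc, hd, smul_add]
  | single k b => rw [Finsupp.smul_single, etaSum_single, etaSum_single, evenMul_smul,
          smul_mul_assoc]

theorem eta_mul_etaSum (c : ℕ →₀ A) : etaOp A * etaSum c = etaSum c * etaOp A := by
  induction c using Finsupp.induction_linear with
  | zero => simp
  | add c d hc hd => rw [map_add, mul_add, add_mul, hc, hd]
  | single k a => rw [etaSum_single, eta_comm_evenMul_mul, ← pow_succ', mul_assoc, pow_succ]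

theorem etaSum_mem_diffOps (c : ℕ →₀ A) : etaSum c ∈ diffOps A := by
  rw [etaSum_eq]
  exact Submodule.sum_mem _ fun k _ => mul_mem_diffOps (coeffMul_mem_diffOps _)
    (pow_mem_diffOps etaOp_mem_diffOps k)

theorem superOpHasDegree_etaSum {𝒜 : ℕ × ZMod 2 → Submodule ℝ A} [GradedAlgebra 𝒜] {n : ℕ}
    {q : ZMod 2} {c : ℕ →₀ A} (hc : ∀ k : ℕ, c k ∈ 𝒜 (n, q + k)) :
    SuperOpHasDegree 𝒜 (n, q) (etaSum c) := by
  rw [etaSum_eq]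
  refine SuperOpHasDegree.sum _ fun k _ => (superOpHasDegree_evenMul (hc k)).mul_eq
    (superOpHasDegree_eta.pow_odd k) ?_
  ext
  · simp
  · change q + k + k = q
    rw [add_assoc, CharTwo.add_self_eq_zero, add_zero]

/-- The value at the origin of the even part of a superfunction. -/
def evalOrigin (f : SuperFun A) : A := f.1.coeff 0

variable (A) in
/-- A basis of the superfunctions on which `η` acts as a shift. -/
def etaBasis (k : ℕ) : SuperFun A :=
  let f : A[X] := Polynomial.monomial (k / 2) (algebraMap ℝ A ((k / 2).factorial : ℝ)⁻¹)
  if Even k then (f, 0) else (0, f)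

theorem eta_etaBasis_zero : etaOp A (etaBasis A 0) = 0 := by
  simp [etaBasis, etaOp_apply]

theorem eta_etaBasis_succ (k : ℕ) : etaOp A (etaBasis A (k + 1)) = etaBasis A k := by
  rw [etaOp_apply]
  rcases Nat.even_or_odd' k with ⟨l, rfl | rfl⟩
  · have h1 : (2 * l + 1) / 2 = l := by omega
    simp [etaBasis, h1]
  · have h1 : (2 * l + 1 + 1) / 2 = l + 1 := by omega
    have h2 : (2 * l + 1) / 2 = l := by omega
    have h3 : Even (2 * l + 1 + 1) := ⟨l + 1, by ring⟩
    have h4 : algebraMap ℝ A ((l + 1).factorial : ℝ)⁻¹ * ((l : A) + 1) =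
        algebraMap ℝ A (l.factorial : ℝ)⁻¹ := by
      have : ((l : A) + 1) = algebraMap ℝ A ((l : ℝ) + 1) := by simp
      rw [this, ← map_mul]
      congr 1
      rw [Nat.factorial_succ]
      push_cast
      field_simp
    simp [etaBasis, h1, h2, h3, h4]

/-- The functionals f ↦ (ηˡf)(0) are dual to this basis, so they read off the coefficients of a
polynomial in η. -/
theorem evalOrigin_eta_pow (l k : ℕ) :
    evalOrigin ((etaOp A ^ l) (etaBasis A k)) = if l = k then 1 else 0 := by
  induction l generalizing k with
  | zero =>
    rcases k with _ | k
    · simp [evalOrigin, etaBasis]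
    · rw [pow_zero, Module.End.one_apply, if_neg (by omega), evalOrigin, etaBasis]
      split_ifs with h
      · have : (k + 1) / 2 ≠ 0 := by
          rcases h with ⟨r, hr⟩; omega
        simp [Polynomial.coeff_monomial, this]
      · simp
  | succ l ih =>
    rw [pow_succ, Module.End.mul_apply]
    rcases k with _ | k
    · rw [eta_etaBasis_zero]; simp [evalOrigin]
    · rw [eta_etaBasis_succ, ih]; simp

theorem evalOrigin_add (f g : SuperFun A) :
    evalOrigin (f + g) = evalOrigin f + evalOrigin g := by
  simp [evalOrigin]

theorem evalOrigin_coeffMul (c : A[X]) (f : SuperFun A) :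
    evalOrigin (coeffMul c f) = c.coeff 0 * evalOrigin f := by
  simp [evalOrigin, coeffMul_apply, Polynomial.mul_coeff_zero]

theorem evalOrigin_evenMul (a : A) (f : SuperFun A) :
    evalOrigin (evenMul a f) = a * evalOrigin f := by
  rw [evenMul, evalOrigin_coeffMul, Polynomial.coeff_C_zero]

theorem evalOrigin_etaSum_basis (c : ℕ →₀ A) (k : ℕ) :
    evalOrigin (etaSum c (etaBasis A k)) = c k := by
  induction c using Finsupp.induction_linear with
  | zero => simp [evalOrigin]
  | add c d hc hd => rw [map_add, LinearMap.add_apply, evalOrigin_add, hc, hd, Finsupp.add_apply]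
  | single l a =>
    rw [etaSum_single, Module.End.mul_apply, evalOrigin_evenMul, evalOrigin_eta_pow,
      Finsupp.single_apply]
    split_ifs <;> simp

theorem etaSum_injective : Function.Injective (etaSum (A := A)) := fun c d h => by
  ext k
  rw [← evalOrigin_etaSum_basis c, h, evalOrigin_etaSum_basis]

theorem etaBasis_hasDegree (𝒜 : ℕ × ZMod 2 → Submodule ℝ A) [GradedAlgebra 𝒜] (k : ℕ) :
    SuperFunHasDegree 𝒜 (0, (k : ZMod 2)) (etaBasis A k) := fun r => by
  have h (m : ℕ) (a : ℝ) : (Polynomial.monomial m (algebraMap ℝ A a)).coeff r ∈ 𝒜 (0, 0) := by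
    rw [Polynomial.coeff_monomial]
    split_ifs
    exacts [SetLike.algebraMap_mem_graded 𝒜 _, zero_mem _]
  rw [etaBasis]
  rcases Nat.even_or_odd' k with ⟨l, rfl | rfl⟩
  · have h0 : ((2 * l : ℕ) : ZMod 2) = 0 := by
      push_cast; rw [show (2 : ZMod 2) = 0 from rfl, zero_mul]
    rw [h0]
    simpa using h _ _
  · have h0 : ((2 * l + 1 : ℕ) : ZMod 2) = 1 := by
      push_cast; rw [show (2 : ZMod 2) = 0 from rfl, zero_mul, zero_add]
    rw [h0, show ((0, 1) + (0, 1) : ℕ × ZMod 2) = (0, 0) from rfl]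
    simpa using h _ _

/-- This is Taylor's formula at the origin: η^{2r} and η^{2r+1} produce the r-th derivatives of the
even and of the odd part. -/
theorem eq_zero_of_evalOrigin {f : SuperFun A} (h : ∀ k, evalOrigin ((etaOp A ^ k) f) = 0) :
    f = 0 := by
  have key (r : ℕ) (g : A[X]) : (Polynomial.derivative^[r] g).coeff 0 = r.factorial • g.coeff r := by
    rw [Polynomial.coeff_iterate_derivative]; simp [Nat.descFactorial_self]
  have hpow : ∀ (r : ℕ) (f : SuperFun A), (etaOp A ^ (2 * r)) f =
      (Polynomial.derivative^[r] f.1, Polynomial.derivative^[r] f.2) := by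
    intro r
    induction r with
    | zero => intro f; simp
    | succ r ih =>
      intro f
      rw [mul_add, pow_add, Module.End.mul_apply, ih]
      simp [pow_two, Module.End.mul_apply, etaOp_apply]
  -- Factorials can be cancelled because A is a real vector space.
  have hfac (r : ℕ) (a : A) (h : r.factorial • a = 0) : a = 0 := by
    have h1 : ((r.factorial : ℝ)) • a = 0 := by rw [Nat.cast_smul_eq_nsmul, h]
    exact (smul_eq_zero.mp h1).resolve_left (by positivity)
  ext r
  · have := h (2 * r)
    rw [hpow, evalOrigin, key] at this
    simpa using hfac r _ this
  · have := h (2 * r + 1)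
    rw [pow_succ, Module.End.mul_apply, hpow, etaOp_apply, evalOrigin, key] at this
    simpa using hfac r _ this

/-- At the origin every term with a factor θ on the left vanishes and only the constant term of c
counts. There ∂ₓʳ is η^{2r}, and ∂_θ∂ₓʳ has the same value as η^{2r+1}, since η - ∂_θ is divisible
by θ. -/
theorem exists_evalOrigin_eq {T : SuperOp A} (hT : T ∈ diffOps A) :
    ∃ c : ℕ →₀ A, ∀ f, evalOrigin (T f) = evalOrigin (etaSum c f) := by
  induction hT using Submodule.span_induction with
  | mem T h =>
    obtain ⟨i, j, r, c, rfl⟩ := h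
    have hpow : etaOp A ^ (2 * r) = dX A ^ r := by rw [pow_mul, pow_two, eta_mul_eta]
    match i, j with
    | 0, 0 =>
      refine ⟨Finsupp.single (2 * r) (c.coeff 0), fun f => ?_⟩
      simp only [pow_zero, one_mul, mul_one]
      rw [etaSum_single, Module.End.mul_apply, evalOrigin_coeffMul, Module.End.mul_apply,
        evalOrigin_evenMul, hpow]
    | 0, 1 =>
      refine ⟨Finsupp.single (2 * r + 1) (c.coeff 0), fun f => ?_⟩
      simp only [pow_zero, one_mul, pow_one]
      rw [etaSum_single, mul_assoc, Module.End.mul_apply, evalOrigin_coeffMul,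
        Module.End.mul_apply, Module.End.mul_apply, evalOrigin_evenMul, pow_succ', hpow,
        Module.End.mul_apply, dTheta_apply, etaOp_apply, evalOrigin, evalOrigin]
    | 0, j + 2 =>
      refine ⟨0, fun f => ?_⟩
      have : dTheta A ^ (j + 2) = 0 := by rw [pow_add, pow_two, dTheta_mul_dTheta, mul_zero]
      rw [this, mul_zero, zero_mul, map_zero]
    | i + 1, j =>
      refine ⟨0, fun f => ?_⟩
      rw [pow_succ', mul_assoc, mul_assoc, mul_assoc, Module.End.mul_apply, thetaMul_apply]
      simp [evalOrigin]
  | zero => exact ⟨0, fun f => by simp⟩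
  | add T T' _ _ h h' =>
    obtain ⟨c, hc⟩ := h
    obtain ⟨c', hc'⟩ := h'
    refine ⟨c + c', fun f => ?_⟩
    rw [LinearMap.add_apply, evalOrigin_add, hc, hc', map_add, LinearMap.add_apply,
      evalOrigin_add]
  | smul a T _ h =>
    obtain ⟨c, hc⟩ := h
    refine ⟨a • c, fun f => ?_⟩
    have h2 (g : SuperFun A) : evalOrigin (a • g) = a • evalOrigin g := by simp [evalOrigin]
    rw [etaSum_smul, LinearMap.smul_apply, LinearMap.smul_apply, h2, h2, hc]

/-- The differential operators that commute with `η` are the polynomials in `η`. -/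
theorem exists_etaSum_of_commute {T : SuperOp A} (hT : T ∈ diffOps A)
    (hη : etaOp A * T = T * etaOp A) :
    ∃ c : ℕ →₀ A, T = etaSum c ∧
      ∀ (𝒜 : ℕ × ZMod 2 → Submodule ℝ A) [GradedAlgebra 𝒜] (n : ℕ) (q : ZMod 2),
        SuperOpHasDegree 𝒜 (n, q) T → ∀ k : ℕ, c k ∈ 𝒜 (n, q + k) := by
  obtain ⟨c, hc⟩ := exists_evalOrigin_eq hT
  have hTc : T = etaSum c := by
    -- The difference of the two operators commutes with η and has value zero at the origin on every
    -- function, so all the numbers (ηᵏ(Tf - c(η)f))(0) vanish.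
    refine LinearMap.ext fun f => sub_eq_zero.mp (eq_zero_of_evalOrigin fun k => ?_)
    have h1 : etaOp A ^ k * T = T * etaOp A ^ k := (Commute.pow_left hη k)
    have h2 : etaOp A ^ k * etaSum c = etaSum c * etaOp A ^ k :=
      (Commute.pow_left (eta_mul_etaSum c) k)
    rw [map_sub, ← Module.End.mul_apply, ← Module.End.mul_apply, h1, h2, Module.End.mul_apply,
      Module.End.mul_apply, evalOrigin, Prod.fst_sub, Polynomial.coeff_sub]
    exact sub_eq_zero.mpr (hc _)
  refine ⟨c, hTc, fun 𝒜 _ n q hd k => ?_⟩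
  have := (hd _ _ (etaBasis_hasDegree 𝒜 k) 0).1
  rw [hTc] at this
  simpa using (evalOrigin_etaSum_basis c k) ▸ this

end EtaSum

/-! ### Gauge transformations of one component. -/

section Gauge

variable {A : Type*} [Ring A] [Algebra ℝ A]

/-- The coefficients in the commutation relations of `ηᵏ` and `x η + ν θ`. -/
def gaugeCoeff (ν : ℝ) : ℕ → ℝ
  | 0 => 0
  | k + 1 => ν + k - gaugeCoeff ν k

/-- The closed form locates the zeros, which decide what survives every gauge transformation: the
index 0, and the odd index 2l + 1 exactly when ν = -l. -/
theorem gaugeCoeff_even (ν : ℝ) (l : ℕ) :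
    gaugeCoeff ν (2 * l) = l ∧ gaugeCoeff ν (2 * l + 1) = ν + l := by
  induction l with
  | zero => simp [gaugeCoeff]
  | succ l ih =>
    have h : gaugeCoeff ν (2 * (l + 1)) = (l + 1 : ℕ) := by
      rw [mul_add, mul_one, gaugeCoeff, ih.2]; push_cast; ring
    refine ⟨h, ?_⟩
    rw [gaugeCoeff, h]; push_cast; ring

/-- Moving one η past φ gives ηφ = φη + θη + νσ. Further, ηθηᵏ = σηᵏ + θη^{k+1}, while η
anticommutes with σ; this is the origin of the recursion γ_{k+1} = ν + k - γ_k. For k = 0 the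
truncated exponent is harmless, as γ_0 = 0. -/
theorem eta_pow_mul_phi (ν : ℝ) (k : ℕ) :
    etaOp A ^ k * phiOp A ν = phiOp A ν * etaOp A ^ k +
      gaugeCoeff ν k • (parityOp A * etaOp A ^ (k - 1)) +
      (k : ℝ) • (thetaMul A * etaOp A ^ k) := by
  have hσ (T : SuperOp A) : T = parityOp A * T + (2 : ℝ) • (thetaMul A * (etaOp A * T)) := by
    rw [parityOp_eq, sub_mul, one_mul, two_mul, add_mul, mul_assoc, two_smul, sub_add_cancel]
  have hφ : etaOp A * phiOp A ν = phiOp A ν * etaOp A + thetaMul A * etaOp A +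
      ν • parityOp A := by
    rw [parityOp_eq]
    simp only [phiOp, mul_add, add_mul, eta_mul_x_mul, mul_smul_comm, eta_mul_theta,
      smul_mul_assoc, two_mul, mul_assoc]
    module
  induction k with
  | zero => simp [gaugeCoeff]
  | succ k ih =>
    have h1 : gaugeCoeff ν k • (etaOp A * (parityOp A * etaOp A ^ (k - 1))) =
        -(gaugeCoeff ν k • (parityOp A * etaOp A ^ k)) := by
      rcases k with _ | k
      · simp [gaugeCoeff]
      · rw [Nat.add_sub_cancel, pow_succ', parity_mul_eta_mul, smul_neg, neg_neg]
    have h2 := hσ (etaOp A ^ k)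
    rw [← pow_succ'] at h2
    rw [pow_succ', mul_assoc, ih, mul_add, mul_add, ← mul_assoc, hφ, mul_smul_comm, h1,
      mul_smul_comm, eta_mul_theta_mul, ← pow_succ', Nat.add_sub_cancel, gaugeCoeff]
    simp only [add_mul, mul_assoc, smul_mul_assoc, ← pow_succ']
    push_cast
    linear_combination (norm := module) (k : ℝ) • h2

/-- Scale the coefficients. -/
def scaleCoeff (r : ℕ → ℝ) : (ℕ →₀ A) →+ (ℕ →₀ A) :=
  Finsupp.liftAddHom fun k => (Finsupp.singleAddHom k).comp (DistribSMul.toAddMonoidHom A (r k))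

theorem scaleCoeff_single (r : ℕ → ℝ) (k : ℕ) (a : A) :
    scaleCoeff r (Finsupp.single k a) = Finsupp.single k (r k • a) := by
  rw [scaleCoeff, Finsupp.liftAddHom_apply, Finsupp.sum_single_index] <;> simp

theorem scaleCoeff_apply (r : ℕ → ℝ) (c : ℕ →₀ A) (k : ℕ) : scaleCoeff r c k = r k • c k := by
  induction c using Finsupp.induction_linear with
  | zero => simp
  | add c d hc hd => simp [hc, hd]
  | single l a =>
    rw [scaleCoeff_single, Finsupp.single_apply, Finsupp.single_apply]
    split_ifs with h
    · rw [h]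
    · rw [smul_zero]

/-- The map `c ↦ d` with `d k = gaugeCoeff ν (k + 1) • c (k + 1)`. -/
def gaugeShift (ν : ℝ) : (ℕ →₀ A) →+ (ℕ →₀ A) :=
  Finsupp.liftAddHom fun k =>
    (Finsupp.singleAddHom (k - 1)).comp (DistribSMul.toAddMonoidHom A (gaugeCoeff ν k))

theorem gaugeShift_single (ν : ℝ) (k : ℕ) (a : A) :
    gaugeShift ν (Finsupp.single k a) = Finsupp.single (k - 1) (gaugeCoeff ν k • a) := by
  rw [gaugeShift, Finsupp.liftAddHom_apply, Finsupp.sum_single_index] <;> simp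

theorem gaugeShift_apply (ν : ℝ) (c : ℕ →₀ A) (k : ℕ) :
    gaugeShift ν c k = gaugeCoeff ν (k + 1) • c (k + 1) := by
  induction c using Finsupp.induction_linear with
  | zero => simp
  | add c d hc hd => simp [hc, hd]
  | single l a =>
    rw [gaugeShift_single]
    rcases l with _ | l
    · simp [gaugeCoeff]
    · rw [Nat.add_sub_cancel, Finsupp.single_apply, Finsupp.single_apply]
      split_ifs with h h' h'
      · rw [h]
      · omega
      · omega
      · rw [smul_zero]

theorem phiOp_add (ν w : ℝ) : phiOp A (ν + w) = phiOp A ν + w • thetaMul A := by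
  rw [phiOp, phiOp]; module

/-- Scalars commute with all the operators involved, so the formula for one power extends by
linearity. It is the gauge action of a polynomial in η between weights ν/2 and (ν + w)/2: diagonal
in the θ-part, with zero eigenvalue at the power w, and a shift by one power in the σ-part. -/
theorem etaSum_mul_phi (ν w : ℝ) (c : ℕ →₀ A) :
    etaSum c * phiOp A ν - phiOp A (ν + w) * etaSum c =
      thetaMul A * etaSum (scaleCoeff (fun k => k - w) c) +
        parityOp A * etaSum (gaugeShift ν c) := by
  induction c using Finsupp.induction_linear with
  | zero => simp
  | add c d hc hd =>
    simp only [map_add, mul_add, add_mul]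
    rw [add_add_add_comm, ← hc, ← hd]
    abel
  | single k a =>
    have hcomm : phiOp A (ν + w) * evenMul a = evenMul a * phiOp A (ν + w) := by
      simp only [phiOp, add_mul, mul_add, mul_assoc, evenMul_comm_eta, x_comm_evenMul_mul,
        smul_mul_assoc, mul_smul_comm, evenMul_comm_theta]
    rw [gaugeShift_single, scaleCoeff_single, etaSum_single, etaSum_single, etaSum_single,
      mul_assoc, eta_pow_mul_phi, ← mul_assoc (phiOp A (ν + w)), hcomm, evenMul_smul, evenMul_smul,
      phiOp_add]
    simp only [mul_add, add_mul, mul_assoc, smul_mul_assoc, mul_smul_comm, theta_comm_evenMul_mul,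
      parity_comm_evenMul_mul]
    module

variable (A) in
/-- The action `2 x ∂ₓ + θ ∂_θ + ν` of `2X_x` on densities of weight `ν / 2`. -/
def weightOp (ν : ℝ) : SuperOp A := etaOp A * phiOp A ν + phiOp A ν * etaOp A

theorem eta_theta_mul_etaSum (c : ℕ →₀ A) :
    etaOp A * (thetaMul A * etaSum c) + thetaMul A * etaSum c * etaOp A = etaSum c := by
  rw [eta_mul_theta_mul, mul_assoc, eta_mul_etaSum, sub_add_cancel]

theorem eta_parity_mul_etaSum (c : ℕ →₀ A) :
    etaOp A * (parityOp A * etaSum c) + parityOp A * etaSum c * etaOp A = 0 := by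
  rw [mul_assoc, ← eta_mul_etaSum, parity_mul_eta_mul, add_neg_cancel]

/-- Take the anticommutator of `etaSum_mul_phi` with η: the θ-part gives back its polynomial, and
the σ-part anticommutes with η. -/
theorem etaSum_mul_weight (ν w : ℝ) (c : ℕ →₀ A) :
    etaSum c * weightOp A ν - weightOp A (ν + w) * etaSum c =
      etaSum (scaleCoeff (fun k => k - w) c) := by
  have h := etaSum_mul_phi ν w c
  have h1 : etaSum c * weightOp A ν - weightOp A (ν + w) * etaSum c =
      etaOp A * (etaSum c * phiOp A ν - phiOp A (ν + w) * etaSum c) +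
      (etaSum c * phiOp A ν - phiOp A (ν + w) * etaSum c) * etaOp A := by
    simp only [weightOp, mul_add, add_mul, mul_sub, sub_mul, mul_assoc, ← eta_mul_etaSum]
    simp only [← mul_assoc, eta_mul_etaSum]
    abel
  rw [h1, h, mul_add, add_mul, add_add_add_comm, eta_theta_mul_etaSum, eta_parity_mul_etaSum,
    add_zero]

/-- The anticommutator with η recovers c, and σ² = 1 then recovers p. -/
theorem theta_parity_etaSum_injective {c d p q : ℕ →₀ A}
    (h : thetaMul A * etaSum c + parityOp A * etaSum p =
      thetaMul A * etaSum d + parityOp A * etaSum q) : c = d ∧ p = q := by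
  have h1 : c = d := by
    apply etaSum_injective
    have h2 (c p : ℕ →₀ A) : etaOp A * (thetaMul A * etaSum c + parityOp A * etaSum p) +
        (thetaMul A * etaSum c + parityOp A * etaSum p) * etaOp A = etaSum c := by
      rw [mul_add, add_mul, add_add_add_comm, eta_theta_mul_etaSum, eta_parity_mul_etaSum,
        add_zero]
    rw [← h2 c p, h, h2]
  refine ⟨h1, etaSum_injective ?_⟩
  rw [h1] at h
  have h3 := congrArg (fun T => parityOp A * T) (add_left_cancel h)
  simpa only [parity_mul_parity_mul] using h3

theorem weight_mul_theta (ν : ℝ) :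
    weightOp A ν * thetaMul A = thetaMul A * weightOp A ν + thetaMul A := by
  rw [weightOp, eta_phi_anticomm]
  simp only [mul_add, add_mul, mul_assoc, eta_mul_theta_mul, eta_mul_theta, mul_smul_comm,
      mul_sub, theta_mul_x_mul, theta_mul_theta_mul, smul_mul_assoc,
      mul_one, one_mul]
  module

theorem parity_mul_phi (ν : ℝ) : parityOp A * phiOp A ν = -(phiOp A ν * parityOp A) := by
  simp only [phiOp, mul_add, add_mul, mul_assoc, mul_smul_comm, smul_mul_assoc, parity_mul_x_mul,
    parity_mul_eta, parity_mul_theta, theta_mul_parity, Module.End.mul_neg']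
  module

theorem weight_mul_parity (ν : ℝ) :
    weightOp A ν * parityOp A = parityOp A * weightOp A ν := by
  have h1 (T : SuperOp A) : parityOp A * (phiOp A ν * T) = -(phiOp A ν * (parityOp A * T)) := by
    rw [← mul_assoc, parity_mul_phi, Module.End.neg_mul', mul_assoc]
  simp only [weightOp, add_mul, mul_add, mul_assoc, parity_mul_eta_mul, h1, parity_mul_phi,
    parity_mul_eta, Module.End.mul_neg', neg_neg]

theorem weight_mul_theta_parity (ν w : ℝ) (c p : ℕ →₀ A) :
    weightOp A (ν + w) * (thetaMul A * etaSum c + parityOp A * etaSum p) -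
        (thetaMul A * etaSum c + parityOp A * etaSum p) * weightOp A ν =
      thetaMul A * etaSum (c - scaleCoeff (fun k => k - w) c) -
        parityOp A * etaSum (scaleCoeff (fun k => k - w) p) := by
  rw [map_sub, ← etaSum_mul_weight ν w c, ← etaSum_mul_weight ν w p, mul_add, ← mul_assoc,
    ← mul_assoc, weight_mul_theta, weight_mul_parity]
  simp only [add_mul, mul_sub, mul_assoc]
  abel

/-- Linear algebra of the gauge transformation `Φ ↦ Φ + J φ - φ' J`, with `J` chosen such that it
kills the deformation of `η`. -/
theorem exists_gauge_eta {ν w : ℝ} {E Φ : SuperOp A} (hE : E ∈ diffOps A) (hΦ : Φ ∈ diffOps A)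
    {q : ℕ →₀ A}
    (hb : weightOp A (ν + w) * E - E * weightOp A ν +
      ((etaOp A * Φ + Φ * etaOp A + E * phiOp A ν + phiOp A (ν + w) * E) * etaOp A -
        etaOp A * (etaOp A * Φ + Φ * etaOp A + E * phiOp A ν + phiOp A (ν + w) * E)) = -E)
    (hc : weightOp A (ν + w) * Φ - Φ * weightOp A ν +
      ((etaOp A * Φ + Φ * etaOp A + E * phiOp A ν + phiOp A (ν + w) * E) * phiOp A ν -
        phiOp A (ν + w) * (etaOp A * Φ + Φ * etaOp A + E * phiOp A ν + phiOp A (ν + w) * E)) +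
      parityOp A * etaSum q = Φ) :
    ∃ T ∈ diffOps A, ∃ c p : ℕ →₀ A, E + T * etaOp A - etaOp A * T = 0 ∧
      Φ + T * phiOp A ν - phiOp A (ν + w) * T = thetaMul A * etaSum c + parityOp A * etaSum p ∧
      (∀ k : ℕ, (w - k - 1) • p k + gaugeCoeff ν (k + 1) • c (k + 1) + q k = 0) ∧
      (E = 0 → Φ = 0 → T = 0 ∧ c = 0 ∧ p = 0) ∧
      ∀ (𝒜 : ℕ × ZMod 2 → Submodule ℝ A) [GradedAlgebra 𝒜] (n : ℕ),
        SuperOpHasDegree 𝒜 (n, 1) E → SuperOpHasDegree 𝒜 (n, 1) Φ →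
        SuperOpHasDegree 𝒜 (n, 0) T ∧ ∀ k : ℕ, c k ∈ 𝒜 (n, k) ∧ p k ∈ 𝒜 (n, k + 1) := by
  obtain ⟨T, hT, hTE, hT0, hTd⟩ := exists_eta_primitive hE
  obtain ⟨Φ', hΦ'⟩ : ∃ Φ', Φ' = Φ + T * phiOp A ν - phiOp A (ν + w) * T := ⟨_, rfl⟩
  have hφ (ν : ℝ) : phiOp A ν ∈ diffOps A :=
    add_mem (mul_mem_diffOps (coeffMul_mem_diffOps _) etaOp_mem_diffOps)
      (Submodule.smul_mem _ _ thetaMul_mem_diffOps)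
  have hΦ'm : Φ' ∈ diffOps A := hΦ' ▸ sub_mem (add_mem hΦ (mul_mem_diffOps hT (hφ _)))
    (mul_mem_diffOps (hφ _) hT)
  have hH : etaOp A * Φ + Φ * etaOp A + E * phiOp A ν + phiOp A (ν + w) * E =
      etaOp A * Φ' + Φ' * etaOp A - T * weightOp A ν + weightOp A (ν + w) * T := by
    rw [hΦ', ← hTE]
    simp only [weightOp, mul_add, add_mul, mul_sub, sub_mul, mul_assoc]
    abel
  obtain ⟨h1, h2⟩ := ospPair_eta_phi (A := A) ν
  obtain ⟨h1', h2'⟩ := ospPair_eta_phi (A := A) (ν + w)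
  rw [hH] at hb hc
  change weightOp A ν * etaOp A - etaOp A * weightOp A ν = -etaOp A at h1
  change weightOp A (ν + w) * etaOp A - etaOp A * weightOp A (ν + w) = -etaOp A at h1'
  change weightOp A ν * phiOp A ν - phiOp A ν * weightOp A ν = phiOp A ν at h2
  change weightOp A (ν + w) * phiOp A (ν + w) - phiOp A (ν + w) * weightOp A (ν + w) =
    phiOp A (ν + w) at h2'
  obtain ⟨N, hN⟩ : ∃ N, N = etaOp A * Φ' + Φ' * etaOp A := ⟨_, rfl⟩
  -- Once E is gone, what remains of the linearized relation [H, E] = -E is that N commutes with η.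
  have hNη : etaOp A * N = N * etaOp A := by
    rw [← hN, ← hTE] at hb
    have e1 := congrArg (fun S => T * S) h1
    have e2 := congrArg (fun S => S * T) h1'
    simp only [mul_sub, sub_mul, mul_add, add_mul, mul_assoc, Module.End.mul_neg',
      Module.End.neg_mul'] at hb e1 e2
    linear_combination (norm := module) -hb - e1 + e2
  have hc' : weightOp A (ν + w) * Φ' - Φ' * weightOp A ν + (N * phiOp A ν - phiOp A (ν + w) * N) +
      parityOp A * etaSum q = Φ' := by
    have hΦe : Φ = Φ' - T * phiOp A ν + phiOp A (ν + w) * T := by rw [hΦ']; abel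
    rw [← hN, hΦe] at hc
    have e1 := congrArg (fun S => T * S) h2
    have e2 := congrArg (fun S => S * T) h2'
    simp only [mul_sub, sub_mul, mul_add, add_mul, mul_assoc] at hc e1 e2 ⊢
    linear_combination (norm := module) hc + e1 - e2
  obtain ⟨c, hNc, hcd⟩ := exists_etaSum_of_commute (T := N) (hN ▸ add_mem
    (mul_mem_diffOps etaOp_mem_diffOps hΦ'm) (mul_mem_diffOps hΦ'm etaOp_mem_diffOps)) hNη
  -- Since ηθN + θNη = N, the difference Φ' - θN anticommutes with η. Multiplication by σ turns this
  -- into commutation, and the commutant theorem applies a second time.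
  have hPm : parityOp A * (Φ' - thetaMul A * etaSum c) ∈ diffOps A :=
    mul_mem_diffOps parityOp_mem_diffOps
      (sub_mem hΦ'm (mul_mem_diffOps thetaMul_mem_diffOps (etaSum_mem_diffOps _)))
  obtain ⟨p, hPp, hpd⟩ := exists_etaSum_of_commute hPm (by
    have e1 := eta_theta_mul_etaSum c
    rw [← hNc, hN] at e1
    have e2 : etaOp A * (Φ' - thetaMul A * etaSum c) =
        -((Φ' - thetaMul A * etaSum c) * etaOp A) := by
      rw [mul_sub, sub_mul, ← hNc]
      rw [hN]
      linear_combination (norm := module) -e1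
    rw [mul_assoc, ← neg_neg (etaOp A * (parityOp A * _)), ← parity_mul_eta_mul, e2,
      Module.End.mul_neg', neg_neg])
  have hΦcp : Φ' = thetaMul A * etaSum c + parityOp A * etaSum p := by
    rw [← hPp, parity_mul_parity_mul]; abel
  refine ⟨T, hT, c, p, ?_, ?_, ?_, ?_, ?_⟩
  · rw [← hTE]; abel
  · rw [← hΦ', hΦcp]
  · intro k
    -- In the linearized relation [H, Φ] = Φ the θ-parts agree identically; the σ-parts give the
    -- recursion for p.
    rw [hΦcp, weight_mul_theta_parity, hNc, etaSum_mul_phi] at hc'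
    have : thetaMul A * etaSum c + parityOp A * etaSum
        (-scaleCoeff (fun k => k - w) p + gaugeShift ν c + q) =
        thetaMul A * etaSum c + parityOp A * etaSum p := by
      rw [← hc']
      simp only [map_add, map_sub, map_neg, mul_add, mul_sub, Module.End.mul_neg']
      abel
    have h := DFunLike.congr_fun (theta_parity_etaSum_injective this).2 k
    simp only [Finsupp.add_apply, Finsupp.neg_apply, scaleCoeff_apply, gaugeShift_apply] at h
    linear_combination (norm := module) h
  · intro hE0 hΦ0
    have hT0' := hT0 hE0
    have hΦ'0 : Φ' = 0 := by rw [hΦ', hΦ0, hT0']; simp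
    have : thetaMul A * etaSum c + parityOp A * etaSum p =
        thetaMul A * etaSum (0 : ℕ →₀ A) + parityOp A * etaSum (0 : ℕ →₀ A) := by
      rw [← hΦcp, hΦ'0]; simp
    exact ⟨hT0', theta_parity_etaSum_injective this⟩
  · intro 𝒜 _ n hEd hΦd
    have hTd' : SuperOpHasDegree 𝒜 (n, 0) T := by
      have := hTd 𝒜 (n, 1) hEd
      rwa [show ((n, 1) + (0, 1) : ℕ × ZMod 2) = (n, 0) from rfl] at this
    have hΦ'd : SuperOpHasDegree 𝒜 (n, 1) Φ' := by
      rw [hΦ']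
      exact (hΦd.add (hTd'.mul_eq (superOpHasDegree_phi _) (by simp))).sub
        ((superOpHasDegree_phi _).mul_eq hTd' (by simp))
    have hNd : SuperOpHasDegree 𝒜 (n, 0) N := by
      rw [hN]
      exact (superOpHasDegree_eta.mul_eq hΦ'd (by rw [Prod.mk_add_mk, zero_add]; rfl)).add
        (hΦ'd.mul_eq superOpHasDegree_eta rfl)
    have hck := hcd 𝒜 n 0 hNd
    have hcθ : SuperOpHasDegree 𝒜 (n, 1) (thetaMul A * etaSum c) :=
      superOpHasDegree_theta.mul_eq (superOpHasDegree_etaSum hck) (by simp)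
    have hpk := hpd 𝒜 n 1 (superOpHasDegree_parity.mul_eq (hΦ'd.sub hcθ) (zero_add _))
    refine ⟨hTd', fun k => ⟨?_, ?_⟩⟩
    · simpa using hck k
    · rw [add_comm]; exact hpk k

/-- Every infinitesimal deformation of the action on a single component is gauge equivalent to one
in normal form. -/
theorem exists_gauge {ν w : ℝ} {E Φ : SuperOp A} (hE : E ∈ diffOps A) (hΦ : Φ ∈ diffOps A)
    {q : ℕ →₀ A} (hq : ∀ k : ℕ, (k : ℝ) + 1 ≠ w → q k = 0)
    (hb : weightOp A (ν + w) * E - E * weightOp A ν +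
      ((etaOp A * Φ + Φ * etaOp A + E * phiOp A ν + phiOp A (ν + w) * E) * etaOp A -
        etaOp A * (etaOp A * Φ + Φ * etaOp A + E * phiOp A ν + phiOp A (ν + w) * E)) = -E)
    (hc : weightOp A (ν + w) * Φ - Φ * weightOp A ν +
      ((etaOp A * Φ + Φ * etaOp A + E * phiOp A ν + phiOp A (ν + w) * E) * phiOp A ν -
        phiOp A (ν + w) * (etaOp A * Φ + Φ * etaOp A + E * phiOp A ν + phiOp A (ν + w) * E)) +
      parityOp A * etaSum q = Φ) :
    ∃ J ∈ diffOps A, ∃ c p : ℕ →₀ A, E + J * etaOp A - etaOp A * J = 0 ∧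
      Φ + J * phiOp A ν - phiOp A (ν + w) * J = thetaMul A * etaSum c + parityOp A * etaSum p ∧
      (∀ k : ℕ, (k : ℝ) ≠ w → c k = 0) ∧ (∀ k : ℕ, (k : ℝ) + 1 ≠ w → p k = 0) ∧
      (∀ k : ℕ, (k : ℝ) + 1 = w → gaugeCoeff ν (k + 1) ≠ 0 → p k = 0) ∧
      (∀ k : ℕ, (k : ℝ) + 1 = w → gaugeCoeff ν (k + 1) • c (k + 1) + q k = 0) ∧
      (E = 0 → Φ = 0 → J = 0) ∧
      ∀ (𝒜 : ℕ × ZMod 2 → Submodule ℝ A) [GradedAlgebra 𝒜] (n : ℕ),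
        SuperOpHasDegree 𝒜 (n, 1) E → SuperOpHasDegree 𝒜 (n, 1) Φ →
        SuperOpHasDegree 𝒜 (n, 0) J ∧ ∀ k : ℕ, c k ∈ 𝒜 (n, k) ∧ p k ∈ 𝒜 (n, k + 1) := by
  obtain ⟨T, hT, c, p, hTE, hTΦ, hrel, h0, hdeg⟩ := exists_gauge_eta hE hΦ hb hc
  -- For k ≠ w the coefficient g_k solves (k - w)g_k = -c_k. For k = w it has no effect on c, and it
  -- is used instead to cancel p_{w-1}; the index shift is the pushforward along `Nat.succ`. If γ_w
  -- = 0 its inverse is 0 by convention, so g_w = 0 and p_{w-1} survives.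
  obtain ⟨g, hg⟩ : ∃ g : ℕ →₀ A, g = scaleCoeff (fun k => if (k : ℝ) = w then 0 else
      (w - k)⁻¹) c - scaleCoeff (fun k => if (k : ℝ) = w then (gaugeCoeff ν k)⁻¹ else 0)
      (Finsupp.mapDomain Nat.succ p) := ⟨_, rfl⟩
  have hmap (k : ℕ) : Finsupp.mapDomain Nat.succ p (k + 1) = p k :=
    Finsupp.mapDomain_apply Nat.succ_injective _ _
  have hmap0 : Finsupp.mapDomain Nat.succ p 0 = 0 :=
    Finsupp.mapDomain_of_notMem_range _ _ (by simp)
  have hgk (k : ℕ) (hk : (k : ℝ) ≠ w) : g k = (w - k)⁻¹ • c k := by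
    rw [hg, Finsupp.sub_apply, scaleCoeff_apply, scaleCoeff_apply, if_neg hk, if_neg hk,
      zero_smul, sub_zero]
  have hgw (k : ℕ) (hk : (k : ℝ) + 1 = w) : g (k + 1) = -((gaugeCoeff ν (k + 1))⁻¹ • p k) := by
    have : ((k + 1 : ℕ) : ℝ) = w := by push_cast; exact hk
    rw [hg, Finsupp.sub_apply, scaleCoeff_apply, scaleCoeff_apply, if_pos this, if_pos this,
      zero_smul, zero_sub, hmap]
  have hgphi := etaSum_mul_phi ν w g
  refine ⟨T + etaSum g, add_mem hT (etaSum_mem_diffOps g),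
    c + scaleCoeff (fun k => k - w) g, p + gaugeShift ν g, ?_, ?_, ?_, ?_, ?_, ?_, ?_, ?_⟩
  · rw [add_mul, mul_add, eta_mul_etaSum, ← hTE]; abel
  · simp only [map_add, mul_add, add_mul]
    linear_combination (norm := module) hTΦ + hgphi
  · intro k hk
    rw [Finsupp.add_apply, scaleCoeff_apply, hgk k hk, smul_smul]
    have : ((k : ℝ) - w) * (w - k)⁻¹ = -1 := by
      rw [← neg_sub w, neg_mul, mul_inv_cancel₀ (sub_ne_zero.mpr (Ne.symm hk))]
    rw [this]; module
  · intro k hk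
    have hk' : ((k + 1 : ℕ) : ℝ) ≠ w := by push_cast; exact hk
    rw [Finsupp.add_apply, gaugeShift_apply, hgk _ hk']
    -- Off the resonance k + 1 = w the relation expresses p_k through c_{k+1}, so the g that removes
    -- c_{k+1} removes p_k too.
    have h := hrel k
    rw [hq k hk, add_zero] at h
    have hne : w - k - 1 ≠ 0 := fun h => hk (by linarith)
    have h2 : p k = (w - k - 1)⁻¹ • ((w - k - 1) • p k) := by
      rw [smul_smul, inv_mul_cancel₀ hne, one_smul]
    rw [h2, eq_neg_of_add_eq_zero_left h, Nat.cast_succ, sub_add_eq_sub_sub]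
    module
  · intro k hk hne
    rw [Finsupp.add_apply, gaugeShift_apply, hgw k hk, smul_neg, smul_smul, mul_inv_cancel₀ hne,
      one_smul, add_neg_cancel]
  · intro k hk
    have h := hrel k
    -- At k + 1 = w the coefficient of p_k vanishes, and g does not alter c_w: the relation is a
    -- constraint on c_w and the obstruction alone.
    rw [show w - k - 1 = 0 by linarith, zero_smul, zero_add] at h
    rw [Finsupp.add_apply, scaleCoeff_apply, ← h]
    have : ((k + 1 : ℕ) : ℝ) - w = 0 := by push_cast; linarith
    rw [this, zero_smul, add_zero]
  · intro hE0 hΦ0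
    obtain ⟨h1, h2, h3⟩ := h0 hE0 hΦ0
    rw [h1, hg, h2, h3]; simp
  · intro 𝒜 _ n hEd hΦd
    obtain ⟨h1, h2⟩ := hdeg 𝒜 n hEd hΦd
    have hgd (k : ℕ) : g k ∈ 𝒜 (n, (k : ZMod 2)) := by
      rw [hg, Finsupp.sub_apply, scaleCoeff_apply, scaleCoeff_apply]
      refine sub_mem (Submodule.smul_mem _ _ (h2 k).1) (Submodule.smul_mem _ _ ?_)
      rcases k with _ | k
      · rw [hmap0]; exact zero_mem _
      · rw [hmap, Nat.cast_succ]; exact (h2 k).2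
    refine ⟨h1.add (superOpHasDegree_etaSum fun k => by rw [zero_add]; exact hgd k),
      fun k => ⟨?_, ?_⟩⟩
    · rw [Finsupp.add_apply, scaleCoeff_apply]
      exact add_mem (h2 k).1 (Submodule.smul_mem _ _ (hgd k))
    · rw [Finsupp.add_apply, gaugeShift_apply, ← Nat.cast_succ]
      refine add_mem ?_ (Submodule.smul_mem _ _ (hgd (k + 1)))
      rw [Nat.cast_succ]; exact (h2 k).2

end Gauge

/-! ### Operators on symbols as infinite matrices. -/

section Components

variable {A : Type*} [Ring A]

theorem component_apply (i j : ℕ) (T : SymbolOp A) (v : SuperFun A) :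
    component i j T v = T (Finsupp.single j v) i := rfl

theorem symbolOp_ext {S T : SymbolOp A} (h : ∀ i j, component i j S = component i j T) :
    S = T := by
  refine Finsupp.lhom_ext fun j v => ?_
  ext1 i
  exact LinearMap.congr_fun (h i j) v

theorem component_zero (i j : ℕ) : component i j (0 : SymbolOp A) = 0 := rfl

theorem component_add (i j : ℕ) (S T : SymbolOp A) :
    component i j (S + T) = component i j S + component i j T := rfl

theorem component_sub (i j : ℕ) (S T : SymbolOp A) :
    component i j (S - T) = component i j S - component i j T := rfl

theorem component_neg (i j : ℕ) (T : SymbolOp A) :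
    component i j (-T) = -component i j T := rfl

theorem component_sum {ι : Type*} (i j : ℕ) (s : Finset ι) (T : ι → SymbolOp A) :
    component i j (∑ x ∈ s, T x) = ∑ x ∈ s, component i j (T x) := by
  refine LinearMap.ext fun v => ?_
  rw [component_apply, LinearMap.sum_apply, LinearMap.sum_apply, Finsupp.finsetSum_apply]
  rfl

theorem component_smul [Algebra ℝ A] (i j : ℕ) (r : ℝ) (T : SymbolOp A) :
    component i j (r • T) = r • component i j T := rfl

theorem component_blockOp (i j i' j' : ℕ) (T : SuperOp A) :
    component i j (blockOp i' j' T) = if i = i' ∧ j = j' then T else 0 := by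
  refine LinearMap.ext fun v => ?_
  have h : component i j (blockOp i' j' T) v =
      Finsupp.single i' (T (Finsupp.single j v j')) i := rfl
  rw [h, Finsupp.single_apply, Finsupp.single_apply]
  by_cases h1 : i = i' <;> by_cases h2 : j = j' <;> simp [h1, h2, eq_comm]

theorem diagOp_single (D : ℕ → SuperOp A) (j : ℕ) (v : SuperFun A) :
    diagOp D (Finsupp.single j v) = Finsupp.single j (D j v) := by
  rw [diagOp, Finsupp.lsum_single]; rfl

theorem component_diagOp (i j : ℕ) (D : ℕ → SuperOp A) :
    component i j (diagOp D) = if i = j then D j else 0 := by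
  refine LinearMap.ext fun v => ?_
  rw [component_apply, diagOp_single, Finsupp.single_apply]
  by_cases h : i = j <;> simp [h, eq_comm]

theorem component_one (i j : ℕ) :
    component i j (1 : SymbolOp A) = if i = j then 1 else 0 := by
  refine LinearMap.ext fun v => ?_
  rw [component_apply, Module.End.one_apply, Finsupp.single_apply]
  by_cases h : i = j <;> simp [h, eq_comm]

theorem component_mul_diagOp (i j : ℕ) (T : SymbolOp A) (D : ℕ → SuperOp A) :
    component i j (T * diagOp D) = component i j T * D j := by
  refine LinearMap.ext fun v => ?_
  rw [component_apply, Module.End.mul_apply, diagOp_single]; rfl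

theorem symbolOp_apply (T : SymbolOp A) (v : Symbols A) (i : ℕ) :
    T v i = ∑ j ∈ v.support, component i j T (v j) := by
  conv_lhs => rw [← Finsupp.sum_single v, Finsupp.sum, map_sum, Finsupp.finsetSum_apply]
  rfl

theorem component_diagOp_mul (i j : ℕ) (D : ℕ → SuperOp A) (T : SymbolOp A) :
    component i j (diagOp D * T) = D i * component i j T := by
  refine LinearMap.ext fun v => ?_
  rw [component_apply, Module.End.mul_apply, Module.End.mul_apply, component_apply]
  generalize T (Finsupp.single j v) = u
  induction u using Finsupp.induction_linear with
  | zero => simp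
  | add u u' h h' => rw [map_add, Finsupp.add_apply, h, h', Finsupp.add_apply, map_add]
  | single k u =>
    rw [diagOp_single, Finsupp.single_apply, Finsupp.single_apply]
    split_ifs with h
    · rw [h]
    · rw [map_zero]

/-- This is matrix multiplication; the finite set K contains the rows where column j of T is
non-zero, so the sum is finite. -/
theorem component_mul {i j : ℕ} {S T : SymbolOp A} {K : Finset ℕ}
    (hK : ∀ k, component k j T ≠ 0 → k ∈ K) :
    component i j (S * T) = ∑ k ∈ K, component i k S * component k j T := by
  refine LinearMap.ext fun v => ?_
  rw [component_apply, Module.End.mul_apply, symbolOp_apply, LinearMap.sum_apply]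
  refine Finset.sum_subset (fun k hk => hK k fun h0 => ?_) fun k _ hk => ?_
  · rw [Finsupp.mem_support_iff, ← component_apply, h0] at hk
    exact hk rfl
  · rw [Finsupp.notMem_support_iff] at hk
    rw [hk, map_zero]

theorem diagOp_mul_diagOp (D D' : ℕ → SuperOp A) :
    diagOp D * diagOp D' = diagOp fun j => D j * D' j :=
  symbolOp_ext fun i j => by
    rw [component_mul_diagOp, component_diagOp, component_diagOp]
    split_ifs <;> simp

theorem diagOp_mul_blockOp (D : ℕ → SuperOp A) (i j : ℕ) (T : SuperOp A) :
    diagOp D * blockOp i j T = blockOp i j (D i * T) :=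
  symbolOp_ext fun i' j' => by
    rw [component_diagOp_mul, component_blockOp, component_blockOp]
    split_ifs with h
    · rw [h.1]
    · rw [mul_zero]

theorem blockOp_mul_diagOp (D : ℕ → SuperOp A) (i j : ℕ) (T : SuperOp A) :
    blockOp i j T * diagOp D = blockOp i j (T * D j) :=
  symbolOp_ext fun i' j' => by
    rw [component_mul_diagOp, component_blockOp, component_blockOp]
    split_ifs with h
    · rw [h.2]
    · rw [zero_mul]

theorem blockOp_mul_blockOp_of_ne {i j i' j' : ℕ} (h : j ≠ i') (S T : SuperOp A) :
    blockOp i j S * blockOp i' j' T = 0 := by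
  refine LinearMap.ext fun v => ?_
  have h1 : (blockOp i j S * blockOp i' j' T) v =
      Finsupp.single i (S (Finsupp.single i' (T (v j')) j)) := rfl
  rw [h1, Finsupp.single_eq_of_ne h]; simp

theorem blockOp_add (i j : ℕ) (S T : SuperOp A) :
    blockOp i j (S + T) = blockOp i j S + blockOp i j T := by
  refine LinearMap.ext fun v => ?_
  exact Finsupp.single_add i (S (v j)) (T (v j))

theorem blockOp_zero (i j : ℕ) : blockOp i j (0 : SuperOp A) = 0 := by
  refine LinearMap.ext fun v => ?_
  exact Finsupp.single_zero i

theorem diagOp_zero : diagOp (fun _ => (0 : SuperOp A)) = 0 :=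
  symbolOp_ext fun i j => by rw [component_diagOp, component_zero, ite_self]

/-- The operator with given components. -/
def ofComponents (T : ℕ → ℕ → SuperOp A) (h : ∀ j, {i | T i j ≠ 0}.Finite) : SymbolOp A :=
  Finsupp.lsum ℕ fun j => ∑ i ∈ (h j).toFinset, Finsupp.lsingle i ∘ₗ T i j

theorem component_ofComponents (T : ℕ → ℕ → SuperOp A) (h : ∀ j, {i | T i j ≠ 0}.Finite)
    (i j : ℕ) : component i j (ofComponents T h) = T i j := by
  refine LinearMap.ext fun v => ?_
  rw [component_apply, ofComponents, Finsupp.lsum_single, LinearMap.sum_apply,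
    Finsupp.finsetSum_apply]
  have h1 (k : ℕ) : (Finsupp.lsingle k ∘ₗ T k j : SuperFun A →ₗ[Aᵐᵒᵖ] Symbols A) v i =
      if k = i then T k j v else 0 := by
    rw [← Finsupp.single_apply]; rfl
  rw [Finset.sum_congr rfl fun k _ => h1 k, Finset.sum_ite_eq']
  split_ifs with h2
  · rfl
  · rw [Set.Finite.mem_toFinset, Set.mem_ofPred_eq, not_not] at h2
    rw [h2]; rfl

end Components

/-! ### Stability of differential operators and of degrees on symbols. -/

section DiffOpClosure

variable {A : Type*} [Ring A] [Algebra ℝ A]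

theorem IsDiffOp.zero : IsDiffOp (0 : SymbolOp A) :=
  ⟨fun _ _ => zero_mem _, fun j => by simp [component_zero]⟩

theorem IsDiffOp.add {S T : SymbolOp A} (hS : IsDiffOp S) (hT : IsDiffOp T) :
    IsDiffOp (S + T) :=
  ⟨fun i j => by rw [component_add]; exact add_mem (hS.1 i j) (hT.1 i j), fun j => by
    refine ((hS.2 j).union (hT.2 j)).subset fun i hi => ?_
    by_contra h
    simp only [Set.mem_union, Set.mem_ofPred_eq, not_or, not_not] at h
    exact hi (by rw [component_add, h.1, h.2, add_zero])⟩

theorem IsDiffOp.smul (r : ℝ) {T : SymbolOp A} (hT : IsDiffOp T) : IsDiffOp (r • T) :=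
  ⟨fun i j => by rw [component_smul]; exact Submodule.smul_mem _ _ (hT.1 i j), fun j => by
    refine (hT.2 j).subset fun i hi h => hi ?_
    rw [component_smul, h, smul_zero]⟩

theorem IsDiffOp.neg {T : SymbolOp A} (hT : IsDiffOp T) : IsDiffOp (-T) :=
  ⟨fun i j => by rw [component_neg]; exact neg_mem (hT.1 i j), fun j => by
    refine (hT.2 j).subset fun i hi h => hi ?_
    rw [component_neg, h, neg_zero]⟩

theorem IsDiffOp.sum {ι : Type*} (s : Finset ι) {T : ι → SymbolOp A}
    (hT : ∀ x ∈ s, IsDiffOp (T x)) : IsDiffOp (∑ x ∈ s, T x) :=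
  Finset.sum_induction _ IsDiffOp (fun _ _ h h' => h.add h') .zero hT

theorem IsDiffOp.mul {S T : SymbolOp A} (hS : IsDiffOp S) (hT : IsDiffOp T) :
    IsDiffOp (S * T) := by
  have hK (j k : ℕ) (h : component k j T ≠ 0) : k ∈ (hT.2 j).toFinset := by
    rwa [Set.Finite.mem_toFinset]
  constructor
  · intro i j
    rw [component_mul (hK j)]
    exact Submodule.sum_mem _ fun k _ => mul_mem_diffOps (hS.1 i k) (hT.1 k j)
  · intro j
    refine ((hT.2 j).toFinset.finite_toSet.biUnion fun k _ => hS.2 k).subset fun i hi => ?_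
    by_contra h
    simp only [Set.mem_iUnion, not_exists, Set.mem_ofPred_eq, not_not] at h
    apply hi
    rw [component_mul (hK j)]
    exact Finset.sum_eq_zero fun k hk => by rw [h k hk, zero_mul]

theorem IsDiffOp.diagOp {D : ℕ → SuperOp A} (hD : ∀ j, D j ∈ diffOps A) :
    IsDiffOp (diagOp D) :=
  ⟨fun i j => by
    rw [component_diagOp]; split_ifs
    exacts [hD j, zero_mem _], fun j => by
    refine (Set.finite_singleton j).subset fun i hi => ?_
    rw [Set.mem_ofPred_eq, component_diagOp] at hi
    by_contra h
    exact hi (if_neg h)⟩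

theorem IsDiffOp.one : IsDiffOp (1 : SymbolOp A) := by
  have : (1 : SymbolOp A) = _root_.diagOp fun _ => 1 :=
    symbolOp_ext fun i j => by rw [component_one, component_diagOp]
  rw [this]
  exact .diagOp fun _ => one_mem_diffOps

theorem IsDiffOp.blockOp (i j : ℕ) {T : SuperOp A} (hT : T ∈ diffOps A) :
    IsDiffOp (blockOp i j T) :=
  ⟨fun i' j' => by
    rw [component_blockOp]; split_ifs
    exacts [hT, zero_mem _], fun j' => by
    refine (Set.finite_singleton i).subset fun i' hi => ?_
    rw [Set.mem_ofPred_eq, component_blockOp] at hi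
    by_contra h
    exact hi (if_neg fun h' => h h'.1)⟩

variable {𝒜 : ℕ × ZMod 2 → Submodule ℝ A}

theorem opHasDegree_iff {d : ℕ × ZMod 2} {T : SymbolOp A} :
    OpHasDegree 𝒜 d T ↔ ∀ i j, SuperOpHasDegree 𝒜 d (component i j T) := by
  constructor
  · intro h i j e f hf
    refine h e (Finsupp.single j f) (fun k => ?_) i
    rw [Finsupp.single_apply]
    split_ifs
    exacts [hf, SuperFunHasDegree.zero e]
  · intro h e v hv i
    change SuperFunHasDegree 𝒜 _ (T v i)
    rw [symbolOp_apply]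
    exact Finset.sum_induction _ (SuperFunHasDegree 𝒜 (d + e)) (fun _ _ h h' => h.add h')
      (.zero _) fun j _ => h i j e _ (hv j)

theorem OpHasDegree.zero (d : ℕ × ZMod 2) : OpHasDegree 𝒜 d 0 :=
  opHasDegree_iff.mpr fun _ _ => .zero d

theorem OpHasDegree.add {d : ℕ × ZMod 2} {S T : SymbolOp A} (hS : OpHasDegree 𝒜 d S)
    (hT : OpHasDegree 𝒜 d T) : OpHasDegree 𝒜 d (S + T) :=
  opHasDegree_iff.mpr fun i j => by
    rw [component_add]; exact (opHasDegree_iff.mp hS i j).add (opHasDegree_iff.mp hT i j)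

theorem OpHasDegree.smul {d : ℕ × ZMod 2} (r : ℝ) {T : SymbolOp A} (hT : OpHasDegree 𝒜 d T) :
    OpHasDegree 𝒜 d (r • T) :=
  opHasDegree_iff.mpr fun i j => by
    rw [component_smul]; exact (opHasDegree_iff.mp hT i j).smul r

theorem OpHasDegree.neg {d : ℕ × ZMod 2} {T : SymbolOp A} (hT : OpHasDegree 𝒜 d T) :
    OpHasDegree 𝒜 d (-T) :=
  opHasDegree_iff.mpr fun i j => by
    rw [component_neg]; exact (opHasDegree_iff.mp hT i j).neg

theorem OpHasDegree.sum {d : ℕ × ZMod 2} {ι : Type*} (s : Finset ι) {T : ι → SymbolOp A}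
    (hT : ∀ x ∈ s, OpHasDegree 𝒜 d (T x)) : OpHasDegree 𝒜 d (∑ x ∈ s, T x) :=
  Finset.sum_induction _ (OpHasDegree 𝒜 d) (fun _ _ h h' => h.add h') (.zero d) hT

theorem OpHasDegree.mul_eq {d e c : ℕ × ZMod 2} {S T : SymbolOp A} (hS : OpHasDegree 𝒜 d S)
    (hT : OpHasDegree 𝒜 e T) (h : d + e = c) : OpHasDegree 𝒜 c (S * T) := fun e' v hv => by
  rw [← h, add_assoc]; exact hS _ _ (hT _ _ hv)

theorem OpHasDegree.one : OpHasDegree 𝒜 0 1 := fun e v hv => by rw [zero_add]; exact hv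

theorem OpHasDegree.diagOp {d : ℕ × ZMod 2} {D : ℕ → SuperOp A}
    (hD : ∀ j, SuperOpHasDegree 𝒜 d (D j)) : OpHasDegree 𝒜 d (diagOp D) :=
  opHasDegree_iff.mpr fun i j => by
    rw [component_diagOp]; split_ifs
    exacts [hD j, .zero d]

theorem OpHasDegree.blockOp {d : ℕ × ZMod 2} (i j : ℕ) {T : SuperOp A}
    (hT : SuperOpHasDegree 𝒜 d T) : OpHasDegree 𝒜 d (blockOp i j T) :=
  opHasDegree_iff.mpr fun i' j' => by
    rw [component_blockOp]; split_ifs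
    exacts [hT, .zero d]

end DiffOpClosure

/-! ### Degrees of the action and of the cocycles. -/

section Degrees

variable {A : Type*} [Ring A] [Algebra ℝ A] {𝒜 : ℕ × ZMod 2 → Submodule ℝ A} [GradedAlgebra 𝒜]

theorem HasParity.parityOp {p : ZMod 2} {F : SuperFun ℝ} (h : HasParity p F) :
    HasParity p (parityOp ℝ F) := by
  rw [parityOp_apply]
  exact ⟨fun h0 => by rw [h.1 h0, neg_zero], fun h1 => h.2 h1⟩

theorem HasParity.dX {p : ZMod 2} {F : SuperFun ℝ} (h : HasParity p F) :
    HasParity p (dX ℝ F) := by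
  rw [dX_apply]
  exact ⟨fun h0 => by rw [h.1 h0, map_zero], fun h1 => by rw [h.2 h1, map_zero]⟩

theorem hasParity_shift {p : ZMod 2} : (p + 1 = 0 → p = 1) ∧ (p + 1 = 1 → p = 0) := by
  revert p; decide

theorem HasParity.eta {p : ZMod 2} {F : SuperFun ℝ} (h : HasParity p F) :
    HasParity (p + 1) (etaOp ℝ F) := by
  rw [etaOp_apply]
  exact ⟨fun h0 => by rw [h.2 (hasParity_shift.1 h0), map_zero],
    fun h1 => h.1 (hasParity_shift.2 h1)⟩

theorem HasParity.etaBar {p : ZMod 2} {F : SuperFun ℝ} (h : HasParity p F) :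
    HasParity (p + 1) (etaBarOp ℝ F) := by
  rw [etaBarOp_apply]
  exact ⟨fun h0 => by rw [h.2 (hasParity_shift.1 h0), map_zero, neg_zero],
    fun h1 => h.1 (hasParity_shift.2 h1)⟩

theorem HasParity.eta_pow {p : ZMod 2} {F : SuperFun ℝ} (h : HasParity p F) (k : ℕ) :
    HasParity (p + k) ((etaOp ℝ ^ k) F) := by
  induction k with
  | zero => simpa using h
  | succ k ih =>
    rw [pow_succ', Module.End.mul_apply, Nat.cast_succ, ← add_assoc]
    exact ih.eta

theorem superOpHasDegree_densityAction (w : ℝ) {p : ZMod 2} {F : SuperFun ℝ}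
    (h : HasParity p F) : SuperOpHasDegree 𝒜 (0, p) (densityAction A w F) := by
  refine (((superOpHasDegree_superMul h).mul_eq superOpHasDegree_dX (add_zero _)).sub
    (((superOpHasDegree_superMul h.parityOp.etaBar).mul_eq superOpHasDegree_etaBar ?_).smul _)).add
    ((superOpHasDegree_superMul h.dX).smul w)
  rw [Prod.mk_add_mk, add_assoc, CharTwo.add_self_eq_zero (1 : ZMod 2), add_zero, add_zero]

theorem superOpHasDegree_upsilon {k : ℕ} (hk : 1 ≤ k) {p : ZMod 2} {F : SuperFun ℝ}
    (h : HasParity p F) : SuperOpHasDegree 𝒜 (0, p + 1) (upsilon A k F) := by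
  obtain ⟨l, rfl⟩ : ∃ l, k = l + 1 := ⟨k - 1, by omega⟩
  refine (superOpHasDegree_superMul (h.parityOp.eta_pow 2)).mul_eq
    (superOpHasDegree_etaBar.pow_odd _) ?_
  rw [Prod.mk_add_mk, show 2 * (l + 1) - 1 = 2 * l + 1 by omega]
  push_cast
  rw [show (2 : ZMod 2) = 0 from rfl]; simp

theorem superOpHasDegree_upsilonTilde {k : ℕ} (hk : 1 ≤ k) {p : ZMod 2} {F : SuperFun ℝ}
    (h : HasParity p F) : SuperOpHasDegree 𝒜 (0, p + 1) (upsilonTilde A k F) := by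
  obtain ⟨l, rfl⟩ : ∃ l, k = l + 1 := ⟨k - 1, by omega⟩
  refine SuperOpHasDegree.add ?_ ?_
  · rcases l with _ | l
    · simpa using SuperOpHasDegree.zero _
    · refine ((superOpHasDegree_superMul (h.parityOp.eta_pow 4)).mul_eq
        (superOpHasDegree_etaBar.pow_odd _) ?_).smul _
      rw [Prod.mk_add_mk, show 2 * (l + 1 + 1) - 3 = 2 * l + 1 by omega]
      push_cast
      rw [show (4 : ZMod 2) = 0 from rfl, show (2 : ZMod 2) = 0 from rfl]; simp
  · refine (superOpHasDegree_superMul (h.parityOp.eta_pow 3)).mul_eq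
      (superOpHasDegree_etaBar.pow_odd _) ?_
    rw [Prod.mk_add_mk, show 2 * (l + 1) - 2 = 2 * l by omega]
    push_cast
    rw [show (2 : ZMod 2) = 0 from rfl, show (3 : ZMod 2) = 1 from rfl]; simp

variable {m : ℕ}

theorem isDiffOp_infinitesimal (t : Params m A) (F : SuperFun ℝ) :
    IsDiffOp (t.infinitesimal F) :=
  (IsDiffOp.diagOp fun _ => mul_mem_diffOps (coeffMul_mem_diffOps _) (superMul_mem_diffOps _)).add
    (IsDiffOp.sum _ fun _ _ => .blockOp _ _ (add_mem
      (mul_mem_diffOps (oddMul_mem_diffOps _) (upsilon_mem_diffOps _ _))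
      (mul_mem_diffOps (oddMul_mem_diffOps _) (upsilonTilde_mem_diffOps _ _))))

theorem opHasDegree_infinitesimal {n : ℕ} {t : Params m A} (ht : t.IsHomogeneous 𝒜 n)
    {p : ZMod 2} {F : SuperFun ℝ} (h : HasParity p F) :
    OpHasDegree 𝒜 (n, p) (t.infinitesimal F) := by
  have hp : ((n, 1) + (0, p + 1) : ℕ × ZMod 2) = (n, p) := by
    rw [Prod.mk_add_mk, add_zero, add_comm, add_assoc, CharTwo.add_self_eq_zero, add_zero]
  refine (OpHasDegree.diagOp fun j => (superOpHasDegree_evenMul (ht.1 j)).mul_eq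
    (superOpHasDegree_superMul h.dX) (by simp)).add (OpHasDegree.sum _ fun k _ => .blockOp _ _ ?_)
  have hk := (Finset.mem_Icc.mp k.2).1
  exact ((superOpHasDegree_oddMul (ht.2.1 k)).mul_eq (superOpHasDegree_upsilon hk h) hp).add
    ((superOpHasDegree_oddMul (ht.2.2 k)).mul_eq (superOpHasDegree_upsilonTilde hk h) hp)

theorem isDiffOp_symbolAction (δ : ℝ) (F : SuperFun ℝ) : IsDiffOp (symbolAction A δ F) :=
  .diagOp fun _ => densityAction_mem_diffOps _ _

theorem opHasDegree_symbolAction (δ : ℝ) {p : ZMod 2} {F : SuperFun ℝ} (h : HasParity p F) :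
    OpHasDegree 𝒜 (0, p) (symbolAction A δ F) :=
  .diagOp fun _ => superOpHasDegree_densityAction _ h

end Degrees

/-! ### The undeformed action on symbols. -/

section DiagonalAlgebra

variable {A : Type*} [Ring A]

theorem diagOp_add (D D' : ℕ → SuperOp A) :
    diagOp D + diagOp D' = diagOp fun j => D j + D' j :=
  symbolOp_ext fun i j => by
    rw [component_add, component_diagOp, component_diagOp, component_diagOp]
    split_ifs <;> simp

theorem diagOp_sub (D D' : ℕ → SuperOp A) :
    diagOp D - diagOp D' = diagOp fun j => D j - D' j :=
  symbolOp_ext fun i j => by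
    rw [component_sub, component_diagOp, component_diagOp, component_diagOp]
    split_ifs <;> simp

theorem diagOp_neg (D : ℕ → SuperOp A) : -diagOp D = diagOp fun j => -D j :=
  symbolOp_ext fun i j => by
    rw [component_neg, component_diagOp, component_diagOp]
    split_ifs <;> simp

variable [Algebra ℝ A]

theorem diagOp_smul (r : ℝ) (D : ℕ → SuperOp A) : r • diagOp D = diagOp fun j => r • D j :=
  symbolOp_ext fun i j => by
    rw [component_smul, component_diagOp, component_diagOp]
    split_ifs <;> simp

theorem blockOp_smul (r : ℝ) (i j : ℕ) (T : SuperOp A) :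
    r • blockOp i j T = blockOp i j (r • T) :=
  symbolOp_ext fun i' j' => by
    rw [component_smul, component_blockOp, component_blockOp]
    split_ifs <;> simp

variable (A) in
/-- The action of `2X_θ` on symbols. -/
def etaDiag : SymbolOp A := diagOp fun _ => etaOp A

variable (A) in
/-- The action of `2X_{xθ}` on symbols. -/
def phiDiag (δ : ℝ) : SymbolOp A := diagOp fun j => phiOp A (2 * δ - j)

theorem ospPair_diag (δ : ℝ) : OspPair (etaDiag A) (phiDiag A δ) := by
  constructor
  · have h (j : ℕ) := (ospPair_eta_phi (A := A) (2 * δ - j)).1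
    simp only [etaDiag, phiDiag, diagOp_mul_diagOp, diagOp_add]
    refine (diagOp_sub _ _).trans (Eq.trans ?_ (diagOp_neg _).symm)
    exact congrArg diagOp (funext h)
  · have h (j : ℕ) := (ospPair_eta_phi (A := A) (2 * δ - j)).2
    simp only [etaDiag, phiDiag, diagOp_mul_diagOp, diagOp_add]
    refine (diagOp_sub _ _).trans ?_
    exact congrArg diagOp (funext h)

theorem symbolAction_eq_ospMap (δ : ℝ) {F : SuperFun ℝ} (hF : F ∈ osp) :
    symbolAction A δ F = ospMap (etaDiag A) (phiDiag A δ) F := by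
  have h (j : ℕ) : densityAction A (δ - j / 2) F = ospMap (etaOp A) (phiOp A (2 * δ - j)) F := by
    rw [densityAction_eq_ospMap _ hF, show 2 * (δ - (j : ℝ) / 2) = 2 * δ - j by ring]
  simp only [symbolAction, ospMap, LinearMap.coe_mk, AddHom.coe_mk, etaDiag, phiDiag,
    diagOp_mul_diagOp, diagOp_add, diagOp_smul]
  exact congrArg diagOp (funext h)

end DiagonalAlgebra

/-! ### The infinitesimal deformation expressed through η. -/

section EtaBarPowers

variable {A : Type*} [Ring A] [Algebra ℝ A]

/-- As σ anticommutes with η, η̄² = σηση = -η². -/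
theorem etaBar_pow_even (l : ℕ) : etaBarOp A ^ (2 * l) = (-1 : ℝ) ^ l • etaOp A ^ (2 * l) := by
  have h : etaBarOp A ^ 2 = (-1 : ℝ) • etaOp A ^ 2 := by
    rw [pow_two, etaBarOp_eq, mul_assoc, ← mul_assoc (etaOp A), ← neg_neg (etaOp A * parityOp A),
      ← parity_mul_eta, Module.End.neg_mul', Module.End.mul_neg', mul_assoc,
      parity_mul_parity_mul, pow_two]
    module
  rw [pow_mul, h, smul_pow, pow_mul]

theorem etaBar_pow_odd (l : ℕ) :
    etaBarOp A ^ (2 * l + 1) = (-1 : ℝ) ^ l • (parityOp A * etaOp A ^ (2 * l + 1)) := by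
  rw [pow_succ', etaBar_pow_even, etaBarOp_eq, mul_smul_comm, mul_assoc, ← pow_succ']

theorem eta_pow_even_mul_theta (l : ℕ) :
    etaOp A ^ (2 * l) * thetaMul A = thetaMul A * etaOp A ^ (2 * l) := by
  rw [pow_mul, pow_two, eta_mul_eta]
  exact Commute.pow_left dX_mul_theta l

/-- Even powers of η are powers of ∂ₓ and commute with θ, so just one factor η has to pass the
second θ. This product yields the term 𝔟𝔞 in N². -/
theorem theta_mul_eta_pow_odd_mul_theta (l : ℕ) :
    thetaMul A * (etaOp A ^ (2 * l + 1) * thetaMul A) = thetaMul A * etaOp A ^ (2 * l) := by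
  rw [pow_succ, mul_assoc, eta_mul_theta, mul_sub, mul_one, ← mul_assoc (etaOp A ^ _),
    eta_pow_even_mul_theta, mul_sub, mul_assoc, theta_mul_theta_mul, sub_zero]

theorem superOp_map_smul (T : SuperOp ℝ) (r : ℝ) (F : SuperFun ℝ) : T (r • F) = r • T F := by
  rw [← op_smul_eq_smul, map_smul, op_smul_eq_smul]

end EtaBarPowers

namespace Params

variable {A : Type*} [Ring A] [Algebra ℝ A] {m : ℕ}

/-- The component of index `k` of the deformation of `2X_{xθ}`. -/
def blockNormal (t : Params m A) (k : Finset.Icc 1 m) : SuperOp A :=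
  thetaMul A * etaSum (Finsupp.single (2 * ((k : ℕ) - 1) + 1)
      ((2 * (-1) ^ ((k : ℕ) - 1) : ℝ) • t.b k)) +
    parityOp A * etaSum (Finsupp.single (2 * ((k : ℕ) - 1))
      (-(2 * (-1) ^ ((k : ℕ) - 1) : ℝ) • t.c k))

/-- The infinitesimal deformation of `2X_{xθ}`. -/
def normalOp (t : Params m A) : SymbolOp A :=
  diagOp (fun j => thetaMul A * etaSum (Finsupp.single 0 ((2 : ℝ) • t.a j))) +
    ∑ k : Finset.Icc 1 m, blockOp (m - k) (m + k - 1) (t.blockNormal k)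

/-- The infinitesimal deformation, as a linear map. -/
def infinitesimalLinear (t : Params m A) : SuperFun ℝ →ₗ[ℝ] SymbolOp A where
  toFun := t.infinitesimal
  map_add' F G := by
    have h1 (j : ℕ) : evenMul (t.a j) * upsilonPrime A (F + G) =
        evenMul (t.a j) * upsilonPrime A F + evenMul (t.a j) * upsilonPrime A G := by
      rw [upsilonPrime, map_add, superMul_add, mul_add]; rfl
    have h2 (k : ℕ) : upsilon A k (F + G) = upsilon A k F + upsilon A k G := by
      rw [upsilon, map_add, map_add, superMul_add, add_mul]; rfl
    have h3 (k : ℕ) : upsilonTilde A k (F + G) = upsilonTilde A k F + upsilonTilde A k G := by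
      simp only [upsilonTilde, map_add, superMul_add, add_mul]
      module
    simp only [infinitesimal, h1, h2, h3, mul_add, ← diagOp_add, blockOp_add,
      Finset.sum_add_distrib]
    abel
  map_smul' r F := by
    have h1 (j : ℕ) : evenMul (t.a j) * upsilonPrime A (r • F) =
        r • (evenMul (t.a j) * upsilonPrime A F) := by
      rw [upsilonPrime, superOp_map_smul, superMul_smul, mul_smul_comm]; rfl
    have h2 (k : ℕ) : upsilon A k (r • F) = r • upsilon A k F := by
      rw [upsilon, superOp_map_smul, superOp_map_smul, superMul_smul, smul_mul_assoc]; rfl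
    have h3 (k : ℕ) : upsilonTilde A k (r • F) = r • upsilonTilde A k F := by
      simp only [upsilonTilde, superOp_map_smul, superMul_smul, smul_mul_assoc]
      module
    simp only [infinitesimal, h1, h2, h3, mul_smul_comm, ← diagOp_smul, ← smul_add,
      ← blockOp_smul, ← Finset.smul_sum, RingHom.id_apply]

theorem oddMul_eq (b : A) : oddMul b = evenMul b * parityOp A := rfl

theorem evenMul_neg (a : A) : evenMul (-a) = -evenMul a := by
  rw [evenMul, Polynomial.C_neg, coeffMul_neg]; rfl

theorem superMul_zero : (superMul 0 : SuperOp A) = 0 := by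
  simpa using superMul_smul (A := A) 0 0

theorem superMul_one : (superMul (1, 0) : SuperOp A) = 1 := by
  rw [superMul_even, Polynomial.map_one, coeffMul_one]

theorem superMul_theta : (superMul (0, 1) : SuperOp A) = thetaMul A := by
  rw [superMul_odd, Polynomial.map_one, coeffMul_one, mul_one]

theorem superMul_x : (superMul (Polynomial.X, 0) : SuperOp A) = coeffMul Polynomial.X := by
  rw [superMul_even, Polynomial.map_X]

/-- The infinitesimal deformation from the values of its components. -/
theorem infinitesimal_eq {t : Params m A} {F : SuperFun ℝ} {r : ℝ} {D : ℕ → SuperOp A}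
    {T : Finset.Icc 1 m → SuperOp A}
    (h1 : ∀ j, r • (evenMul (t.a j) * upsilonPrime A F) = D j)
    (h2 : ∀ (k : Finset.Icc 1 m) (l : ℕ), (k : ℕ) = l + 1 →
      r • (oddMul (t.b k) * upsilon A (l + 1) F + oddMul (t.c k) * upsilonTilde A (l + 1) F) =
        T k) :
    r • t.infinitesimal F = diagOp D + ∑ k : Finset.Icc 1 m, blockOp (m - k) (m + k - 1) (T k) := by
  rw [infinitesimal, smul_add, diagOp_smul, Finset.smul_sum]
  congr 1
  · exact congrArg diagOp (funext h1)
  · refine Finset.sum_congr rfl fun k _ => ?_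
    have hk := (Finset.mem_Icc.mp k.2).1
    have := h2 k ((k : ℕ) - 1) (by omega)
    rw [Nat.sub_add_cancel hk] at this
    rw [blockOp_smul, this]

theorem infinitesimal_one (t : Params m A) : t.infinitesimal (1, 0) = 0 := by
  have := infinitesimal_eq (t := t) (F := (1, 0)) (r := 1) (D := fun _ => 0) (T := fun _ => 0)
    (fun j => by simp [upsilonPrime, dX_apply, Polynomial.derivative_one, superMul_even,
      coeffMul_zero])
    (fun k l _ => by
      simp [upsilon, upsilonTilde, pow_succ, Module.End.mul_apply, etaOp_apply, parityOp_apply,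
        superMul_even, coeffMul_zero])
  rw [one_smul] at this
  rw [this, diagOp_zero, zero_add]
  exact Finset.sum_eq_zero fun k _ => blockOp_zero _ _

/-- Each cocycle contains at least one x-derivative of the generating function, hence kills X_θ: the
deformation is carried by Φ alone. -/
theorem infinitesimal_theta (t : Params m A) : t.infinitesimal (0, 1) = 0 := by
  have := infinitesimal_eq (t := t) (F := (0, 1)) (r := 1) (D := fun _ => 0) (T := fun _ => 0)
    (fun j => by simp [upsilonPrime, dX_apply, Polynomial.derivative_one, superMul_even,
      coeffMul_zero])
    (fun k l _ => by
      simp [upsilon, upsilonTilde, pow_succ, Module.End.mul_apply, etaOp_apply, parityOp_apply,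
        superMul_even, coeffMul_zero])
  rw [one_smul] at this
  rw [this, diagOp_zero, zero_add]
  exact Finset.sum_eq_zero fun k _ => blockOp_zero _ _

theorem upsilon_tilde_x_theta (l : ℕ) : upsilonTilde A (l + 1) (0, Polynomial.X) =
    -((-1 : ℝ) ^ l • etaOp A ^ (2 * l)) := by
  have h3 : (etaOp ℝ ^ 3) (parityOp ℝ (0, Polynomial.X)) = (-1 : ℝ) • (1, 0) := by
    simp [pow_succ, Module.End.mul_apply, etaOp_apply, parityOp_apply]
  have h4 : (etaOp ℝ ^ 4) (parityOp ℝ (0, Polynomial.X)) = 0 := by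
    simp [pow_succ, Module.End.mul_apply, etaOp_apply, parityOp_apply]
  rw [upsilonTilde, h3, h4, superMul_zero, zero_mul, smul_zero, zero_add, superMul_smul,
    superMul_one, smul_mul_assoc, one_mul, show 2 * (l + 1) - 2 = 2 * l by omega, etaBar_pow_even]
  module

theorem upsilon_x_theta (l : ℕ) : upsilon A (l + 1) (0, Polynomial.X) =
    -((-1 : ℝ) ^ l • (thetaMul A * etaOp A ^ (2 * l + 1))) := by
  have h2 : (etaOp ℝ ^ 2) (parityOp ℝ (0, Polynomial.X)) = (-1 : ℝ) • (0, 1) := by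
    simp [pow_succ, Module.End.mul_apply, etaOp_apply, parityOp_apply]
  rw [upsilon, h2, superMul_smul, superMul_theta, show 2 * (l + 1) - 1 = 2 * l + 1 by omega,
    etaBar_pow_odd, smul_mul_assoc, mul_smul_comm, theta_mul_parity_mul]
  module

/-- This explains the constants of `blockNormal`: the factor 2 belongs to 2X_{xθ}, the sign
(-1)^{k-1} comes from replacing η̄ by η, and (-1)^{|G|} = -1 is absorbed by σθ = -θ for 𝔟 but stays
for 𝔠. -/
theorem infinitesimal_x_theta (t : Params m A) :
    (2 : ℝ) • t.infinitesimal (0, Polynomial.X) = t.normalOp := by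
  refine infinitesimal_eq (fun j => ?_) fun k l hk => ?_
  · have : dX ℝ (0, Polynomial.X) = (0, 1) := by simp [dX_apply]
    rw [upsilonPrime, this, superMul_theta, etaSum_single, pow_zero, mul_one, evenMul_smul,
      mul_smul_comm, evenMul_comm_theta]
  · rw [upsilon_x_theta, upsilon_tilde_x_theta, blockNormal, show (k : ℕ) - 1 = l by omega]
    simp only [oddMul_eq, etaSum_single, evenMul_smul, mul_smul_comm,
      smul_mul_assoc, mul_assoc, Module.End.mul_neg', parity_mul_theta_mul,
      theta_comm_evenMul_mul, parity_comm_evenMul_mul]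
    module

theorem upsilon_x (l : ℕ) : upsilon A (l + 1) (Polynomial.X, 0) =
    (-1 : ℝ) ^ l • (parityOp A * etaOp A ^ (2 * l + 1)) := by
  have h2 : (etaOp ℝ ^ 2) (parityOp ℝ (Polynomial.X, 0)) = (1, 0) := by
    simp [pow_succ, Module.End.mul_apply, etaOp_apply, parityOp_apply]
  rw [upsilon, h2, superMul_one, one_mul, show 2 * (l + 1) - 1 = 2 * l + 1 by omega,
    etaBar_pow_odd]

theorem upsilonTilde_x (l : ℕ) : upsilonTilde A (l + 1) (Polynomial.X, 0) = 0 := by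
  have h3 : (etaOp ℝ ^ 3) (parityOp ℝ (Polynomial.X, 0)) = 0 := by
    simp [pow_succ, Module.End.mul_apply, etaOp_apply, parityOp_apply]
  have h4 : (etaOp ℝ ^ 4) (parityOp ℝ (Polynomial.X, 0)) = 0 := by
    simp [pow_succ, Module.End.mul_apply, etaOp_apply, parityOp_apply]
  rw [upsilonTilde, h3, h4, superMul_zero]; simp

theorem derivative_x_sq :
    Polynomial.derivative (Polynomial.X ^ 2 : ℝ[X]) = (2 : ℝ) • Polynomial.X := by
  rw [Polynomial.derivative_X_sq, Polynomial.smul_eq_C_mul]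

theorem upsilon_x_sq (l : ℕ) : upsilon A (l + 1) (Polynomial.X ^ 2, 0) =
    (2 * (-1) ^ l : ℝ) • (parityOp A * (coeffMul Polynomial.X * etaOp A ^ (2 * l + 1))) := by
  have h2 : (etaOp ℝ ^ 2) (parityOp ℝ (Polynomial.X ^ 2, 0)) = (2 : ℝ) • (Polynomial.X, 0) := by
    change etaOp ℝ (etaOp ℝ (parityOp ℝ (Polynomial.X ^ 2, 0))) = _
    simp only [etaOp_apply, parityOp_apply,
      neg_zero, map_zero, derivative_x_sq, Prod.smul_mk, smul_zero]
  rw [upsilon, h2, superMul_smul, superMul_x, show 2 * (l + 1) - 1 = 2 * l + 1 by omega,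
    etaBar_pow_odd, parity_mul_x_mul, mul_smul_comm, smul_mul_assoc]
  module

theorem upsilonTilde_x_sq (l : ℕ) : upsilonTilde A (l + 1) (Polynomial.X ^ 2, 0) =
    -((2 * l * (-1) ^ l : ℝ) • (parityOp A * etaOp A ^ (2 * l - 1))) +
      (2 * (-1) ^ l : ℝ) • (thetaMul A * etaOp A ^ (2 * l)) := by
  have h3 : (etaOp ℝ ^ 3) (parityOp ℝ (Polynomial.X ^ 2, 0)) = (2 : ℝ) • (0, 1) := by
    change etaOp ℝ (etaOp ℝ (etaOp ℝ (parityOp ℝ (Polynomial.X ^ 2, 0)))) = _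
    simp only [etaOp_apply, parityOp_apply,
      neg_zero, map_zero, derivative_x_sq, Prod.smul_mk, smul_zero,
      Polynomial.derivative_smul, Polynomial.derivative_X]
  have h4 : (etaOp ℝ ^ 4) (parityOp ℝ (Polynomial.X ^ 2, 0)) = (2 : ℝ) • (1, 0) := by
    change etaOp ℝ (etaOp ℝ (etaOp ℝ (etaOp ℝ (parityOp ℝ (Polynomial.X ^ 2, 0))))) = _
    simp only [etaOp_apply, parityOp_apply,
      neg_zero, map_zero, derivative_x_sq, Prod.smul_mk, smul_zero,
      Polynomial.derivative_smul, Polynomial.derivative_X]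
  rw [upsilonTilde, h3, h4, superMul_smul, superMul_smul, superMul_one, superMul_theta,
    show 2 * (l + 1) - 2 = 2 * l by omega, etaBar_pow_even, Nat.cast_succ, add_sub_cancel_right]
  rcases l with _ | l
  · simp
  · rw [show 2 * (l + 1 + 1) - 3 = 2 * l + 1 by omega, show 2 * (l + 1) - 1 = 2 * l + 1 by omega,
      etaBar_pow_odd, pow_succ (-1 : ℝ) l]
    simp only [smul_mul_assoc, mul_smul_comm, one_mul]
    module

/-- The 𝔠-parts do not contribute, because ση^{2k-2} anticommutes with η; this agrees with Υ̃_k(X_x)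
= 0. -/
theorem infinitesimal_x (t : Params m A) :
    (2 : ℝ) • t.infinitesimal (Polynomial.X, 0) =
      etaDiag A * t.normalOp + t.normalOp * etaDiag A := by
  have hE : etaDiag A * t.normalOp + t.normalOp * etaDiag A =
      diagOp (fun j => etaSum (Finsupp.single 0 ((2 : ℝ) • t.a j))) +
      ∑ k : Finset.Icc 1 m, blockOp (m - k) (m + k - 1)
        (etaSum (Finsupp.single (2 * ((k : ℕ) - 1) + 1)
          ((2 * (-1) ^ ((k : ℕ) - 1) : ℝ) • t.b k))) := by
    rw [normalOp, mul_add, add_mul, Finset.mul_sum, Finset.sum_mul, add_add_add_comm,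
      ← Finset.sum_add_distrib, etaDiag, diagOp_mul_diagOp, diagOp_mul_diagOp, diagOp_add]
    congr 1
    · exact congrArg diagOp (funext fun j => eta_theta_mul_etaSum _)
    · refine Finset.sum_congr rfl fun k _ => ?_
      rw [diagOp_mul_blockOp, blockOp_mul_diagOp, ← blockOp_add, blockNormal, mul_add, add_mul,
        add_add_add_comm, eta_theta_mul_etaSum, eta_parity_mul_etaSum, add_zero]
  rw [hE]
  refine infinitesimal_eq (fun j => ?_) fun k l hk => ?_
  · have : dX ℝ (Polynomial.X, 0) = (1, 0) := by simp [dX_apply]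
    rw [upsilonPrime, this, superMul_one, etaSum_single, pow_zero, mul_one, evenMul_smul, mul_one]
  · rw [upsilon_x, upsilonTilde_x, show (k : ℕ) - 1 = l by omega, mul_zero, add_zero, oddMul_eq,
      mul_smul_comm, mul_assoc, parity_mul_parity_mul, etaSum_single, evenMul_smul, smul_smul,
      smul_mul_assoc]

end Params

/-! ### Anticommutators and squares of normal forms. -/

section NormalForms

variable {A : Type*} [Ring A] [Algebra ℝ A]

theorem phi_theta_anticomm (ν w : ℝ) :
    phiOp A (ν + w) * thetaMul A + thetaMul A * phiOp A (ν + w) = coeffMul Polynomial.X := by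
  simp only [phiOp, add_mul, mul_add, mul_assoc, eta_mul_theta, theta_mul_x_mul, mul_sub,
    smul_mul_assoc, mul_smul_comm, theta_mul_theta, mul_one]
  module

theorem phi_anticomm_normal (ν w : ℝ) (c p : ℕ →₀ A) :
    phiOp A (ν + w) * (thetaMul A * etaSum c + parityOp A * etaSum p) +
        (thetaMul A * etaSum c + parityOp A * etaSum p) * phiOp A ν =
      coeffMul Polynomial.X * etaSum c + thetaMul A * etaSum (gaugeShift ν c) -
        thetaMul A * etaSum (scaleCoeff (fun k => k - w) p) + etaSum (gaugeShift ν p) := by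
  have e1 := congrArg (fun T => thetaMul A * T) (etaSum_mul_phi ν w c)
  have e2 := congrArg (fun T => parityOp A * T) (etaSum_mul_phi ν w p)
  have e3 := congrArg (fun T => T * etaSum c) (phi_theta_anticomm (A := A) ν w)
  have e4 := congrArg (fun T => T * etaSum p) (parity_mul_phi (A := A) (ν + w))
  simp only [mul_add, add_mul, mul_sub, mul_assoc, theta_mul_theta_mul, theta_mul_parity_mul,
    parity_mul_theta_mul, parity_mul_parity_mul, Module.End.neg_mul'] at e1 e2 e3 e4 ⊢
  linear_combination (norm := module) e1 + e2 + e3 + e4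

end NormalForms

namespace Params

variable {A : Type*} [Ring A] [Algebra ℝ A] {m : ℕ}

theorem infinitesimal_x_sq {δ : ℝ} (hδ : 1 ≤ m → 2 * δ = m) (t : Params m A) :
    t.infinitesimal (Polynomial.X ^ 2, 0) =
      phiDiag A δ * t.normalOp + t.normalOp * phiDiag A δ := by
  have hD (j : ℕ) : phiOp A (2 * δ - j) * (thetaMul A * etaSum (Finsupp.single 0 ((2 : ℝ) • t.a j)))
      + thetaMul A * etaSum (Finsupp.single 0 ((2 : ℝ) • t.a j)) * phiOp A (2 * δ - j) =
      coeffMul Polynomial.X * etaSum (Finsupp.single 0 ((2 : ℝ) • t.a j)) := by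
    have h := phi_anticomm_normal (2 * δ - j) 0 (Finsupp.single 0 ((2 : ℝ) • t.a j)) 0
    simpa [gaugeShift_single, gaugeCoeff] using h
  have hB (k : Finset.Icc 1 m) (l : ℕ) (hk : (k : ℕ) = l + 1) :
      phiOp A (2 * δ - (m - k : ℕ)) * t.blockNormal k +
        t.blockNormal k * phiOp A (2 * δ - (m + k - 1 : ℕ)) =
      (2 * (-1) ^ l : ℝ) • (coeffMul Polynomial.X * (evenMul (t.b k) * etaOp A ^ (2 * l + 1))) -
      (2 * (-1) ^ l : ℝ) • (thetaMul A * (evenMul (t.c k) * etaOp A ^ (2 * l))) -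
      (2 * (-1) ^ l * l : ℝ) • (evenMul (t.c k) * etaOp A ^ (2 * l - 1)) := by
    obtain ⟨h1, h2⟩ := Finset.mem_Icc.mp k.2
    have hν : 2 * δ - (m - k : ℕ) = 2 * δ - (m + k - 1 : ℕ) + (2 * l + 1 : ℕ) := by
      rw [show m + (k : ℕ) - 1 = m + l by omega, Nat.cast_sub h2, hk]; push_cast; ring
    -- The source of the block sits at the resonance ν = -l, where γ_{2l+1} = 0; the term in θη^{2l}
    -- with coefficient 𝔟 therefore disappears.
    have hν' : 2 * δ - (m + k - 1 : ℕ) = -l := by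
      rw [show m + (k : ℕ) - 1 = m + l by omega, hδ (h1.trans h2)]; push_cast; ring
    rw [hν, blockNormal, phi_anticomm_normal, hν', show (k : ℕ) - 1 = l by omega,
      gaugeShift_single, gaugeShift_single, scaleCoeff_single, (gaugeCoeff_even _ l).1,
      (gaugeCoeff_even _ l).2]
    simp only [etaSum_single, evenMul_smul,
      smul_mul_assoc, mul_smul_comm, neg_add_cancel, zero_smul]
    rw [evenMul_zero]
    push_cast
    simp only [zero_mul, mul_zero]
    module
  have : phiDiag A δ * t.normalOp + t.normalOp * phiDiag A δ =
      diagOp (fun j => coeffMul Polynomial.X * etaSum (Finsupp.single 0 ((2 : ℝ) • t.a j))) +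
      ∑ k : Finset.Icc 1 m, blockOp (m - k) (m + k - 1)
        (phiOp A (2 * δ - (m - k : ℕ)) * t.blockNormal k +
        t.blockNormal k * phiOp A (2 * δ - (m + k - 1 : ℕ))) := by
    rw [normalOp, mul_add, add_mul, Finset.mul_sum, Finset.sum_mul, add_add_add_comm,
      ← Finset.sum_add_distrib, phiDiag, diagOp_mul_diagOp, diagOp_mul_diagOp, diagOp_add]
    congr 1
    · exact congrArg diagOp (funext hD)
    · refine Finset.sum_congr rfl fun k _ => ?_
      rw [diagOp_mul_blockOp, blockOp_mul_diagOp, ← blockOp_add]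
  rw [this, ← one_smul ℝ (t.infinitesimal _)]
  refine infinitesimal_eq (fun j => ?_) fun k l hk => ?_
  · have : dX ℝ (Polynomial.X ^ 2, 0) = (2 : ℝ) • (Polynomial.X, 0) := by
      rw [dX_apply, derivative_x_sq, map_zero, Prod.smul_mk, smul_zero]
    rw [upsilonPrime, this, superMul_smul, superMul_x, etaSum_single, pow_zero, mul_one, evenMul_smul,
      mul_smul_comm, mul_smul_comm, evenMul_comm_x, one_smul]
  · rw [hB k l hk, upsilon_x_sq, upsilonTilde_x_sq]
    simp only [oddMul_eq, mul_add, Module.End.mul_neg', mul_smul_comm, mul_assoc,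
      parity_mul_parity_mul, parity_mul_theta_mul, x_comm_evenMul_mul, theta_comm_evenMul_mul]
    module

/-- The polarization of the relation of index `k`. -/
def relation (t t' : Params m A) (k : Finset.Icc 1 m) : A :=
  t.b k * t'.a (m + k - 1) - t.a (m - k) * t'.c k + t.c k * t'.a (m + k - 1)

/-- Two off-diagonal blocks never compose, since their sources have index at least m and their
targets index below m. Two diagonal parts give θ² = 0. The mixed products remain, with the scalars
kept in the order of the operators, so supercommutativity is not involved. -/
theorem normalOp_mul_normalOp (t t' : Params m A) :
    t.normalOp * t'.normalOp = ∑ k : Finset.Icc 1 m, blockOp (m - k) (m + k - 1)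
      (thetaMul A * etaSum (Finsupp.single (2 * ((k : ℕ) - 1))
        ((4 * (-1) ^ ((k : ℕ) - 1) : ℝ) • t.relation t' k))) := by
  have h1 : (∑ k : Finset.Icc 1 m, blockOp (m - k) (m + k - 1) (t.blockNormal k)) *
      (∑ k : Finset.Icc 1 m, blockOp (m - k) (m + k - 1) (t'.blockNormal k)) = 0 := by
    rw [Finset.sum_mul_sum]
    refine Finset.sum_eq_zero fun k _ => Finset.sum_eq_zero fun k' _ => ?_
    have h1 := Finset.mem_Icc.mp k.2
    have h2 := Finset.mem_Icc.mp k'.2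
    exact blockOp_mul_blockOp_of_ne (by omega) _ _
  have h2 : (diagOp fun j => thetaMul A * etaSum (Finsupp.single 0 ((2 : ℝ) • t.a j))) *
      (diagOp fun j => thetaMul A * etaSum (Finsupp.single 0 ((2 : ℝ) • t'.a j))) = 0 := by
    rw [diagOp_mul_diagOp, ← diagOp_zero]
    refine congrArg diagOp (funext fun j => ?_)
    rw [etaSum_single, pow_zero, mul_one, mul_assoc, ← mul_assoc (evenMul _),
      ← evenMul_comm_theta, mul_assoc, theta_mul_theta_mul]
  rw [normalOp, normalOp, mul_add, add_mul, add_mul, h1, h2, zero_add, add_zero, Finset.mul_sum,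
    Finset.sum_mul, ← Finset.sum_add_distrib]
  refine Finset.sum_congr rfl fun k _ => ?_
  rw [diagOp_mul_blockOp, blockOp_mul_diagOp, ← blockOp_add]
  congr 1
  simp only [blockNormal, relation, etaSum_single, pow_zero, mul_one, evenMul_smul, evenMul_neg,
    evenMul_add, sub_eq_add_neg, evenMul_mul, mul_add, add_mul, smul_mul_assoc, mul_smul_comm,
    Module.End.neg_mul', Module.End.mul_neg', mul_assoc, smul_add, smul_neg,
    theta_comm_evenMul_mul, theta_mul_theta_mul]
  generalize (k : ℕ) - 1 = l
  have he (n : ℕ) (a : A) : etaOp A ^ n * evenMul a = evenMul a * etaOp A ^ n :=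
    Commute.pow_left (evenMul_comm_eta a) n
  have e1 (a : A) : etaOp A ^ (2 * l + 1) * (thetaMul A * evenMul a) =
      evenMul a * (etaOp A ^ (2 * l + 1) * thetaMul A) := by
    rw [evenMul_comm_theta, ← mul_assoc, he, mul_assoc]
  have e2 (a : A) : etaOp A ^ (2 * l) * (thetaMul A * evenMul a) =
      evenMul a * (thetaMul A * etaOp A ^ (2 * l)) := by
    rw [evenMul_comm_theta, ← mul_assoc, he, mul_assoc, eta_pow_even_mul_theta]
  simp only [e1, e2, theta_comm_evenMul_mul, parity_comm_evenMul_mul, theta_mul_parity_mul,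
    theta_mul_eta_pow_odd_mul_theta, parity_mul_theta_mul, Module.End.mul_neg', mul_zero, smul_zero]
  module

end Params

/-- `N² = 0`. -/
def SquareZero {B : Type*} [Ring B] (N : B) : Prop := N * N = 0

theorem OspPair.powerSeries {R : Type*} [Ring R] {e φ : R} (h : OspPair e φ) {N : R⟦X⟧}
    (h1 : SquareZero N)
    (h2 : ∀ n, (e * PowerSeries.coeff n N + PowerSeries.coeff n N * e) * e =
      e * (e * PowerSeries.coeff n N + PowerSeries.coeff n N * e))
    (h3 : ∀ n, (e * φ + φ * e) * PowerSeries.coeff n N +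
        (e * PowerSeries.coeff n N + PowerSeries.coeff n N * e) * φ =
      PowerSeries.coeff n N + PowerSeries.coeff n N * (e * φ + φ * e) +
        φ * (e * PowerSeries.coeff n N + PowerSeries.coeff n N * e)) :
    OspPair (PowerSeries.C e) (PowerSeries.C φ + N) := by
  refine (h.map PowerSeries.C).add h1 ?_ ?_
  · ext1 n
    simp only [PowerSeries.coeff_mul_C, PowerSeries.coeff_C_mul, map_add, h2]
  · rw [← map_mul, ← map_mul, ← map_add]
    generalize e * φ + φ * e = H at h3 ⊢
    ext1 n
    simp only [PowerSeries.coeff_mul_C, PowerSeries.coeff_C_mul, map_add, h3]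

/-! ### Normal forms solve the deformation relations. -/

section NormalForms

variable {A : Type*} [Ring A] [Algebra ℝ A]

/-- The hypotheses put c in the power w and p in the power w - 1, with γ_w c_w = 0. This is the case
in which the σ-part of the linearized relation [H, Φ] = Φ also closes. -/
theorem weight_normal {ν w : ℝ} {c p : ℕ →₀ A} (h1 : scaleCoeff (fun k => k - w) c = 0)
    (h2 : scaleCoeff (fun k => k - w) p = -p) (h3 : gaugeShift ν c = 0) :
    weightOp A (ν + w) * (thetaMul A * etaSum c + parityOp A * etaSum p) -
        (thetaMul A * etaSum c + parityOp A * etaSum p) * weightOp A ν +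
        (etaSum c * phiOp A ν - phiOp A (ν + w) * etaSum c) =
      thetaMul A * etaSum c + parityOp A * etaSum p := by
  rw [weight_mul_theta_parity, etaSum_mul_phi, h1, h2, h3]
  simp only [sub_zero, map_neg, Module.End.mul_neg', map_zero, mul_zero, add_zero]
  module

end NormalForms

namespace Params

variable {A : Type*} [Ring A] [Algebra ℝ A] {m : ℕ}

/-- Block k has ν = 1 - k and w = 2k - 1, the values at which γ_w = 0. -/
theorem blockNormal_weight {δ : ℝ} (hδ : 1 ≤ m → 2 * δ = m) (t : Params m A)
    (k : Finset.Icc 1 m) :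
    weightOp A (2 * δ - (m - k : ℕ)) * t.blockNormal k -
        t.blockNormal k * weightOp A (2 * δ - (m + k - 1 : ℕ)) +
        ((etaOp A * t.blockNormal k + t.blockNormal k * etaOp A) *
            phiOp A (2 * δ - (m + k - 1 : ℕ)) -
          phiOp A (2 * δ - (m - k : ℕ)) *
            (etaOp A * t.blockNormal k + t.blockNormal k * etaOp A)) =
      t.blockNormal k := by
  obtain ⟨h1, h2⟩ := Finset.mem_Icc.mp k.2
  obtain ⟨l, hk⟩ : ∃ l, (k : ℕ) = l + 1 := ⟨(k : ℕ) - 1, by omega⟩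
  have hν : 2 * δ - (m - k : ℕ) = 2 * δ - (m + k - 1 : ℕ) + (2 * l + 1 : ℕ) := by
    rw [show m + (k : ℕ) - 1 = m + l by omega, Nat.cast_sub h2, hk]; push_cast; ring
  have hν' : 2 * δ - (m + k - 1 : ℕ) = -l := by
    rw [show m + (k : ℕ) - 1 = m + l by omega, hδ (h1.trans h2)]; push_cast; ring
  rw [hν, hν']
  have e : etaOp A * t.blockNormal k + t.blockNormal k * etaOp A =
      etaSum (Finsupp.single (2 * ((k : ℕ) - 1) + 1)
        ((2 * (-1) ^ ((k : ℕ) - 1) : ℝ) • t.b k)) := by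
    rw [blockNormal, mul_add, add_mul, add_add_add_comm, eta_theta_mul_etaSum,
      eta_parity_mul_etaSum, add_zero]
  rw [e, blockNormal, show (k : ℕ) - 1 = l by omega]
  refine weight_normal ?_ ?_ ?_
  · rw [scaleCoeff_single, sub_self, zero_smul, Finsupp.single_zero]
  · rw [scaleCoeff_single, ← Finsupp.single_neg]
    congr 1
    push_cast
    module
  · rw [gaugeShift_single, (gaugeCoeff_even _ l).2, neg_add_cancel, zero_smul,
      Finsupp.single_zero]

theorem normalOp_weight {δ : ℝ} (hδ : 1 ≤ m → 2 * δ = m) (t : Params m A) :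
    (etaDiag A * phiDiag A δ + phiDiag A δ * etaDiag A) * t.normalOp +
        (etaDiag A * t.normalOp + t.normalOp * etaDiag A) * phiDiag A δ =
      t.normalOp + t.normalOp * (etaDiag A * phiDiag A δ + phiDiag A δ * etaDiag A) +
        phiDiag A δ * (etaDiag A * t.normalOp + t.normalOp * etaDiag A) := by
  have hE : etaDiag A * t.normalOp + t.normalOp * etaDiag A =
      diagOp (fun j => etaSum (Finsupp.single 0 ((2 : ℝ) • t.a j))) +
      ∑ k : Finset.Icc 1 m, blockOp (m - k) (m + k - 1)
        (etaOp A * t.blockNormal k + t.blockNormal k * etaOp A) := by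
    rw [normalOp, mul_add, add_mul, Finset.mul_sum, Finset.sum_mul, add_add_add_comm,
      ← Finset.sum_add_distrib, etaDiag, diagOp_mul_diagOp, diagOp_mul_diagOp, diagOp_add]
    congr 1
    · exact congrArg diagOp (funext fun j => eta_theta_mul_etaSum _)
    · refine Finset.sum_congr rfl fun k _ => ?_
      rw [diagOp_mul_blockOp, blockOp_mul_diagOp, ← blockOp_add]
  have hH : etaDiag A * phiDiag A δ + phiDiag A δ * etaDiag A =
      diagOp fun j => weightOp A (2 * δ - j) := by
    rw [etaDiag, phiDiag, diagOp_mul_diagOp, diagOp_mul_diagOp, diagOp_add]; rfl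
  refine symbolOp_ext fun i j => ?_
  rw [hE, hH, normalOp, phiDiag, component_add, component_add, component_add,
    component_diagOp_mul, component_mul_diagOp, component_mul_diagOp, component_diagOp_mul,
    component_add, component_add, component_sum, component_sum, component_diagOp,
    component_diagOp]
  have hd : weightOp A (2 * δ - i) * (if i = j then thetaMul A * etaSum (Finsupp.single 0
          ((2 : ℝ) • t.a j)) else 0) -
        (if i = j then thetaMul A * etaSum (Finsupp.single 0 ((2 : ℝ) • t.a j)) else 0) *
          weightOp A (2 * δ - j) +
        ((if i = j then etaSum (Finsupp.single 0 ((2 : ℝ) • t.a j)) else 0) *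
          phiOp A (2 * δ - j) - phiOp A (2 * δ - i) *
          (if i = j then etaSum (Finsupp.single 0 ((2 : ℝ) • t.a j)) else 0)) =
      if i = j then thetaMul A * etaSum (Finsupp.single 0 ((2 : ℝ) • t.a j)) else 0 := by
    split_ifs with h
    · rw [h]
      have := weight_normal (ν := 2 * δ - j) (w := 0) (c := Finsupp.single 0 ((2 : ℝ) • t.a j))
        (p := 0) (by simp [scaleCoeff_single]) (by simp) (by simp [gaugeShift_single, gaugeCoeff])
      simpa using this
    · simp
  have hb : weightOp A (2 * δ - i) * (∑ k : Finset.Icc 1 m,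
          component i j (blockOp (m - k) (m + k - 1) (t.blockNormal k))) -
        (∑ k : Finset.Icc 1 m, component i j (blockOp (m - k) (m + k - 1) (t.blockNormal k))) *
          weightOp A (2 * δ - j) +
        ((∑ k : Finset.Icc 1 m, component i j (blockOp (m - k) (m + k - 1)
            (etaOp A * t.blockNormal k + t.blockNormal k * etaOp A))) *
          phiOp A (2 * δ - j) - phiOp A (2 * δ - i) *
          ∑ k : Finset.Icc 1 m, component i j (blockOp (m - k) (m + k - 1)
            (etaOp A * t.blockNormal k + t.blockNormal k * etaOp A))) =
      ∑ k : Finset.Icc 1 m, component i j (blockOp (m - k) (m + k - 1) (t.blockNormal k)) := by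
    simp only [Finset.mul_sum, Finset.sum_mul, ← Finset.sum_sub_distrib, ← Finset.sum_add_distrib]
    refine Finset.sum_congr rfl fun k _ => ?_
    rw [component_blockOp, component_blockOp]
    split_ifs with h
    · rw [h.1, h.2]; exact t.blockNormal_weight hδ k
    · simp
  simp only [mul_add, add_mul]
  linear_combination (norm := module) hd + hb

/-- The family of formal series with the given coefficients. -/
def series (τ : ℕ → Params m A) : Params m A⟦X⟧ where
  a j := PowerSeries.mk fun n => (τ n).a j
  b k := PowerSeries.mk fun n => (τ n).b k
  c k := PowerSeries.mk fun n => (τ n).c k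

theorem map_coeff_series (τ : ℕ → Params m A) (n : ℕ) :
    (series τ).map (PowerSeries.coeff n) = τ n := by
  ext <;> simp [series, map]

/-- The coefficients of the relations. -/
def relationCoeff (τ : ℕ → Params m A) (n : ℕ) (k : Finset.Icc 1 m) : A :=
  ∑ x ∈ Finset.HasAntidiagonal.antidiagonal n, (τ x.1).relation (τ x.2) k

/-- Supercommutativity enters here: the operators produce 𝔞𝔠, the relations contain 𝔠𝔞, and these
agree because 𝔞 is even. -/
theorem relations_series_iff {𝒜 : ℕ × ZMod 2 → Submodule ℝ A} (hA : IsSuperCommutative 𝒜)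
    {τ : ℕ → Params m A} (hτ : ∀ n, (τ n).IsHomogeneous 𝒜 n) :
    (series τ).Relations ↔ ∀ n k, relationCoeff τ n k = 0 := by
  have h (k : Finset.Icc 1 m) (n : ℕ) : PowerSeries.coeff n ((series τ).b k *
      (series τ).a (m + k - 1) - (series τ).c k * (series τ).a (m - k) +
      (series τ).c k * (series τ).a (m + k - 1)) = relationCoeff τ n k := by
    have hc : PowerSeries.coeff n ((series τ).c k * (series τ).a (m - k)) =
        ∑ x ∈ Finset.HasAntidiagonal.antidiagonal n, (τ x.1).a (m - k) * (τ x.2).c k := by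
      rw [PowerSeries.coeff_mul, ← Finset.Nat.sum_antidiagonal_swap]
      refine Finset.sum_congr rfl fun x _ => ?_
      have := hA _ _ _ _ ((hτ x.1).1 (m - k)) ((hτ x.2).2.2 k)
      rw [this]
      simp [series, superSign]
    rw [map_add, map_sub, hc, PowerSeries.coeff_mul, PowerSeries.coeff_mul, relationCoeff,
      ← Finset.sum_sub_distrib, ← Finset.sum_add_distrib]
    simp [series, relation]
  constructor
  · intro hr n k
    rw [← h, hr k, map_zero]
  · intro hr k
    ext n
    rw [h, hr, map_zero]

/-- The deformation of `2X_{xθ}`, as a formal series. -/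
def normalSeries (τ : ℕ → Params m A) : (SymbolOp A)⟦X⟧ :=
  PowerSeries.mk fun n => (τ n).normalOp

theorem coeff_normalSeries_sq (τ : ℕ → Params m A) (n : ℕ) :
    PowerSeries.coeff n (normalSeries τ * normalSeries τ) =
      ∑ k : Finset.Icc 1 m, blockOp (m - k) (m + k - 1)
        (thetaMul A * etaSum (Finsupp.single (2 * ((k : ℕ) - 1))
          ((4 * (-1) ^ ((k : ℕ) - 1) : ℝ) • relationCoeff τ n k))) := by
  have hadd (k : Finset.Icc 1 m) (s : Finset (ℕ × ℕ)) (f : ℕ × ℕ → A) :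
      blockOp (m - k) (m + k - 1) (thetaMul A * etaSum (Finsupp.single (2 * ((k : ℕ) - 1))
          ((4 * (-1) ^ ((k : ℕ) - 1) : ℝ) • ∑ x ∈ s, f x))) =
      ∑ x ∈ s, blockOp (m - k) (m + k - 1) (thetaMul A * etaSum (Finsupp.single
        (2 * ((k : ℕ) - 1)) ((4 * (-1) ^ ((k : ℕ) - 1) : ℝ) • f x))) := by
    classical
    induction s using Finset.induction_on with
    | empty => simp [blockOp_zero]
    | insert x s hx ih =>
      rw [Finset.sum_insert hx, Finset.sum_insert hx, smul_add, Finsupp.single_add, map_add,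
        mul_add, blockOp_add, ih]
  rw [PowerSeries.coeff_mul]
  simp only [relationCoeff, hadd]
  rw [Finset.sum_comm]
  refine Finset.sum_congr rfl fun x _ => ?_
  rw [normalSeries, PowerSeries.coeff_mk, PowerSeries.coeff_mk, normalOp_mul_normalOp]

theorem normalSeries_sq {τ : ℕ → Params m A} (h : ∀ n k, relationCoeff τ n k = 0) :
    SquareZero (normalSeries τ) := by
  rw [SquareZero]
  ext1 n
  rw [coeff_normalSeries_sq, map_zero]
  exact Finset.sum_eq_zero fun k _ => by simp [h, blockOp_zero]

theorem normalOp_eta_sq (t : Params m A) :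
    (etaDiag A * t.normalOp + t.normalOp * etaDiag A) * etaDiag A =
      etaDiag A * (etaDiag A * t.normalOp + t.normalOp * etaDiag A) := by
  have hE : etaDiag A * t.normalOp + t.normalOp * etaDiag A =
      diagOp (fun j => etaSum (Finsupp.single 0 ((2 : ℝ) • t.a j))) +
      ∑ k : Finset.Icc 1 m, blockOp (m - k) (m + k - 1)
        (etaSum (Finsupp.single (2 * ((k : ℕ) - 1) + 1)
          ((2 * (-1) ^ ((k : ℕ) - 1) : ℝ) • t.b k))) := by
    rw [normalOp, mul_add, add_mul, Finset.mul_sum, Finset.sum_mul, add_add_add_comm,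
      ← Finset.sum_add_distrib, etaDiag, diagOp_mul_diagOp, diagOp_mul_diagOp, diagOp_add]
    congr 1
    · exact congrArg diagOp (funext fun j => eta_theta_mul_etaSum _)
    · refine Finset.sum_congr rfl fun k _ => ?_
      rw [diagOp_mul_blockOp, blockOp_mul_diagOp, ← blockOp_add, blockNormal, mul_add, add_mul,
        add_add_add_comm, eta_theta_mul_etaSum, eta_parity_mul_etaSum, add_zero]
  rw [hE, mul_add, add_mul, Finset.mul_sum, Finset.sum_mul, etaDiag, diagOp_mul_diagOp,
    diagOp_mul_diagOp]
  congr 1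
  · exact congrArg diagOp (funext fun j => (eta_mul_etaSum _).symm)
  · exact Finset.sum_congr rfl fun k _ => by
      rw [diagOp_mul_blockOp, blockOp_mul_diagOp, eta_mul_etaSum]

theorem ospPair_series {δ : ℝ} (hδ : 1 ≤ m → 2 * δ = m) {τ : ℕ → Params m A}
    (h : ∀ n k, relationCoeff τ n k = 0) :
    OspPair (PowerSeries.C (etaDiag A)) (PowerSeries.C (phiDiag A δ) + normalSeries τ) := by
  refine (ospPair_diag δ).powerSeries (normalSeries_sq h) (fun n => ?_) fun n => ?_
  · rw [normalSeries, PowerSeries.coeff_mk]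
    exact normalOp_eta_sq _
  · rw [normalSeries, PowerSeries.coeff_mk]
    exact normalOp_weight hδ _

end Params

/-! ### The first-order family as a representation. -/

section Tangent

variable {B : Type*} [Ring B] [Algebra ℝ B]

/-- The derivative of `ospMap e φ` in the direction of `N`, as a function of `φ`. -/
def ospTangent (e φ N : B) : SuperFun ℝ →ₗ[ℝ] B where
  toFun F := (F.1.coeff 1 / 2) • (e * N + N * e) + F.1.coeff 2 • (φ * N + N * φ) +
    (F.2.coeff 1 / 2) • N
  map_add' F G := by
    simp only [Prod.fst_add, Prod.snd_add, Polynomial.coeff_add]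
    module
  map_smul' r F := by
    simp only [Prod.smul_fst, Prod.smul_snd, Polynomial.coeff_smul, RingHom.id_apply, smul_eq_mul]
    module

theorem SquareZero.eq {B : Type*} [Ring B] {N : B} (h : SquareZero N) : N * N = 0 := h

/-- Only the image Φ² of X_{x²} is quadratic in Φ, and N² = 0, so the representation depends on N
through an affine formula. -/
theorem coeff_ospMap {e φ : B} {N : B⟦X⟧} (h : SquareZero N) (F : SuperFun ℝ) (n : ℕ) :
    PowerSeries.coeff n (ospMap (PowerSeries.C e) (PowerSeries.C φ + N) F) =
      PowerSeries.coeff n (PowerSeries.C (ospMap e φ F)) +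
        ospTangent e φ (PowerSeries.coeff n N) F := by
  have hs (r : ℝ) (b : B) : PowerSeries.C (r • b) = r • PowerSeries.C b := by
    ext1 k
    rw [PowerSeries.coeff_smul, PowerSeries.coeff_C, PowerSeries.coeff_C]
    split_ifs <;> simp
  have : ospMap (PowerSeries.C e) (PowerSeries.C φ + N) F = PowerSeries.C (ospMap e φ F) +
      ((F.1.coeff 1 / 2) • (PowerSeries.C e * N + N * PowerSeries.C e) +
        F.1.coeff 2 • (PowerSeries.C φ * N + N * PowerSeries.C φ) + (F.2.coeff 1 / 2) • N) := by
    simp only [ospMap, LinearMap.coe_mk, AddHom.coe_mk, map_add, hs, map_mul, mul_add, add_mul, h.eq]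
    module
  rw [this]
  simp only [map_add, PowerSeries.coeff_smul, PowerSeries.coeff_C_mul, PowerSeries.coeff_mul_C,
    ospTangent, LinearMap.coe_mk, AddHom.coe_mk]

theorem ospTangent_one (e φ N : B) : ospTangent e φ N (1, 0) = 0 := by
  simp [ospTangent, Polynomial.coeff_one]

theorem ospTangent_theta (e φ N : B) : ospTangent e φ N (0, 1) = 0 := by
  simp [ospTangent, Polynomial.coeff_one]

theorem ospTangent_x (e φ N : B) :
    (2 : ℝ) • ospTangent e φ N (Polynomial.X, 0) = e * N + N * e := by
  simp [ospTangent, Polynomial.coeff_X, smul_smul]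

theorem ospTangent_x_theta (e φ N : B) :
    (2 : ℝ) • ospTangent e φ N (0, Polynomial.X) = N := by
  simp [ospTangent, Polynomial.coeff_X, smul_smul]

theorem ospTangent_x_sq (e φ N : B) :
    ospTangent e φ N (Polynomial.X ^ 2, 0) = φ * N + N * φ := by
  simp [ospTangent, Polynomial.coeff_X_pow]

end Tangent

namespace Params

variable {A : Type*} [Ring A] [Algebra ℝ A] {m : ℕ} {δ : ℝ}

/-- By linearity five generators suffice. The cocycles are thereby tangent vectors at (η, φ) in a
direction that fixes η. -/
theorem infinitesimal_eq_ospTangent (hδ : 1 ≤ m → 2 * δ = m) (t : Params m A) {F : SuperFun ℝ}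
    (hF : F ∈ osp) :
    t.infinitesimal F = ospTangent (etaDiag A) (phiDiag A δ) t.normalOp F := by
  have h2 (S T : SymbolOp A) (h : (2 : ℝ) • S = (2 : ℝ) • T) : S = T :=
    smul_right_injective _ two_ne_zero h
  have e1 : t.infinitesimal (1, 0) = ospTangent (etaDiag A) (phiDiag A δ) t.normalOp (1, 0) := by
    rw [infinitesimal_one, ospTangent_one]
  have e2 : t.infinitesimal (0, 1) = ospTangent (etaDiag A) (phiDiag A δ) t.normalOp (0, 1) := by
    rw [infinitesimal_theta, ospTangent_theta]
  have e3 : t.infinitesimal (Polynomial.X, 0) =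
      ospTangent (etaDiag A) (phiDiag A δ) t.normalOp (Polynomial.X, 0) :=
    h2 _ _ (by rw [infinitesimal_x, ospTangent_x])
  have e4 : t.infinitesimal (0, Polynomial.X) =
      ospTangent (etaDiag A) (phiDiag A δ) t.normalOp (0, Polynomial.X) :=
    h2 _ _ (by rw [infinitesimal_x_theta, ospTangent_x_theta])
  have e5 : t.infinitesimal (Polynomial.X ^ 2, 0) =
      ospTangent (etaDiag A) (phiDiag A δ) t.normalOp (Polynomial.X ^ 2, 0) := by
    rw [infinitesimal_x_sq hδ, ospTangent_x_sq]
  exact eqOn_osp (M := SymbolOp A) (f := t.infinitesimalLinear)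
    (g := ospTangent (etaDiag A) (phiDiag A δ) t.normalOp) e1 e2 e3 e4 e5 hF

theorem firstOrderFamily_eq_ospMap (hδ : 1 ≤ m → 2 * δ = m) {τ : ℕ → Params m A}
    (h : ∀ n k, relationCoeff τ n k = 0) (F : osp) :
    firstOrderFamily δ (series τ) F =
      ospMap (PowerSeries.C (etaDiag A)) (PowerSeries.C (phiDiag A δ) + normalSeries τ) F := by
  have h1 := coeff_ospMap (B := SymbolOp A) (e := etaDiag A) (φ := phiDiag A δ)
    (N := normalSeries τ) (normalSeries_sq h) F
  ext1 n
  rw [h1, firstOrderFamily, map_add, PowerSeries.coeff_mk,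
    map_coeff_series, symbolAction_eq_ospMap δ F.2, infinitesimal_eq_ospTangent hδ _ F.2,
    normalSeries, PowerSeries.coeff_mk]

theorem infinitesimal_eq_zero {t : Params m A} (ha : ∀ j, t.a j = 0) (hb : ∀ k, t.b k = 0)
    (hc : ∀ k, t.c k = 0) (F : SuperFun ℝ) : t.infinitesimal F = 0 := by
  have h1 : t.infinitesimal F = diagOp (fun _ => 0) +
      ∑ k : Finset.Icc 1 m, blockOp (m - k) (m + k - 1) 0 := by
    simp only [infinitesimal, ha, hb, hc, oddMul_eq, evenMul_zero, zero_mul, add_zero]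
  rw [h1, diagOp_zero, zero_add]
  exact Finset.sum_eq_zero fun k _ => blockOp_zero _ _

variable {𝒜 : ℕ × ZMod 2 → Submodule ℝ A} [GradedAlgebra 𝒜]

theorem isFormalDeformation_firstOrderFamily (hδ : 1 ≤ m → 2 * δ = m) {τ : ℕ → Params m A}
    (hτ : ∀ n, (τ n).IsHomogeneous 𝒜 n) (h0 : τ 0 = ⟨0, 0, 0⟩)
    (h : ∀ n k, relationCoeff τ n k = 0) :
    IsFormalDeformation 𝒜 δ (firstOrderFamily δ (series τ)) := by
  have hc (F : osp) (n : ℕ) : PowerSeries.coeff n (firstOrderFamily δ (series τ) F) =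
      PowerSeries.coeff n (PowerSeries.C (symbolAction A δ (F : SuperFun ℝ))) +
        (τ n).infinitesimal F := by
    rw [firstOrderFamily, map_add, PowerSeries.coeff_mk, map_coeff_series]
  constructor
  · constructor
    · intro F G
      simp only [firstOrderFamily_eq_ospMap hδ h, Submodule.coe_add, map_add]
    · intro r F
      simp only [firstOrderFamily_eq_ospMap hδ h, Submodule.coe_smul, map_smul]
  · intro F
    rw [hc, infinitesimal_eq_zero (fun j => by rw [h0]; rfl) (fun k => by rw [h0]; rfl)
      (fun k => by rw [h0]; rfl), add_zero, PowerSeries.coeff_zero_C]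
  · intro F n
    rw [hc, PowerSeries.coeff_C]
    refine IsDiffOp.add ?_ (isDiffOp_infinitesimal _ _)
    split_ifs
    · exact isDiffOp_symbolAction _ _
    · exact IsDiffOp.zero
  · intro F p hp n
    rw [hc, PowerSeries.coeff_C]
    refine OpHasDegree.add ?_ (opHasDegree_infinitesimal (hτ n) hp)
    split_ifs with hn
    · rw [hn]; exact opHasDegree_symbolAction _ hp
    · exact OpHasDegree.zero _
  · intro F G H p q hF hG hb
    have hH := hb.eq_ospBracket hF hG F.2 G.2
    have := ospMap_bracket (B := (SymbolOp A)⟦X⟧) (E := PowerSeries.C (etaDiag A))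
      (Φ := PowerSeries.C (phiDiag A δ) + normalSeries τ) (ospPair_series hδ h) hF hG
    rw [firstOrderFamily_eq_ospMap hδ h, firstOrderFamily_eq_ospMap hδ h,
      firstOrderFamily_eq_ospMap hδ h, hH]
    exact this

end Params

/-! ### The relations in a single degree. -/

section Coefficients

variable {R : Type*} [Ring R]

theorem coeff_mul_of_low_left {D S : R⟦X⟧} {n : ℕ} (hD : ∀ k < n, PowerSeries.coeff k D = 0) :
    PowerSeries.coeff n (D * S) = PowerSeries.coeff n D * PowerSeries.coeff 0 S := by
  rw [PowerSeries.coeff_mul]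
  refine Finset.sum_eq_single (n, 0) (fun x hx hne => ?_) fun h => ?_
  · have hs := Finset.HasAntidiagonal.mem_antidiagonal.mp hx
    have : x.1 < n := by
      by_contra h
      exact hne (Prod.ext (by dsimp; omega) (by dsimp; omega))
    rw [hD _ this, zero_mul]
  · exact absurd (Finset.HasAntidiagonal.mem_antidiagonal.mpr (add_zero n)) h

theorem coeff_mul_of_low_right {D S : R⟦X⟧} {n : ℕ} (hD : ∀ k < n, PowerSeries.coeff k D = 0) :
    PowerSeries.coeff n (S * D) = PowerSeries.coeff 0 S * PowerSeries.coeff n D := by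
  rw [PowerSeries.coeff_mul]
  refine Finset.sum_eq_single (0, n) (fun x hx hne => ?_) fun h => ?_
  · have hs := Finset.HasAntidiagonal.mem_antidiagonal.mp hx
    have : x.2 < n := by
      by_contra h
      exact hne (Prod.ext (by dsimp; omega) (by dsimp; omega))
    rw [hD _ this, mul_zero]
  · exact absurd (Finset.HasAntidiagonal.mem_antidiagonal.mpr (zero_add n)) h

theorem coeff_mul_of_low {D S : R⟦X⟧} {n : ℕ} (hD : ∀ k < n, PowerSeries.coeff k D = 0) :
    ∀ k < n, PowerSeries.coeff k (D * S) = 0 ∧ PowerSeries.coeff k (S * D) = 0 := by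
  intro k hk
  rw [coeff_mul_of_low_left fun l hl => hD l (hl.trans hk),
    coeff_mul_of_low_right fun l hl => hD l (hl.trans hk), hD k hk, zero_mul, mul_zero]
  exact ⟨rfl, rfl⟩

/-- The coefficients of index `n` of the relations, for a pair which is `(e, φ + N)` up to terms
of degree at least `n`. -/
theorem OspPair.coeff_relations {E Φ N : R⟦X⟧} {e φ : R} (h : OspPair E Φ) {n : ℕ} (hn : 0 < n)
    (hE : ∀ k < n, PowerSeries.coeff k E = PowerSeries.coeff k (PowerSeries.C e))
    (hΦ : ∀ k < n, PowerSeries.coeff k Φ = PowerSeries.coeff k (PowerSeries.C φ + N))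
    (hN0 : PowerSeries.coeff 0 N = 0) (hN : PowerSeries.coeff n N = 0) {En Φn : R}
    (hEn : En = PowerSeries.coeff n E) (hΦn : Φn = PowerSeries.coeff n Φ) :
    ((e * φ + φ * e) * En + (e * Φn + Φn * e + En * φ + φ * En) * e + En =
        En * (e * φ + φ * e) + e * (e * Φn + Φn * e + En * φ + φ * En)) ∧
      ((e * φ + φ * e) * Φn + (e * Φn + Φn * e + En * φ + φ * En) * φ +
          e * PowerSeries.coeff n (N * N) =
        Φn + Φn * (e * φ + φ * e) + φ * (e * Φn + Φn * e + En * φ + φ * En) +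
          PowerSeries.coeff n (N * N) * e) := by
  obtain ⟨D, hD⟩ : ∃ D, E = PowerSeries.C e + D := ⟨E - PowerSeries.C e, by abel⟩
  obtain ⟨D', hD'⟩ : ∃ D', Φ = PowerSeries.C φ + N + D' :=
    ⟨Φ - (PowerSeries.C φ + N), by abel⟩
  have hl : ∀ k < n, PowerSeries.coeff k D = 0 := fun k hk => by
    simpa [hD] using hE k hk
  have hl' : ∀ k < n, PowerSeries.coeff k D' = 0 := fun k hk => by
    have := hΦ k hk
    rw [hD', map_add] at this
    simpa using this
  have hn0 (r : R) : PowerSeries.coeff n (PowerSeries.C r) = 0 := by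
    rw [PowerSeries.coeff_C, if_neg hn.ne']
  have hDn : PowerSeries.coeff n D = En := by rw [hEn, hD, map_add, hn0, zero_add]
  have hDn' : PowerSeries.coeff n D' = Φn := by
    rw [hΦn, hD', map_add, map_add, hn0, hN, zero_add, zero_add]
  have hE0 : PowerSeries.coeff 0 E = e := by rw [hE 0 hn, PowerSeries.coeff_zero_C]
  have hΦ0 : PowerSeries.coeff 0 Φ = φ := by
    rw [hΦ 0 hn, map_add, hN0, PowerSeries.coeff_zero_C, add_zero]
  -- G gathers the terms of EΦ + ΦE that involve the deviations D and D'. It starts in degree n,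
  -- where its coefficient is linear in them.
  obtain ⟨G, hG⟩ : ∃ G, G = PowerSeries.C e * D' + D' * PowerSeries.C e + D * Φ + Φ * D :=
    ⟨_, rfl⟩
  have hGl : ∀ k < n, PowerSeries.coeff k G = 0 := fun k hk => by
    rw [hG, map_add, map_add, map_add, (coeff_mul_of_low hl k hk).1, (coeff_mul_of_low hl k hk).2,
      (coeff_mul_of_low hl' k hk).1, (coeff_mul_of_low hl' k hk).2]
    simp
  have hGn : PowerSeries.coeff n G = e * Φn + Φn * e + En * φ + φ * En := by
    rw [hG, map_add, map_add, map_add, coeff_mul_of_low_left hl, coeff_mul_of_low_right hl,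
      coeff_mul_of_low_left hl', coeff_mul_of_low_right hl', hDn, hDn', hΦ0,
      PowerSeries.coeff_zero_C]
  obtain ⟨M, hM⟩ : ∃ M, M = PowerSeries.C e * N + N * PowerSeries.C e := ⟨_, rfl⟩
  have hM0 : PowerSeries.coeff 0 M = 0 := by
    rw [hM, map_add, PowerSeries.coeff_C_mul, PowerSeries.coeff_mul_C, hN0]; simp
  have hMn : PowerSeries.coeff n M = 0 := by
    rw [hM, map_add, PowerSeries.coeff_C_mul, PowerSeries.coeff_mul_C, hN]; simp
  obtain ⟨z, hz⟩ : ∃ z, z = e * φ + φ * e := ⟨_, rfl⟩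
  have hH : E * Φ + Φ * E = PowerSeries.C z + M + G := by
    rw [hz, hG, hM, map_add, map_mul, map_mul, hD, hD']; noncomm_ring
  rw [← hGn, ← hz]
  constructor
  · have h1 : PowerSeries.C z * D + M * D + G * E + E + (PowerSeries.C z + M) * PowerSeries.C e =
        D * PowerSeries.C z + D * M + E * G + PowerSeries.C e * (PowerSeries.C z + M) := by
      have := h.1
      rw [hH, hD] at this
      rw [hD]
      linear_combination (norm := noncomm_ring) this
    have h2 := congrArg (PowerSeries.coeff n) h1
    simp only [map_add, coeff_mul_of_low_left hl, coeff_mul_of_low_left hGl,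
      coeff_mul_of_low_right hl, coeff_mul_of_low_right hGl, PowerSeries.coeff_mul_C,
      PowerSeries.coeff_C_mul, hn0, hMn, hM0, hE0, hDn, ← hEn, PowerSeries.coeff_zero_C,
      zero_mul, mul_zero, add_zero] at h2
    exact h2
  · have h1 : PowerSeries.C z * D' + M * D' + G * Φ +
        PowerSeries.C z * (PowerSeries.C φ + N) + M * PowerSeries.C φ +
          PowerSeries.C e * (N * N) =
        Φ + (D' * PowerSeries.C z + D' * M + Φ * G +
          (PowerSeries.C φ + N) * PowerSeries.C z + PowerSeries.C φ * M +
          N * N * PowerSeries.C e) := by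
      have := h.2
      rw [hH, hD'] at this
      -- The quadratic contribution of N is a commutator with e: [M, N] = [e, N²].
      have h3 : M * N + N * N * PowerSeries.C e = N * M + PowerSeries.C e * (N * N) := by
        rw [hM]; noncomm_ring
      rw [hD']
      linear_combination (norm := noncomm_ring) this - h3
    have h2 := congrArg (PowerSeries.coeff n) h1
    simp only [map_add, coeff_mul_of_low_left hl', coeff_mul_of_low_left hGl,
      coeff_mul_of_low_right hl', coeff_mul_of_low_right hGl, PowerSeries.coeff_mul_C,
      PowerSeries.coeff_C_mul, hn0, hMn, hM0, hΦ0, hDn', ← hΦn, PowerSeries.coeff_zero_C, hN,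
      zero_mul, mul_zero, add_zero] at h2
    rw [h2]
    abel

end Coefficients

/-- The only pairs of components between which there are nontrivial classes. -/
theorem exists_block_of_gaugeCoeff_eq_zero {δ : ℝ} {m : ℕ}
    (hm : (1 ≤ m ∧ 2 * δ = m) ∨ (m = 0 ∧ ∀ n : ℕ, 2 * δ ≠ (n : ℝ) + 1)) {i j l : ℕ}
    (hl : j = i + (l + 1)) (hg : gaugeCoeff (2 * δ - j) (l + 1) = 0) :
    ∃ k : Finset.Icc 1 m, i = m - k ∧ j = m + k - 1 ∧ l = 2 * ((k : ℕ) - 1) := by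
  obtain ⟨r, hr | hr⟩ := Nat.even_or_odd' l
  -- For l = 2r the coefficient is ν + r, and its vanishing makes 2δ = i + r + 1 a positive integer,
  -- hence equal to m. For odd l the coefficient is a positive integer.
  · rw [hr, (gaugeCoeff_even _ r).2] at hg
    have h2 : 2 * δ = ((i + r : ℕ) : ℝ) + 1 := by
      rw [hl, hr] at hg; push_cast at hg ⊢; linarith
    rcases hm with ⟨-, h⟩ | ⟨-, h⟩
    · rw [h] at h2
      have h3 : m = i + r + 1 := by exact_mod_cast h2
      exact ⟨⟨r + 1, Finset.mem_Icc.mpr ⟨by omega, by omega⟩⟩, by dsimp only; omega,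
        by dsimp only; omega, by dsimp only; omega⟩
    · exact absurd h2 (h _)
  · rw [hr, show 2 * r + 1 + 1 = 2 * (r + 1) by ring, (gaugeCoeff_even _ (r + 1)).1] at hg
    norm_cast at hg

theorem gaugeCoeff_block {δ : ℝ} {m : ℕ} (hδ : 1 ≤ m → 2 * δ = m) (k : Finset.Icc 1 m) :
    gaugeCoeff (2 * δ - (m + k - 1 : ℕ)) (2 * ((k : ℕ) - 1) + 1) = 0 := by
  obtain ⟨h1, h2⟩ := Finset.mem_Icc.mp k.2
  rw [(gaugeCoeff_even _ _).2, hδ (h1.trans h2), show m + (k : ℕ) - 1 = m + ((k : ℕ) - 1) by omega]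
  push_cast; ring

/-! ### Normalization of one homogeneous term. -/

namespace Params

variable {A : Type*} [Ring A] [Algebra ℝ A] {m : ℕ}

/-- The component from `j` to `i` of the obstruction of index `n`. -/
def obstruction (τ : ℕ → Params m A) (n i j : ℕ) : ℕ →₀ A :=
  ∑ k : Finset.Icc 1 m, if i = m - k ∧ j = m + k - 1 then Finsupp.single (2 * ((k : ℕ) - 1))
    ((4 * (-1) ^ ((k : ℕ) - 1) : ℝ) • relationCoeff τ n k) else 0

theorem component_coeff_normalSeries_sq (τ : ℕ → Params m A) (n i j : ℕ) :
    component i j (PowerSeries.coeff n (normalSeries τ * normalSeries τ)) =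
      thetaMul A * etaSum (obstruction τ n i j) := by
  rw [coeff_normalSeries_sq, component_sum, obstruction, map_sum, Finset.mul_sum]
  refine Finset.sum_congr rfl fun k _ => ?_
  rw [component_blockOp]
  split_ifs <;> simp

theorem obstruction_block (τ : ℕ → Params m A) (n : ℕ) (k : Finset.Icc 1 m) :
    obstruction τ n (m - k) (m + k - 1) = Finsupp.single (2 * ((k : ℕ) - 1))
      ((4 * (-1) ^ ((k : ℕ) - 1) : ℝ) • relationCoeff τ n k) := by
  rw [obstruction, Finset.sum_eq_single k, if_pos ⟨rfl, rfl⟩]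
  · intro k' _ hne
    have h1 := Finset.mem_Icc.mp k.2
    have h2 := Finset.mem_Icc.mp k'.2
    have : (k' : ℕ) ≠ k := fun h => hne (Subtype.ext h)
    exact if_neg fun h => this (by omega)
  · simp

theorem obstruction_of_ne {τ : ℕ → Params m A} {n i j : ℕ}
    (h : ∀ k : Finset.Icc 1 m, ¬(i = m - k ∧ j = m + k - 1)) : obstruction τ n i j = 0 :=
  Finset.sum_eq_zero fun k _ => if_neg (h k)

theorem component_normalOp_diag (t : Params m A) (j : ℕ) :
    component j j t.normalOp = thetaMul A * etaSum (Finsupp.single 0 ((2 : ℝ) • t.a j)) := by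
  rw [normalOp, component_add, component_diagOp, if_pos rfl, component_sum,
    Finset.sum_eq_zero, add_zero]
  intro k _
  have h1 := Finset.mem_Icc.mp k.2
  rw [component_blockOp, if_neg (by omega)]

theorem component_normalOp_block (t : Params m A) (k : Finset.Icc 1 m) :
    component (m - k) (m + k - 1) t.normalOp = t.blockNormal k := by
  have h1 := Finset.mem_Icc.mp k.2
  rw [normalOp, component_add, component_diagOp, if_neg (by omega), component_sum, zero_add,
    Finset.sum_eq_single k, component_blockOp, if_pos ⟨rfl, rfl⟩]
  · intro k' _ hne
    have h2 := Finset.mem_Icc.mp k'.2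
    have : (k' : ℕ) ≠ k := fun h => hne (Subtype.ext h)
    rw [component_blockOp, if_neg fun h => this (by omega)]
  · simp

theorem component_normalOp_of_ne (t : Params m A) {i j : ℕ} (hij : i ≠ j)
    (h : ∀ k : Finset.Icc 1 m, ¬(i = m - k ∧ j = m + k - 1)) :
    component i j t.normalOp = 0 := by
  rw [normalOp, component_add, component_diagOp, if_neg hij, component_sum, zero_add]
  exact Finset.sum_eq_zero fun k _ => by rw [component_blockOp, if_neg (h k)]

variable {δ : ℝ} {𝒜 : ℕ × ZMod 2 → Submodule ℝ A} [GradedAlgebra 𝒜]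

/-- The coefficient of index `n` of a deformation can be brought to normal form, and the
obstructions vanish. -/
theorem exists_gauge_normalOp
    (hm : (1 ≤ m ∧ 2 * δ = m) ∨ (m = 0 ∧ ∀ n : ℕ, 2 * δ ≠ (n : ℝ) + 1))
    {n N : ℕ} {τ : ℕ → Params m A} {E Φ : SymbolOp A} (hE : IsDiffOp E) (hΦ : IsDiffOp Φ)
    (hEd : OpHasDegree 𝒜 (n, 1) E) (hΦd : OpHasDegree 𝒜 (n, 1) Φ)
    (h1 : (etaDiag A * phiDiag A δ + phiDiag A δ * etaDiag A) * E +
        (etaDiag A * Φ + Φ * etaDiag A + E * phiDiag A δ + phiDiag A δ * E) * etaDiag A + E =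
      E * (etaDiag A * phiDiag A δ + phiDiag A δ * etaDiag A) +
        etaDiag A * (etaDiag A * Φ + Φ * etaDiag A + E * phiDiag A δ + phiDiag A δ * E))
    (h2 : (etaDiag A * phiDiag A δ + phiDiag A δ * etaDiag A) * Φ +
        (etaDiag A * Φ + Φ * etaDiag A + E * phiDiag A δ + phiDiag A δ * E) * phiDiag A δ +
          etaDiag A * PowerSeries.coeff N (normalSeries τ * normalSeries τ) =
      Φ + Φ * (etaDiag A * phiDiag A δ + phiDiag A δ * etaDiag A) +
        phiDiag A δ * (etaDiag A * Φ + Φ * etaDiag A + E * phiDiag A δ + phiDiag A δ * E) +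
          PowerSeries.coeff N (normalSeries τ * normalSeries τ) * etaDiag A) :
    (∀ k, relationCoeff τ N k = 0) ∧ ∃ (J : SymbolOp A) (t : Params m A), IsDiffOp J ∧
      OpHasDegree 𝒜 (n, 0) J ∧ t.IsHomogeneous 𝒜 n ∧ E + J * etaDiag A = etaDiag A * J ∧
      Φ + J * phiDiag A δ = phiDiag A δ * J + t.normalOp := by
  have hδ : 1 ≤ m → 2 * δ = m := fun h => by
    rcases hm with h' | h'
    · exact h'.2
    · omega
  have hν (i j : ℕ) : 2 * δ - i = 2 * δ - j + ((j : ℝ) - i) := by ring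
  have hH : etaDiag A * phiDiag A δ + phiDiag A δ * etaDiag A =
      diagOp fun j => weightOp A (2 * δ - j) := by
    rw [etaDiag, phiDiag, diagOp_mul_diagOp, diagOp_mul_diagOp, diagOp_add]; rfl
  rw [hH] at h1 h2
  -- Each matrix entry is treated separately. Between components j and i the weights differ by w/2
  -- with w = j - i, and the obstruction lives in the power w - 1.
  have key (i j : ℕ) := exists_gauge (ν := 2 * δ - j) (w := (j : ℝ) - i) (hE.1 i j) (hΦ.1 i j)
    (q := obstruction τ N i j) (by
      intro k hk
      by_cases h : ∃ k : Finset.Icc 1 m, i = m - k ∧ j = m + k - 1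
      · obtain ⟨k', rfl, rfl⟩ := h
        have h3 := Finset.mem_Icc.mp k'.2
        rw [obstruction_block, Finsupp.single_apply, if_neg]
        rintro rfl
        apply hk
        obtain ⟨l, hl⟩ : ∃ l, (k' : ℕ) = l + 1 := ⟨(k' : ℕ) - 1, by omega⟩
        rw [show m + (k' : ℕ) - 1 = m + l by omega, Nat.cast_sub h3.2, hl]
        push_cast; ring
      · rw [obstruction_of_ne (fun k h' => h ⟨k, h'⟩)]; rfl)
    (by
      have h3 := congrArg (component i j) h1
      simp only [component_add, etaDiag, phiDiag, component_diagOp_mul, component_mul_diagOp] at h3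
      rw [← hν]
      linear_combination (norm := module) h3)
    (by
      have h3 := congrArg (component i j) h2
      simp only [component_add, etaDiag, phiDiag, component_diagOp_mul, component_mul_diagOp,
        component_coeff_normalSeries_sq] at h3
      -- Since ηθ - θη = σ, the commutator of η with N² turns the θ-valued obstruction into a
      -- σ-valued one.
      have h4 : etaOp A * (thetaMul A * etaSum (obstruction τ N i j)) -
          thetaMul A * etaSum (obstruction τ N i j) * etaOp A =
            parityOp A * etaSum (obstruction τ N i j) := by
        rw [mul_assoc, ← eta_mul_etaSum, ← mul_assoc, ← mul_assoc, ← sub_mul, eta_mul_theta,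
          parityOp_eq]
        congr 1
        noncomm_ring
      rw [← hν, ← h4]
      linear_combination (norm := module) h3)
  choose J hJ c p hEJ hΦJ hc hp hpg hcq hJ0 hdeg using key
  have hblockν (k : Finset.Icc 1 m) :
      ((2 * ((k : ℕ) - 1) : ℕ) : ℝ) + 1 = ((m + k - 1 : ℕ) : ℝ) - ((m - k : ℕ) : ℝ) := by
    obtain ⟨h1, h2⟩ := Finset.mem_Icc.mp k.2
    obtain ⟨l, hl⟩ : ∃ l, (k : ℕ) = l + 1 := ⟨(k : ℕ) - 1, by omega⟩
    rw [show m + (k : ℕ) - 1 = m + l by omega, Nat.cast_sub h2, hl]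
    push_cast; ring
  -- At an exceptional block γ_w = 0, so the constraint loses its c-term and says that the
  -- obstruction itself is zero.
  have hrel (k : Finset.Icc 1 m) : relationCoeff τ N k = 0 := by
    have h3 := hcq (m - k) (m + k - 1) (2 * ((k : ℕ) - 1)) (hblockν k)
    rw [gaugeCoeff_block hδ, zero_smul, zero_add, obstruction_block, Finsupp.single_eq_same] at h3
    exact (smul_eq_zero.mp h3).resolve_left (mul_ne_zero (by norm_num) (pow_ne_zero _ (by norm_num)))
  have hobs (i j : ℕ) : obstruction τ N i j = 0 := by
    refine Finset.sum_eq_zero fun k _ => ?_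
    rw [hrel, smul_zero, Finsupp.single_zero, ite_self]
  -- The parameters are the surviving coefficients divided by the constants ±2 of `normalOp` and
  -- `blockNormal`.
  obtain ⟨t, ht⟩ : ∃ t : Params m A, t = ⟨fun j => (1 / 2 : ℝ) • c j j 0,
    fun k => (1 / 2 * (-1) ^ ((k : ℕ) - 1) : ℝ) •
      c (m - k) (m + k - 1) (2 * ((k : ℕ) - 1) + 1),
    fun k => (-(1 / 2 * (-1) ^ ((k : ℕ) - 1)) : ℝ) •
      p (m - k) (m + k - 1) (2 * ((k : ℕ) - 1))⟩ := ⟨_, rfl⟩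
  have hsgn (l : ℕ) : ((-1 : ℝ) ^ l) * (-1) ^ l = 1 := by
    rw [← mul_pow]; norm_num
  have hnormal (i j : ℕ) : thetaMul A * etaSum (c i j) + parityOp A * etaSum (p i j) =
      component i j t.normalOp := by
    by_cases hij : i = j
    · subst hij
      have hp0 : p i i = 0 := by
        ext k
        refine hp i i k ?_
        rw [sub_self]; positivity
      have hc0 : c i i = Finsupp.single 0 ((2 : ℝ) • t.a i) := by
        ext k
        rw [Finsupp.single_apply]
        split_ifs with hk
        · rw [← hk, ht]
          simp [smul_smul]
        · exact hc i i k (by rw [sub_self]; exact_mod_cast Ne.symm hk)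
      rw [component_normalOp_diag, hp0, hc0, map_zero, mul_zero, add_zero]
    by_cases hb : ∃ k : Finset.Icc 1 m, i = m - k ∧ j = m + k - 1
    · obtain ⟨k, rfl, rfl⟩ := hb
      rw [component_normalOp_block, blockNormal]
      congr 3
      · ext l
        rw [Finsupp.single_apply]
        split_ifs with hl
        · rw [← hl, ht, smul_smul]
          rw [show (2 * (-1) ^ ((k : ℕ) - 1) * (1 / 2 * (-1) ^ ((k : ℕ) - 1)) : ℝ) = 1 by
            linear_combination hsgn ((k : ℕ) - 1), one_smul]
        · refine hc _ _ l fun h => hl ?_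
          rw [← hblockν k] at h
          exact_mod_cast h.symm
      · ext l
        rw [Finsupp.single_apply]
        split_ifs with hl
        · rw [← hl, ht, smul_smul]
          rw [show (-(2 * (-1) ^ ((k : ℕ) - 1)) * -(1 / 2 * (-1) ^ ((k : ℕ) - 1)) : ℝ) = 1 by
            linear_combination hsgn ((k : ℕ) - 1), one_smul]
        · refine hp _ _ l fun h => hl ?_
          rw [← hblockν k] at h
          have : (l : ℝ) = ((2 * ((k : ℕ) - 1) : ℕ) : ℝ) := by linarith
          exact_mod_cast this.symm
    -- Off the diagonal and the exceptional blocks γ_w is never zero, and the obstructions have been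
    -- shown to vanish, so neither c nor p survives.
    · have hb' : ∀ k : Finset.Icc 1 m, ¬(i = m - k ∧ j = m + k - 1) := fun k h => hb ⟨k, h⟩
      rw [component_normalOp_of_ne t hij hb']
      have hp0 : p i j = 0 := by
        ext l
        by_cases hl : (l : ℝ) + 1 = (j : ℝ) - i
        · refine hpg i j l hl fun hg => ?_
          have hl' : j = i + (l + 1) := by
            have : (j : ℝ) = ((i + (l + 1) : ℕ) : ℝ) := by push_cast; linarith
            exact_mod_cast this
          obtain ⟨k, h3, h4, -⟩ := exists_block_of_gaugeCoeff_eq_zero hm hl' hg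
          exact hb' k ⟨h3, h4⟩
        · exact hp i j l hl
      have hc0 : c i j = 0 := by
        ext l
        by_cases hl : (l : ℝ) = (j : ℝ) - i
        · rcases l with _ | l
          · exfalso
            apply hij
            have : (i : ℝ) = j := by rw [Nat.cast_zero] at hl; linarith
            exact_mod_cast this
          · have hl2 : (l : ℝ) + 1 = (j : ℝ) - i := by rw [← hl]; push_cast; ring
            have h3 := hcq i j l hl2
            rw [hobs, Finsupp.zero_apply, add_zero] at h3
            refine (smul_eq_zero.mp h3).resolve_left fun hg => ?_
            have hl' : j = i + (l + 1) := by
              have : (j : ℝ) = ((i + (l + 1) : ℕ) : ℝ) := by push_cast; linarith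
              exact_mod_cast this
            obtain ⟨k, h3, h4, -⟩ := exists_block_of_gaugeCoeff_eq_zero hm hl' hg
            exact hb' k ⟨h3, h4⟩
        · exact hc i j l hl
      rw [hp0, hc0, map_zero, mul_zero, mul_zero, add_zero]
  -- The gauge operator is zero wherever both E and Φ are, so it inherits the finiteness of their
  -- columns.
  have hfin (j : ℕ) : {i | J i j ≠ 0}.Finite := by
    refine ((hE.2 j).union (hΦ.2 j)).subset fun i hi => ?_
    by_contra h
    simp only [Set.mem_union, Set.mem_ofPred_eq, not_or, not_not] at h
    exact hi (hJ0 i j h.1 h.2)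
  have hd (i j : ℕ) := hdeg i j 𝒜 n (opHasDegree_iff.mp hEd i j) (opHasDegree_iff.mp hΦd i j)
  refine ⟨hrel, ofComponents J hfin, t, ⟨fun i j => ?_, fun j => ?_⟩, opHasDegree_iff.mpr
    fun i j => ?_, ⟨fun j => ?_, fun k => ?_, fun k => ?_⟩, symbolOp_ext fun i j => ?_,
    symbolOp_ext fun i j => ?_⟩
  · rw [component_ofComponents]; exact hJ i j
  · simp only [component_ofComponents]; exact hfin j
  · rw [component_ofComponents]; exact (hd i j).1
  · rw [ht]
    refine Submodule.smul_mem _ _ ?_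
    simpa using ((hd j j).2 0).1
  · rw [ht]
    refine Submodule.smul_mem _ _ ?_
    have := ((hd (m - k) (m + k - 1)).2 (2 * ((k : ℕ) - 1) + 1)).1
    convert this using 3
    push_cast
    rw [show (2 : ZMod 2) = 0 from rfl]; simp
  · rw [ht]
    refine Submodule.smul_mem _ _ ?_
    have := ((hd (m - k) (m + k - 1)).2 (2 * ((k : ℕ) - 1))).2
    convert this using 3
    push_cast
    rw [show (2 : ZMod 2) = 0 from rfl]; simp
  · rw [component_add, etaDiag, component_mul_diagOp, component_diagOp_mul, component_ofComponents]
    linear_combination (norm := module) hEJ i j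
  · have h3 := hΦJ i j
    rw [← hν, hnormal] at h3
    rw [component_add, component_add, phiDiag, component_mul_diagOp, component_diagOp_mul,
      component_ofComponents]
    linear_combination (norm := module) h3

end Params

/-! ### Formal automorphisms with one non-trivial term. -/

section Elementary

variable {R : Type*} [Ring R]

theorem coeff_mul_congr {S S' T T' : R⟦X⟧} {n : ℕ}
    (hS : ∀ k ≤ n, PowerSeries.coeff k S = PowerSeries.coeff k S')
    (hT : ∀ k ≤ n, PowerSeries.coeff k T = PowerSeries.coeff k T') :
    PowerSeries.coeff n (S * T) = PowerSeries.coeff n (S' * T') := by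
  rw [PowerSeries.coeff_mul, PowerSeries.coeff_mul]
  refine Finset.sum_congr rfl fun x hx => ?_
  have := Finset.HasAntidiagonal.mem_antidiagonal.mp hx
  rw [hS _ (by omega), hT _ (by omega)]

/-- The formal series `1 + J Xⁿ`. -/
def elementary (n : ℕ) (J : R) : R⟦X⟧ := 1 + PowerSeries.C J * PowerSeries.X ^ n

/-- The formal series `1 - J Xⁿ + J² X²ⁿ - ⋯`. -/
def elementaryInv (n : ℕ) (J : R) : R⟦X⟧ :=
  PowerSeries.mk fun k => if n ∣ k then (-J) ^ (k / n) else 0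

theorem coeff_mul_elementary (n k : ℕ) (J : R) (T : R⟦X⟧) :
    PowerSeries.coeff k (T * elementary n J) =
      PowerSeries.coeff k T + if n ≤ k then PowerSeries.coeff (k - n) T * J else 0 := by
  rw [elementary, mul_add, mul_one, map_add, ← mul_assoc, PowerSeries.coeff_mul_X_pow']
  simp only [PowerSeries.coeff_mul_C]

theorem coeff_elementary_mul (n k : ℕ) (J : R) (T : R⟦X⟧) :
    PowerSeries.coeff k (elementary n J * T) =
      PowerSeries.coeff k T + if n ≤ k then J * PowerSeries.coeff (k - n) T else 0 := by
  rw [elementary, add_mul, one_mul, map_add, mul_assoc, PowerSeries.coeff_C_mul,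
    PowerSeries.coeff_X_pow_mul', mul_ite, mul_zero]

theorem coeff_elementary (n k : ℕ) (J : R) : PowerSeries.coeff k (elementary n J) =
    PowerSeries.coeff k (1 : R⟦X⟧) + if k = n then J else 0 := by
  rw [elementary, map_add, PowerSeries.coeff_C_mul, PowerSeries.coeff_X_pow, mul_ite, mul_one,
    mul_zero]

/-- This is the geometric series. Conjugation of pairs and the intertwining identities use the
inverse only on this side. -/
theorem elementaryInv_mul {n : ℕ} (hn : 0 < n) (J : R) :
    elementaryInv n J * elementary n J = 1 := by
  ext k
  rw [coeff_mul_elementary, elementaryInv, PowerSeries.coeff_mk, PowerSeries.coeff_mk,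
    PowerSeries.coeff_one]
  by_cases hk : n ≤ k
  · obtain ⟨l, rfl⟩ := Nat.exists_eq_add_of_le hk
    rw [if_pos hk, Nat.add_sub_cancel_left, Nat.add_div_left _ hn, pow_succ,
      if_neg (show n + l ≠ 0 by omega)]
    by_cases h : n ∣ l
    · rw [if_pos h, if_pos ((Nat.dvd_add_right (dvd_refl n)).mpr h), mul_neg, neg_add_cancel]
    · rw [if_neg h, if_neg, zero_mul, add_zero]
      rwa [Nat.dvd_add_right (dvd_refl n)]
  · rw [if_neg hk, add_zero]
    by_cases h0 : k = 0
    · simp [h0]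
    · rw [if_neg h0, if_neg]
      exact fun h => hk (Nat.le_of_dvd (Nat.pos_of_ne_zero h0) h)

end Elementary

section FormalOperators

variable {A : Type*} [Ring A] [Algebra ℝ A] {𝒜 : ℕ × ZMod 2 → Submodule ℝ A} [GradedAlgebra 𝒜]

/-- Formal series of differential operators of parity `p`, with term of index `n` of degree `n`. -/
def IsFormalOp (𝒜 : ℕ × ZMod 2 → Submodule ℝ A) (p : ZMod 2) (T : (SymbolOp A)⟦X⟧) : Prop :=
  ∀ n : ℕ, IsDiffOp (PowerSeries.coeff n T) ∧ OpHasDegree 𝒜 (n, p) (PowerSeries.coeff n T)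

theorem IsFormalOp.mul {p q : ZMod 2} {S T : (SymbolOp A)⟦X⟧} (hS : IsFormalOp 𝒜 p S)
    (hT : IsFormalOp 𝒜 q T) : IsFormalOp 𝒜 (p + q) (S * T) := by
  intro n
  rw [PowerSeries.coeff_mul]
  refine ⟨IsDiffOp.sum _ fun x _ => (hS _).1.mul (hT _).1, OpHasDegree.sum _ fun x hx =>
    (hS _).2.mul_eq (hT _).2 ?_⟩
  rw [Prod.mk_add_mk, Finset.HasAntidiagonal.mem_antidiagonal.mp hx]

theorem IsDiffOp.pow {T : SymbolOp A} (hT : IsDiffOp T) (k : ℕ) : IsDiffOp (T ^ k) := by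
  induction k with
  | zero => rw [pow_zero]; exact .one
  | succ k ih => rw [pow_succ]; exact ih.mul hT

theorem OpHasDegree.pow_even {n : ℕ} {T : SymbolOp A} (hT : OpHasDegree 𝒜 (n, 0) T) (k : ℕ) :
    OpHasDegree 𝒜 (n * k, 0) (T ^ k) := by
  induction k with
  | zero => rw [pow_zero]; exact .one
  | succ k ih => rw [pow_succ]; exact ih.mul_eq hT (by rw [Prod.mk_add_mk, add_zero, Nat.mul_succ])

theorem isFormalOp_one : IsFormalOp 𝒜 0 1 := by
  intro n
  rw [PowerSeries.coeff_one]
  split_ifs with h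
  · rw [h]; exact ⟨.one, .one⟩
  · exact ⟨.zero, .zero _⟩

theorem isFormalOp_elementary {n : ℕ} {J : SymbolOp A} (hJ : IsDiffOp J)
    (hd : OpHasDegree 𝒜 (n, 0) J) : IsFormalOp 𝒜 0 (elementary n J) := by
  intro k
  have h2 : IsDiffOp (if k = n then J else 0) ∧ OpHasDegree 𝒜 (k, 0) (if k = n then J else 0) := by
    split_ifs with h
    · rw [h]; exact ⟨hJ, hd⟩
    · exact ⟨.zero, .zero _⟩
  have h3 : PowerSeries.coeff k (elementary n J) =
      PowerSeries.coeff k (1 : (SymbolOp A)⟦X⟧) + if k = n then J else 0 := coeff_elementary n k J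
  rw [h3]
  exact ⟨(isFormalOp_one (𝒜 := 𝒜) k).1.add h2.1, (isFormalOp_one k).2.add h2.2⟩

theorem isFormalOp_elementaryInv {n : ℕ} {J : SymbolOp A} (hJ : IsDiffOp J)
    (hd : OpHasDegree 𝒜 (n, 0) J) : IsFormalOp 𝒜 0 (elementaryInv n J) := by
  intro k
  rw [elementaryInv, PowerSeries.coeff_mk]
  split_ifs with h
  · refine ⟨hJ.neg.pow _, ?_⟩
    have := hd.neg.pow_even (k / n)
    rwa [Nat.mul_div_cancel' h] at this
  · exact ⟨.zero, .zero _⟩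

end FormalOperators

section ElementaryConj

variable {R : Type*} [Ring R]

/-- The conjugate of `T` by `1 + J Xⁿ`. -/
def elementaryConj (n : ℕ) (J : R) (T : R⟦X⟧) : R⟦X⟧ := elementary n J * T * elementaryInv n J

theorem elementaryConj_mul_elementary {n : ℕ} (hn : 0 < n) (J : R) (T : R⟦X⟧) :
    elementaryConj n J T * elementary n J = elementary n J * T := by
  rw [elementaryConj, mul_assoc, elementaryInv_mul hn, mul_one]

theorem OspPair.elementaryConj {E Φ : R⟦X⟧} (h : OspPair E Φ) {n : ℕ} (hn : 0 < n) (J : R) :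
    OspPair (elementaryConj n J E) (elementaryConj n J Φ) :=
  h.conj (elementaryInv_mul hn J)

theorem coeff_elementaryConj_of_lt {n k : ℕ} (hn : 0 < n) (hk : k < n) (J : R) (T : R⟦X⟧) :
    PowerSeries.coeff k (elementaryConj n J T) = PowerSeries.coeff k T := by
  have := congrArg (PowerSeries.coeff k) (elementaryConj_mul_elementary hn J T)
  rwa [coeff_mul_elementary, coeff_elementary_mul, if_neg (by omega), if_neg (by omega), add_zero,
    add_zero] at this

theorem coeff_elementaryConj {n : ℕ} (hn : 0 < n) (J : R) (T : R⟦X⟧) :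
    PowerSeries.coeff n (elementaryConj n J T) + PowerSeries.coeff 0 T * J =
      PowerSeries.coeff n T + J * PowerSeries.coeff 0 T := by
  have := congrArg (PowerSeries.coeff n) (elementaryConj_mul_elementary hn J T)
  rwa [coeff_mul_elementary, coeff_elementary_mul, if_pos le_rfl, if_pos le_rfl, Nat.sub_self,
    coeff_elementaryConj_of_lt hn hn] at this

theorem coeff_elementaryConj_eq {n : ℕ} (hn : 0 < n) {J P : R} {T : R⟦X⟧}
    (h : PowerSeries.coeff n T + J * PowerSeries.coeff 0 T = PowerSeries.coeff 0 T * J + P) :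
    PowerSeries.coeff n (elementaryConj n J T) = P := by
  have := coeff_elementaryConj hn J T
  rw [h, add_comm] at this
  exact add_left_cancel this

theorem elementary_intertwines {n : ℕ} (hn : 0 < n) (J : R) {I T₀ T : R⟦X⟧}
    (h : I * T₀ = T * I) :
    elementary n J * I * T₀ = elementaryConj n J T * (elementary n J * I) := by
  rw [mul_assoc, h, ← mul_assoc, ← mul_assoc, elementaryConj_mul_elementary hn]

theorem coeff_elementary_mul_of_lt {n k : ℕ} (hk : k < n) (J : R) (T : R⟦X⟧) :
    PowerSeries.coeff k (elementary n J * T) = PowerSeries.coeff k T := by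
  rw [coeff_elementary_mul, if_neg (by omega), add_zero]

end ElementaryConj

/-! ### Normalization in all degrees. -/

namespace Params

variable {A : Type*} [Ring A] [Algebra ℝ A] {m : ℕ}

/-- As τ 0 = 0, the quadratic coefficient of degree n + 1 involves degrees 1 to n only; it is known
before the term of degree n + 1 has been normalized. -/
theorem relationCoeff_congr {τ τ' : ℕ → Params m A} (h0 : τ 0 = ⟨0, 0, 0⟩) {n : ℕ}
    (h : ∀ k ≤ n, τ k = τ' k) (k : Finset.Icc 1 m) :
    relationCoeff τ (n + 1) k = relationCoeff τ' (n + 1) k := by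
  have h0' : τ' 0 = ⟨0, 0, 0⟩ := by rw [← h 0 n.zero_le, h0]
  have hl (s : Params m A) (k : Finset.Icc 1 m) : relation (⟨0, 0, 0⟩ : Params m A) s k = 0 := by
    simp [relation]
  have hr (s : Params m A) (k : Finset.Icc 1 m) : relation s (⟨0, 0, 0⟩ : Params m A) k = 0 := by
    simp [relation]
  refine Finset.sum_congr rfl fun x hx => ?_
  have hs := Finset.HasAntidiagonal.mem_antidiagonal.mp hx
  rcases Nat.eq_zero_or_pos x.1 with h1 | h1
  · rw [h1, h0, h0', hl, hl]
  rcases Nat.eq_zero_or_pos x.2 with h2 | h2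
  · rw [h2, h0, h0', hr, hr]
  rw [h x.1 (by omega), h x.2 (by omega)]

theorem relationCoeff_zero {τ : ℕ → Params m A} (h0 : τ 0 = ⟨0, 0, 0⟩) (k : Finset.Icc 1 m) :
    relationCoeff τ 0 k = 0 := by
  simp [relationCoeff, h0, relation]

theorem normalOp_eq_zero {t : Params m A} (ht : t = ⟨0, 0, 0⟩) : t.normalOp = 0 := by
  have hb (k : Finset.Icc 1 m) : t.blockNormal k = 0 := by
    rw [ht]; simp [blockNormal]
  have ha : (fun j => thetaMul A * etaSum (Finsupp.single 0 ((2 : ℝ) • t.a j))) = fun _ => 0 := by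
    rw [ht]; simp
  rw [normalOp, ha, diagOp_zero, zero_add]
  exact Finset.sum_eq_zero fun k _ => by rw [hb, blockOp_zero]

theorem isHomogeneous_zero (𝒜 : ℕ × ZMod 2 → Submodule ℝ A) (n : ℕ) :
    IsHomogeneous 𝒜 n (⟨0, 0, 0⟩ : Params m A) :=
  ⟨fun _ => zero_mem _, fun _ => zero_mem _, fun _ => zero_mem _⟩

/-- The conjugate of `(E₀, Φ₀)` by `I` is `(E, Φ)`, which is in the normal form of parameter `τ` up
to terms of degree greater than `n`. -/
structure IsNormalized (𝒜 : ℕ × ZMod 2 → Submodule ℝ A) (δ : ℝ) (E₀ Φ₀ : (SymbolOp A)⟦X⟧) (n : ℕ)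
    (I E Φ : (SymbolOp A)⟦X⟧) (τ : ℕ → Params m A) : Prop where
  intertwines_eta : I * E₀ = E * I
  intertwines_phi : I * Φ₀ = Φ * I
  coeff_zero : PowerSeries.coeff 0 I = 1
  formal : IsFormalOp 𝒜 0 I
  formal_eta : IsFormalOp 𝒜 1 E
  formal_phi : IsFormalOp 𝒜 1 Φ
  ospPair : OspPair E Φ
  eta : ∀ k ≤ n, PowerSeries.coeff k E = PowerSeries.coeff k (PowerSeries.C (etaDiag A))
  phi : ∀ k ≤ n, PowerSeries.coeff k Φ =
    PowerSeries.coeff k (PowerSeries.C (phiDiag A δ) + normalSeries τ)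
  homogeneous : ∀ k, (τ k).IsHomogeneous 𝒜 k
  zero : τ 0 = ⟨0, 0, 0⟩
  truncated : ∀ k, n < k → τ k = ⟨0, 0, 0⟩

variable {δ : ℝ} {𝒜 : ℕ × ZMod 2 → Submodule ℝ A} [GradedAlgebra 𝒜]

/-- In degree n + 1 the relations are linear in the new terms of E and Φ, with inhomogeneity [η,
N²]. `exists_gauge_normalOp` solves them, and conjugation by 1 + JX^{n+1} leaves the lower degrees
untouched. -/
theorem IsNormalized.step
    (hm : (1 ≤ m ∧ 2 * δ = m) ∨ (m = 0 ∧ ∀ n : ℕ, 2 * δ ≠ (n : ℝ) + 1))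
    {E₀ Φ₀ I E Φ : (SymbolOp A)⟦X⟧} {n : ℕ} {τ : ℕ → Params m A}
    (h : IsNormalized 𝒜 δ E₀ Φ₀ n I E Φ τ) :
    ∃ I' E' Φ' τ', IsNormalized 𝒜 δ E₀ Φ₀ (n + 1) I' E' Φ' (τ' : ℕ → Params m A) ∧
      (∀ k ≤ n, PowerSeries.coeff k I' = PowerSeries.coeff k I) ∧ (∀ k ≤ n, τ' k = τ k) ∧
      ∀ k, relationCoeff τ' (n + 1) k = 0 := by
  have hN (k : ℕ) (hk : τ k = ⟨0, 0, 0⟩) : PowerSeries.coeff k (normalSeries τ) = 0 := by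
    rw [normalSeries, PowerSeries.coeff_mk, normalOp_eq_zero hk]
  obtain ⟨h1, h2⟩ := OspPair.coeff_relations (R := SymbolOp A) h.ospPair n.succ_pos
    (fun k hk => h.eta k (Nat.lt_succ_iff.mp hk)) (fun k hk => h.phi k (Nat.lt_succ_iff.mp hk))
    (hN 0 h.zero) (hN _ (h.truncated _ n.lt_succ_self)) rfl rfl
  obtain ⟨hrel, J, t, hJ, hJd, ht, hJE, hJΦ⟩ := exists_gauge_normalOp hm
    (h.formal_eta (n + 1)).1 (h.formal_phi (n + 1)).1 (h.formal_eta (n + 1)).2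
    (h.formal_phi (n + 1)).2 h1 h2
  have hn : 0 < n + 1 := n.succ_pos
  have c1 (k : ℕ) (hk : k < n + 1) (T : (SymbolOp A)⟦X⟧) :
      PowerSeries.coeff k (elementaryConj (n + 1) J T) = PowerSeries.coeff k T :=
    coeff_elementaryConj_of_lt hn hk J T
  have c2 {T : (SymbolOp A)⟦X⟧} {P : SymbolOp A} (h : PowerSeries.coeff (n + 1) T +
      J * PowerSeries.coeff 0 T = PowerSeries.coeff 0 T * J + P) :
      PowerSeries.coeff (n + 1) (elementaryConj (n + 1) J T) = P :=
    coeff_elementaryConj_eq hn h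
  have c3 (k : ℕ) (hk : k < n + 1) (T : (SymbolOp A)⟦X⟧) :
      PowerSeries.coeff k (elementary (n + 1) J * T) = PowerSeries.coeff k T :=
    coeff_elementary_mul_of_lt hk J T
  have hf {p : ZMod 2} {T : (SymbolOp A)⟦X⟧} (hT : IsFormalOp 𝒜 p T) :
      IsFormalOp 𝒜 p (elementaryConj (n + 1) J T) := by
    have := ((isFormalOp_elementary hJ hJd).mul hT).mul (isFormalOp_elementaryInv hJ hJd)
    rwa [zero_add, add_zero] at this
  have hE0 : PowerSeries.coeff 0 E = etaDiag A := by
    rw [h.eta 0 n.zero_le, PowerSeries.coeff_zero_C]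
  have hΦ0 : PowerSeries.coeff 0 Φ = phiDiag A δ := by
    rw [h.phi 0 n.zero_le, map_add, PowerSeries.coeff_zero_C, hN 0 h.zero, add_zero]
  have hτ (k : ℕ) (hk : k ≤ n) : Function.update τ (n + 1) t k = τ k :=
    Function.update_of_ne (by omega) _ _
  have hS (k : ℕ) : PowerSeries.coeff k (normalSeries (Function.update τ (n + 1) t)) =
      (Function.update τ (n + 1) t k).normalOp := PowerSeries.coeff_mk _ _
  have hS' (k : ℕ) : PowerSeries.coeff k (normalSeries τ) = (τ k).normalOp :=
    PowerSeries.coeff_mk _ _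
  refine ⟨elementary (n + 1) J * I, elementaryConj (n + 1) J E, elementaryConj (n + 1) J Φ,
    Function.update τ (n + 1) t, ⟨elementary_intertwines hn J h.intertwines_eta,
      elementary_intertwines hn J h.intertwines_phi, ?_, ?_, hf h.formal_eta, hf h.formal_phi,
      h.ospPair.elementaryConj hn J, ?_, ?_, ?_, ?_, ?_⟩,
    fun k hk => c3 k (Nat.lt_succ_iff.mpr hk) I, hτ, fun k => ?_⟩
  · rw [c3 0 hn, h.coeff_zero]
  · have := (isFormalOp_elementary hJ hJd).mul h.formal
    rwa [zero_add] at this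
  · intro k hk
    rcases Nat.lt_or_ge k (n + 1) with hk' | hk'
    · rw [c1 k hk', h.eta k (Nat.lt_succ_iff.mp hk')]
    · have hk2 : k = n + 1 := le_antisymm hk hk'
      rw [hk2, PowerSeries.coeff_C, if_neg hn.ne']
      exact c2 (by rw [hE0, hJE, add_zero])
  · intro k hk
    rw [map_add, hS]
    rcases Nat.lt_or_ge k (n + 1) with hk' | hk'
    · rw [c1 k hk', h.phi k (Nat.lt_succ_iff.mp hk'), hτ k (Nat.lt_succ_iff.mp hk'), map_add, hS']
    · have hk2 : k = n + 1 := le_antisymm hk hk'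
      rw [hk2, PowerSeries.coeff_C, if_neg hn.ne', Function.update_self, zero_add]
      exact c2 (by rw [hΦ0, hJΦ])
  · intro k
    by_cases hk : k = n + 1
    · rw [hk, Function.update_self]; exact ht
    · rw [Function.update_of_ne hk]; exact h.homogeneous k
  · rw [hτ 0 n.zero_le, h.zero]
  · intro k hk
    rw [Function.update_of_ne (by omega), h.truncated k (by omega)]
  · rw [← relationCoeff_congr h.zero (fun l hl => (hτ l hl).symm), hrel]

/-- Every deformation can be brought to normal form by a formal automorphism. -/
theorem exists_normalization
    (hm : (1 ≤ m ∧ 2 * δ = m) ∨ (m = 0 ∧ ∀ n : ℕ, 2 * δ ≠ (n : ℝ) + 1))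
    {E₀ Φ₀ : (SymbolOp A)⟦X⟧} (hE : IsFormalOp 𝒜 1 E₀) (hΦ : IsFormalOp 𝒜 1 Φ₀)
    (h : OspPair E₀ Φ₀) (hE0 : PowerSeries.coeff 0 E₀ = etaDiag A)
    (hΦ0 : PowerSeries.coeff 0 Φ₀ = phiDiag A δ) :
    ∃ (I : (SymbolOp A)⟦X⟧) (τ : ℕ → Params m A), PowerSeries.coeff 0 I = 1 ∧ IsFormalOp 𝒜 0 I ∧
      (∀ k, (τ k).IsHomogeneous 𝒜 k) ∧ τ 0 = ⟨0, 0, 0⟩ ∧ (∀ n k, relationCoeff τ n k = 0) ∧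
      I * E₀ = PowerSeries.C (etaDiag A) * I ∧
      I * Φ₀ = (PowerSeries.C (phiDiag A δ) + normalSeries τ) * I := by
  let State : ℕ → Type _ := fun n =>
    {s : ((SymbolOp A)⟦X⟧ × (SymbolOp A)⟦X⟧ × (SymbolOp A)⟦X⟧) × (ℕ → Params m A) //
      IsNormalized 𝒜 δ E₀ Φ₀ n s.1.1 s.1.2.1 s.1.2.2 s.2}
  have hz (k : ℕ) : PowerSeries.coeff k (normalSeries fun _ => (⟨0, 0, 0⟩ : Params m A)) = 0 := by
    rw [normalSeries, PowerSeries.coeff_mk, normalOp_eq_zero rfl]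
  have s0 : State 0 := ⟨((1, E₀, Φ₀), fun _ => ⟨0, 0, 0⟩),
    { intertwines_eta := by rw [one_mul, mul_one]
      intertwines_phi := by rw [one_mul, mul_one]
      coeff_zero := by rw [PowerSeries.coeff_zero_one]
      formal := isFormalOp_one
      formal_eta := hE
      formal_phi := hΦ
      ospPair := h
      eta := fun k hk => by
        rw [Nat.le_zero.mp hk, PowerSeries.coeff_zero_C, hE0]
      phi := fun k hk => by
        rw [Nat.le_zero.mp hk, map_add, PowerSeries.coeff_zero_C, hz, add_zero, hΦ0]
      homogeneous := isHomogeneous_zero 𝒜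
      zero := rfl
      truncated := fun _ _ => rfl }⟩
  have hstep (n : ℕ) (s : State n) : ∃ s' : State (n + 1),
      (∀ k ≤ n, PowerSeries.coeff k s'.1.1.1 = PowerSeries.coeff k s.1.1.1) ∧
        (∀ k ≤ n, s'.1.2 k = s.1.2 k) ∧ ∀ k, relationCoeff s'.1.2 (n + 1) k = 0 := by
    obtain ⟨I', E', Φ', τ', h1, h2⟩ := s.2.step hm
    exact ⟨⟨((I', E', Φ'), τ'), h1⟩, h2⟩
  choose next hnext using hstep
  let f : ∀ n, State n := fun n => Nat.rec s0 next n
  have hf (n : ℕ) : (∀ k ≤ n, PowerSeries.coeff k (f (n + 1)).1.1.1 =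
        PowerSeries.coeff k (f n).1.1.1) ∧
      (∀ k ≤ n, (f (n + 1)).1.2 k = (f n).1.2 k) ∧
      ∀ k, relationCoeff (f (n + 1)).1.2 (n + 1) k = 0 := hnext n (f n)
  generalize f = f at hf
  -- Later steps do not change earlier coefficients, so the infinite product of the elementary
  -- automorphisms converges and the limit is read off along the diagonal.
  have hI (n k : ℕ) (hk : k ≤ n) : PowerSeries.coeff k (f n).1.1.1 =
      PowerSeries.coeff k (f k).1.1.1 := by
    induction n, hk using Nat.le_induction with
    | base => rfl
    | succ n hk ih => rw [(hf n).1 k hk, ih]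
  have hτ (n k : ℕ) (hk : k ≤ n) : (f n).1.2 k = (f k).1.2 k := by
    induction n, hk using Nat.le_induction with
    | base => rfl
    | succ n hk ih => rw [(hf n).2.1 k hk, ih]
  have hIc (k : ℕ) : PowerSeries.coeff k (PowerSeries.mk fun n =>
      PowerSeries.coeff n (f n).1.1.1) = PowerSeries.coeff k (f k).1.1.1 :=
    PowerSeries.coeff_mk _ _
  have hS (τ : ℕ → Params m A) (k : ℕ) :
      PowerSeries.coeff k (normalSeries τ) = (τ k).normalOp := PowerSeries.coeff_mk _ _
  refine ⟨PowerSeries.mk fun n => PowerSeries.coeff n (f n).1.1.1, fun n => (f n).1.2 n, ?_, ?_,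
    fun k => (f k).2.homogeneous k, (f 0).2.zero, ?_, ?_, ?_⟩
  · rw [hIc, (f 0).2.coeff_zero]
  · intro n
    rw [hIc]; exact (f n).2.formal n
  · intro n k
    rcases n with _ | n
    · exact relationCoeff_zero (f 0).2.zero k
    · rw [relationCoeff_congr (τ := fun n => (f n).1.2 n) (τ' := (f (n + 1)).1.2) (f 0).2.zero
        (fun l hl => (hτ (n + 1) l (by omega)).symm), (hf n).2.2]
  · ext1 n
    rw [coeff_mul_congr (S' := (f n).1.1.1) (T' := E₀) (n := n)
      (fun k hk => by rw [hIc, hI n k hk]) (fun _ _ => rfl), (f n).2.intertwines_eta,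
      coeff_mul_congr (S' := PowerSeries.C (etaDiag A)) (n := n)
        (T' := PowerSeries.mk fun n => PowerSeries.coeff n (f n).1.1.1) (f n).2.eta
        (fun k hk => by rw [hI n k hk, ← hIc])]
  · ext1 n
    rw [coeff_mul_congr (S' := (f n).1.1.1) (T' := Φ₀) (n := n)
      (fun k hk => by rw [hIc, hI n k hk]) (fun _ _ => rfl), (f n).2.intertwines_phi,
      coeff_mul_congr (S' := PowerSeries.C (phiDiag A δ) + normalSeries fun n => (f n).1.2 n)
        (n := n) (T' := PowerSeries.mk fun n => PowerSeries.coeff n (f n).1.1.1)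
        (fun k hk => by
          rw [(f n).2.phi k hk, map_add, map_add, hS, hS, hτ n k hk])
        (fun k hk => by rw [hI n k hk, ← hIc])]

end Params

/-! ### From deformations to pairs of operators. -/

section Representations

theorem theta_mem_osp : ((0, 1) : SuperFun ℝ) ∈ osp := Submodule.subset_span (by simp)

theorem x_theta_mem_osp : ((0, Polynomial.X) : SuperFun ℝ) ∈ osp := Submodule.subset_span (by simp)

theorem one_mem_osp : ((1, 0) : SuperFun ℝ) ∈ osp := Submodule.subset_span (by simp)

theorem x_mem_osp : ((Polynomial.X, 0) : SuperFun ℝ) ∈ osp := Submodule.subset_span (by simp)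

theorem x_sq_mem_osp : ((Polynomial.X ^ 2, 0) : SuperFun ℝ) ∈ osp :=
  Submodule.subset_span (by simp)

/-- A linear map on `osp(1|2)` is determined by its values on the generators. -/
theorem eq_ospMap {B : Type*} [Ring B] [Algebra ℝ B] {ρ : osp → B} (hl : IsLinearMap ℝ ρ)
    {E Φ : B} (h1 : ρ ⟨_, one_mem_osp⟩ = E * E) (h2 : (2 : ℝ) • ρ ⟨_, theta_mem_osp⟩ = E)
    (h3 : (2 : ℝ) • ρ ⟨_, x_mem_osp⟩ = E * Φ + Φ * E)
    (h4 : (2 : ℝ) • ρ ⟨_, x_theta_mem_osp⟩ = Φ) (h5 : ρ ⟨_, x_sq_mem_osp⟩ = Φ * Φ) (F : osp) :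
    ρ F = ospMap E Φ F := by
  have h2' : ρ ⟨_, theta_mem_osp⟩ = (1 / 2 : ℝ) • E := by rw [← h2, smul_smul]; norm_num
  have h3' : ρ ⟨_, x_mem_osp⟩ = (1 / 2 : ℝ) • (E * Φ + Φ * E) := by
    rw [← h3, smul_smul]; norm_num
  have h4' : ρ ⟨_, x_theta_mem_osp⟩ = (1 / 2 : ℝ) • Φ := by rw [← h4, smul_smul]; norm_num
  obtain ⟨F, hF⟩ := F
  refine Submodule.span_induction (p := fun F hF => ρ ⟨F, hF⟩ = ospMap E Φ F) ?_ ?_ ?_ ?_ hF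
  · intro G hG
    simp only [Set.mem_insert_iff, Set.mem_singleton_iff] at hG
    rcases hG with rfl | rfl | rfl | rfl | rfl
    · rw [ospMap_one]; exact h1
    · rw [ospMap_theta]; exact h2'
    · rw [ospMap_x]; exact h3'
    · rw [ospMap_x_theta]; exact h4'
    · rw [ospMap_x_sq]; exact h5
  · rw [map_zero]; exact hl.mk'.map_zero
  · intro F G hF hG h h'
    rw [map_add, ← h, ← h']; exact hl.map_add ⟨F, hF⟩ ⟨G, hG⟩
  · intro r F hF h
    rw [map_smul, ← h]; exact hl.map_smul r ⟨F, hF⟩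

/-- A representation of `osp(1|2)` is determined by the images of `X_θ` and `X_{xθ}`. -/
theorem ospPair_of_representation {B : Type*} [Ring B] [Algebra ℝ B] {ρ : osp → B}
    (hl : IsLinearMap ℝ ρ)
    (hom : ∀ (F G H : osp) (p q : ZMod 2), HasParity p (F : SuperFun ℝ) →
      HasParity q (G : SuperFun ℝ) → IsBracket p q (F : SuperFun ℝ) G H →
      ρ F * ρ G - superSign p q • (ρ G * ρ F) = ρ H) :
    OspPair ((2 : ℝ) • ρ ⟨_, theta_mem_osp⟩) ((2 : ℝ) • ρ ⟨_, x_theta_mem_osp⟩) ∧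
      ∀ F : osp, ρ F = ospMap ((2 : ℝ) • ρ ⟨_, theta_mem_osp⟩)
        ((2 : ℝ) • ρ ⟨_, x_theta_mem_osp⟩) F := by
  have hb (F G H : osp) (p q : ZMod 2) (r : ℝ) (hF : HasParity p (F : SuperFun ℝ))
      (hG : HasParity q (G : SuperFun ℝ))
      (h : ospBracket p q (F : SuperFun ℝ) G = r • (H : SuperFun ℝ)) :
      ρ F * ρ G - superSign p q • (ρ G * ρ F) = r • ρ H := by
    rw [← hl.map_smul]
    refine hom F G (r • H) p q hF hG ?_
    rw [Submodule.coe_smul, ← h]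
    exact isBracket_ospBracket hF hG F.2 G.2
  have ho (f : ℝ[X]) : HasParity 1 (0, f) := ⟨fun h => absurd h (by decide), fun _ => rfl⟩
  have he (f : ℝ[X]) : HasParity 0 (f, 0) := ⟨fun _ => rfl, fun h => absurd h (by decide)⟩
  -- The brackets used are [X_θ, X_θ] = ½X_1, [X_θ, X_{xθ}] = ½X_x, [X_{xθ}, X_{xθ}] = ½X_{x²},
  -- [X_x, X_θ] = -½X_θ and [X_x, X_{xθ}] = ½X_{xθ}. Doubling the odd generators clears the halves.
  have b1 := hb ⟨_, theta_mem_osp⟩ ⟨_, theta_mem_osp⟩ ⟨_, one_mem_osp⟩ 1 1 (1 / 2) (ho _) (ho _)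
    (by ext <;> simp [ospBracket, Polynomial.coeff_one, Polynomial.coeff_C])
  have b2 := hb ⟨_, theta_mem_osp⟩ ⟨_, x_theta_mem_osp⟩ ⟨_, x_mem_osp⟩ 1 1 (1 / 2) (ho _) (ho _)
    (by ext <;> simp [ospBracket, Polynomial.coeff_one, Polynomial.coeff_X])
  have b3 := hb ⟨_, x_theta_mem_osp⟩ ⟨_, x_theta_mem_osp⟩ ⟨_, x_sq_mem_osp⟩ 1 1 (1 / 2) (ho _)
    (ho _) (by ext <;> simp [ospBracket, Polynomial.coeff_X])
  have b4 := hb ⟨_, x_mem_osp⟩ ⟨_, theta_mem_osp⟩ ⟨_, theta_mem_osp⟩ 0 1 (-1 / 2) (he _) (ho _)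
    (by ext <;> simp [ospBracket, Polynomial.coeff_one, Polynomial.coeff_X, Polynomial.coeff_C]
        split_ifs <;> norm_num)
  have b5 := hb ⟨_, x_mem_osp⟩ ⟨_, x_theta_mem_osp⟩ ⟨_, x_theta_mem_osp⟩ 0 1 (1 / 2) (he _) (ho _)
    (by ext <;> simp [ospBracket, Polynomial.coeff_X])
  have s1 : superSign 1 1 = -1 := rfl
  have s2 : superSign 0 1 = 1 := rfl
  rw [s1, neg_one_zsmul, sub_neg_eq_add] at b1 b2 b3
  rw [s2, one_zsmul] at b4 b5
  have hx : (2 : ℝ) • ρ ⟨_, x_mem_osp⟩ = (2 : ℝ) • ρ ⟨_, theta_mem_osp⟩ *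
      (2 : ℝ) • ρ ⟨_, x_theta_mem_osp⟩ + (2 : ℝ) • ρ ⟨_, x_theta_mem_osp⟩ *
      (2 : ℝ) • ρ ⟨_, theta_mem_osp⟩ := by
    rw [smul_mul_smul_comm, smul_mul_smul_comm]
    linear_combination (norm := module) (-4 : ℝ) • b2
  refine ⟨⟨?_, ?_⟩, eq_ospMap hl ?_ rfl hx rfl ?_⟩
  · rw [← hx, smul_mul_smul_comm, smul_mul_smul_comm]
    linear_combination (norm := module) (4 : ℝ) • b4
  · rw [← hx, smul_mul_smul_comm, smul_mul_smul_comm]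
    linear_combination (norm := module) (4 : ℝ) • b5
  · rw [smul_mul_smul_comm]
    linear_combination (norm := module) (-2 : ℝ) • b1
  · rw [smul_mul_smul_comm]
    linear_combination (norm := module) (-2 : ℝ) • b3

end Representations

theorem ospMap_intertwines {B : Type*} [Ring B] [Algebra ℝ B] {I E Φ E' Φ' : B}
    (hE : I * E = E' * I) (hΦ : I * Φ = Φ' * I) (F : SuperFun ℝ) :
    I * ospMap E Φ F = ospMap E' Φ' F * I := by
  have h {S S' T T' : B} (h1 : I * S = S' * I) (h2 : I * T = T' * I) :
      I * (S * T) = S' * T' * I := by rw [← mul_assoc, h1, mul_assoc, h2, mul_assoc]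
  simp only [ospMap, LinearMap.coe_mk, AddHom.coe_mk, mul_add, add_mul, mul_smul_comm,
    smul_mul_assoc, h hE hE, h hE hΦ, h hΦ hE, h hΦ hΦ, hE, hΦ]

theorem coeff_one_of_intertwines {R : Type*} [Ring R] {I T T' : R⟦X⟧}
    (hI : PowerSeries.coeff 0 I = 1) (h : I * T = T' * I) :
    PowerSeries.coeff 1 T + PowerSeries.coeff 1 I * PowerSeries.coeff 0 T =
      PowerSeries.coeff 0 T' * PowerSeries.coeff 1 I + PowerSeries.coeff 1 T' := by
  have h1 (S T : R⟦X⟧) : PowerSeries.coeff 1 (S * T) = PowerSeries.coeff 0 S *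
      PowerSeries.coeff 1 T + PowerSeries.coeff 1 S * PowerSeries.coeff 0 T := by
    rw [PowerSeries.coeff_mul, Finset.Nat.sum_antidiagonal_succ,
      Finset.Nat.antidiagonal_zero, Finset.sum_singleton]
  have h2 := congrArg (PowerSeries.coeff 1) h
  rwa [h1, h1, hI, one_mul, mul_one] at h2

/-! ### Invariance of the first-order parameters. -/

namespace Params

variable {A : Type*} [Ring A] [Algebra ℝ A] {m : ℕ} {δ : ℝ}

/-- Each entry of J commutes with η, so it is a polynomial g(η). It moves c_w by (w - w)g_w = 0 and,
at an exceptional block, p_{w-1} by γ_w g_w = 0. The parameters are therefore gauge invariants. -/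
theorem eq_of_normalOp_conj (hδ : 1 ≤ m → 2 * δ = m) {s t : Params m A} {J : SymbolOp A}
    (hJ : IsDiffOp J) (h1 : J * etaDiag A = etaDiag A * J)
    (h2 : s.normalOp + J * phiDiag A δ = phiDiag A δ * J + t.normalOp) : t = s := by
  have key (i j : ℕ) : ∃ g : ℕ →₀ A, component i j t.normalOp = component i j s.normalOp +
      (thetaMul A * etaSum (scaleCoeff (fun k => k - ((j : ℝ) - i)) g) +
        parityOp A * etaSum (gaugeShift (2 * δ - j) g)) := by
    have h3 := congrArg (component i j) h1
    rw [etaDiag, component_mul_diagOp, component_diagOp_mul] at h3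
    obtain ⟨g, hg, -⟩ := exists_etaSum_of_commute (hJ.1 i j) h3.symm
    have h4 := congrArg (component i j) h2
    rw [component_add, component_add, phiDiag, component_mul_diagOp, component_diagOp_mul, hg] at h4
    have h5 := etaSum_mul_phi (2 * δ - j) ((j : ℝ) - i) g
    rw [show 2 * δ - (j : ℝ) + ((j : ℝ) - i) = 2 * δ - i by ring] at h5
    refine ⟨g, ?_⟩
    rw [← h5]
    linear_combination (norm := module) -h4
  have hb (k : Finset.Icc 1 m) : t.b k = s.b k ∧ t.c k = s.c k := by
    obtain ⟨g, hg⟩ := key (m - k) (m + k - 1)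
    rw [component_normalOp_block, component_normalOp_block, blockNormal, blockNormal,
      add_add_add_comm, ← mul_add, ← mul_add, ← map_add, ← map_add] at hg
    obtain ⟨hθ, hσ⟩ := theta_parity_etaSum_injective hg
    have h3 := DFunLike.congr_fun hθ (2 * ((k : ℕ) - 1) + 1)
    have h4 := DFunLike.congr_fun hσ (2 * ((k : ℕ) - 1))
    have hs : (((2 * ((k : ℕ) - 1) + 1 : ℕ)) : ℝ) -
        (((m + k - 1 : ℕ) : ℝ) - ((m - k : ℕ) : ℝ)) = 0 := by
      obtain ⟨h1, h2⟩ := Finset.mem_Icc.mp k.2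
      obtain ⟨l, hl⟩ : ∃ l, (k : ℕ) = l + 1 := ⟨(k : ℕ) - 1, by omega⟩
      rw [show m + (k : ℕ) - 1 = m + l by omega, Nat.cast_sub h2, hl]
      push_cast; ring
    rw [Finsupp.add_apply, Finsupp.single_eq_same, Finsupp.single_eq_same, scaleCoeff_apply, hs,
      zero_smul, add_zero] at h3
    rw [Finsupp.add_apply, Finsupp.single_eq_same, Finsupp.single_eq_same, gaugeShift_apply,
      gaugeCoeff_block hδ, zero_smul, add_zero] at h4
    exact ⟨smul_right_injective A (mul_ne_zero two_ne_zero (pow_ne_zero _ (by norm_num))) h3,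
      smul_right_injective A (neg_ne_zero.mpr (mul_ne_zero two_ne_zero (pow_ne_zero _ (by norm_num))))
        h4⟩
  have ha (j : ℕ) : t.a j = s.a j := by
    obtain ⟨g, hg⟩ := key j j
    rw [component_normalOp_diag, component_normalOp_diag, ← add_assoc, ← mul_add, ← map_add] at hg
    rw [← add_zero (thetaMul A * etaSum (Finsupp.single 0 ((2 : ℝ) • t.a j))),
      ← mul_zero (parityOp A), ← map_zero (etaSum (A := A))] at hg
    obtain ⟨hθ, -⟩ := theta_parity_etaSum_injective hg
    have h3 := DFunLike.congr_fun hθ 0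
    rw [Finsupp.add_apply, Finsupp.single_eq_same, Finsupp.single_eq_same, scaleCoeff_apply,
      sub_self, Nat.cast_zero, sub_zero, zero_smul, add_zero] at h3
    exact smul_right_injective A (two_ne_zero : (2 : ℝ) ≠ 0) h3
  ext k
  exacts [ha k, (hb k).1, (hb k).2]

variable {𝒜 : ℕ × ZMod 2 → Submodule ℝ A} [GradedAlgebra 𝒜]

/-- An automorphism that intertwines the images of the two odd generators intertwines the whole
representations. If the degree-one term is already an infinitesimal normal form, the degree-one part
of the intertwining identities is a conjugation between normal forms that preserves η, which forces
the parameters to agree. -/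
theorem exists_equivalent_firstOrderFamily
    (hm : (1 ≤ m ∧ 2 * δ = m) ∨ (m = 0 ∧ ∀ n : ℕ, 2 * δ ≠ (n : ℝ) + 1))
    {ρ : osp → (SymbolOp A)⟦X⟧} (hρ : IsFormalDeformation 𝒜 δ ρ) :
    ∃ τ : ℕ → Params m A, (∀ n, (τ n).IsHomogeneous 𝒜 n) ∧ τ 0 = ⟨0, 0, 0⟩ ∧
      (∀ n k, relationCoeff τ n k = 0) ∧
      FormallyEquivalent 𝒜 ρ (firstOrderFamily δ (series τ)) ∧
      ∀ s : Params m A, (∀ F : osp, PowerSeries.coeff 1 (ρ F) =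
        s.infinitesimal (F : SuperFun ℝ)) → τ 1 = s := by
  have hδ : 1 ≤ m → 2 * δ = m := fun h => by
    rcases hm with h' | h'
    · exact h'.2
    · omega
  obtain ⟨h1, h2⟩ := ospPair_of_representation (B := (SymbolOp A)⟦X⟧) (ρ := ρ) hρ.linear hρ.hom
  have hc (n : ℕ) (F : osp) : PowerSeries.coeff n ((2 : ℝ) • ρ F) =
      (2 : ℝ) • PowerSeries.coeff n (ρ F) := PowerSeries.coeff_smul _ _ _
  have hf (F : osp) (hF : HasParity 1 (F : SuperFun ℝ)) : IsFormalOp 𝒜 1 ((2 : ℝ) • ρ F) := by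
    intro n
    rw [hc]
    exact ⟨(hρ.differential F n).smul 2, (hρ.degree F 1 hF n).smul 2⟩
  have ho (f : ℝ[X]) : HasParity 1 (0, f) := ⟨fun h => absurd h (by decide), fun _ => rfl⟩
  have e0 : PowerSeries.coeff 0 ((2 : ℝ) • ρ ⟨_, theta_mem_osp⟩) = etaDiag A := by
    rw [hc, hρ.coeff_zero, symbolAction_eq_ospMap δ theta_mem_osp, ospMap_theta, smul_smul]
    norm_num
  have φ0 : PowerSeries.coeff 0 ((2 : ℝ) • ρ ⟨_, x_theta_mem_osp⟩) = phiDiag A δ := by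
    rw [hc, hρ.coeff_zero, symbolAction_eq_ospMap δ x_theta_mem_osp, ospMap_x_theta, smul_smul]
    norm_num
  obtain ⟨I, τ, hI0, hI, hτ, hτ0, hrel, hIE, hIΦ⟩ := exists_normalization hm
    (hf ⟨_, theta_mem_osp⟩ (ho _)) (hf ⟨_, x_theta_mem_osp⟩ (ho _)) h1 e0 φ0
  refine ⟨τ, hτ, hτ0, hrel, ⟨I, hI0, hI, fun F => ?_⟩, fun s hs => ?_⟩
  · rw [h2, firstOrderFamily_eq_ospMap hδ hrel]
    exact ospMap_intertwines hIE hIΦ _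
  · have c1 (T : SymbolOp A) : PowerSeries.coeff 1 (PowerSeries.C T) = 0 := by
      rw [PowerSeries.coeff_C, if_neg one_ne_zero]
    have hE := coeff_one_of_intertwines (R := SymbolOp A) hI0 hIE
    have hΦ := coeff_one_of_intertwines (R := SymbolOp A) hI0 hIΦ
    have hz : PowerSeries.coeff 0 (normalSeries τ) = 0 := by
      rw [normalSeries, PowerSeries.coeff_mk, normalOp_eq_zero hτ0]
    have hn : PowerSeries.coeff 1 (normalSeries τ) = (τ 1).normalOp := PowerSeries.coeff_mk _ _
    rw [e0, hc, hs, infinitesimal_theta, smul_zero, zero_add, c1, add_zero,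
      PowerSeries.coeff_zero_C] at hE
    rw [φ0, hc, hs, infinitesimal_x_theta, map_add, map_add, c1, hz, hn, add_zero, zero_add,
      PowerSeries.coeff_zero_C] at hΦ
    exact eq_of_normalOp_conj hδ (hI 1).1 hE hΦ

end Params

/-! ### Parameters concentrated in degree one. -/

namespace Params

variable {A : Type*} [Ring A] [Algebra ℝ A] {m : ℕ} {𝒜 : ℕ × ZMod 2 → Submodule ℝ A}

theorem isFormal_series {τ : ℕ → Params m A} (hτ : ∀ n, (τ n).IsHomogeneous 𝒜 n)
    (h0 : τ 0 = ⟨0, 0, 0⟩) : (series τ).IsFormal 𝒜 :=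
  ⟨fun n => by rw [map_coeff_series]; exact hτ n, by rw [map_coeff_series, h0]⟩

theorem relations_iff (hA : IsSuperCommutative 𝒜) {n : ℕ} {t : Params m A}
    (ht : t.IsHomogeneous 𝒜 n) : t.Relations ↔ ∀ k, t.relation t k = 0 := by
  refine forall_congr' fun k => ?_
  have h : t.a (m - k) * t.c k = t.c k * t.a (m - k) := by
    rw [hA _ _ _ _ (ht.1 (m - k)) (ht.2.2 k)]
    simp [superSign]
  rw [relation, h]

/-- Only the splitting 2 = 1 + 1 contributes. This is how the conditions on a normalized series
return the quadratic condition on its infinitesimal part. -/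
theorem relationCoeff_two {τ : ℕ → Params m A} (h0 : τ 0 = ⟨0, 0, 0⟩) (k : Finset.Icc 1 m) :
    relationCoeff τ 2 k = (τ 1).relation (τ 1) k := by
  simp [relationCoeff, Finset.Nat.sum_antidiagonal_succ, h0, relation]

/-- The family of parameters concentrated in degree `1`. -/
def linearFamily (t : Params m A) (n : ℕ) : Params m A := if n = 1 then t else ⟨0, 0, 0⟩

theorem relationCoeff_linearFamily {t : Params m A} (h : ∀ k, t.relation t k = 0) (n : ℕ)
    (k : Finset.Icc 1 m) : relationCoeff t.linearFamily n k = 0 := by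
  refine Finset.sum_eq_zero fun x _ => ?_
  by_cases h1 : x.1 = 1 <;> by_cases h2 : x.2 = 1 <;> simp [linearFamily, h1, h2, h k] <;>
    simp [relation]

theorem isHomogeneous_linearFamily {t : Params m A} (ht : t.IsHomogeneous 𝒜 1) (n : ℕ) :
    (t.linearFamily n).IsHomogeneous 𝒜 n := by
  unfold linearFamily
  split_ifs with h
  · rw [h]; exact ht
  · exact isHomogeneous_zero 𝒜 n

theorem isIntegrable_of_relations [GradedAlgebra 𝒜] {δ : ℝ} (hδ : 1 ≤ m → 2 * δ = m)
    {t : Params m A} (ht : t.IsHomogeneous 𝒜 1) (h : ∀ k, t.relation t k = 0) :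
    IsIntegrable 𝒜 δ t := by
  refine ⟨firstOrderFamily δ (series t.linearFamily), isFormalDeformation_firstOrderFamily hδ
    (isHomogeneous_linearFamily ht) rfl (relationCoeff_linearFamily h), fun F => ?_⟩
  rw [firstOrderFamily, map_add, PowerSeries.coeff_mk, map_coeff_series, PowerSeries.coeff_C,
    if_neg one_ne_zero, zero_add]
  rfl

end Params

end

theorem theorem2 {A : Type*} [Ring A] [Algebra ℝ A]
    (𝒜 : ℕ × ZMod 2 → Submodule ℝ A) [GradedAlgebra 𝒜] (hA : IsSuperCommutative 𝒜)
    (δ : ℝ) (m : ℕ)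
    (hm : (1 ≤ m ∧ 2 * δ = m) ∨ (m = 0 ∧ ∀ n : ℕ, 2 * δ ≠ (n : ℝ) + 1)) :
    (∀ t : Params m A, t.IsHomogeneous 𝒜 1 → (IsIntegrable 𝒜 δ t ↔ t.Relations)) ∧
    (∀ ρ : osp → PowerSeries (SymbolOp A), IsFormalDeformation 𝒜 δ ρ →
      ∃ t : Params m (PowerSeries A), t.IsFormal 𝒜 ∧ t.Relations ∧
        IsFormalDeformation 𝒜 δ (firstOrderFamily δ t) ∧
        FormallyEquivalent 𝒜 ρ (firstOrderFamily δ t) ∧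
        ∀ s : Params m A, s.IsHomogeneous 𝒜 1 →
          (∀ F : osp, PowerSeries.coeff 1 (ρ F) = s.infinitesimal (F : SuperFun ℝ)) →
          t.map (PowerSeries.coeff 1) = s) := by
  have hδ : 1 ≤ m → 2 * δ = m := fun h => by
    rcases hm with h' | h'
    · exact h'.2
    · omega
  refine ⟨fun t ht => ⟨fun ⟨ρ, hρ, h1⟩ => ?_, fun h => ?_⟩, fun ρ hρ => ?_⟩
  -- An extension is normalized without changing its degree-one parameters, so the degree-two
  -- relation of the normal form is the required relation for t.
  · obtain ⟨τ, -, hτ0, hrel, -, hs⟩ := Params.exists_equivalent_firstOrderFamily hm hρ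
    refine (Params.relations_iff hA ht).mpr fun k => ?_
    rw [← hs t h1, ← Params.relationCoeff_two hτ0, hrel]
  · exact Params.isIntegrable_of_relations hδ ht ((Params.relations_iff hA ht).mp h)
  · obtain ⟨τ, hτ, hτ0, hrel, heq, hs⟩ := Params.exists_equivalent_firstOrderFamily hm hρ
    exact ⟨Params.series τ, Params.isFormal_series hτ hτ0,
      (Params.relations_series_iff hA hτ).mpr hrel,
      Params.isFormalDeformation_firstOrderFamily hδ hτ hτ0 hrel, heq,
      fun s _ h => by rw [Params.map_coeff_series, hs s h]⟩
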